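/- **Setting.** Let $d,N\ge 1$, $d_Z\ge 0$ be integers; all Euclidean spaces carry the max norm $\|\cdot\|$. *Data.* Let $\wp$ be a Markov kernel on $\mathbb R^{d+d_Z}$ with $\mathsf{Wass}_2(\wp(u,\cdot),\wp(u',\cdot))\le L_\wp\|u-u'\|$ for all $u,u'$, where $0\le L_\wp<1$ and $\mathsf{Wass}_2$ is the 2-Wasserstein distance of the max norm, and such that $\wp(u,\{\|u'\|\le 1\})=1$ whenever $\|u\|\le 1$. Let $f:\mathbb R^{d+d_Z+1}\to\mathbb R$ be $L_f$-Lipschitz with $|f|\le L_f$. Let $\mu_\eta$ be a probability measure on $\mathbb R$ and $E\subset\mathbb R$ a Borel set with $\mu_\eta(E)=1$. *Network.* Let $\sigma(y)=(1+e^{-y})^{-1}$, let $\phi,\lambda\in C^2(\mathbb R)$ be bounded with bounded first and second derivatives, and let $|\phi|\le C_\phi$, $|\phi'|\le C_{\phi'}$, $|\phi''|\le C_{\phi''}$. Put $m=\min(N,d)$, $M_\phi=1+\frac{C_\phi}{4-C_\phi}$, $$L_0=\max\Big(\tfrac{3C_{\phi'}}{m}\big(\tfrac{C_\phi M_\phi}{10}+\tfrac14\big),\tfrac{3C_\phi}{4}\Big),\qquad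 L_2=\tfrac{C_{\phi''}}{m}\vee\tfrac{C_{\phi'}^2}{Nd(4-C_\phi)},$$ $$L_1=4\max\Big[\tfrac{M_\phi C_\phi^2}{5m^2}+\tfrac{C_\phi M_\phi^2C_{\phi'}^2}{8m^2}+\tfrac{C_{\phi''}}{4m}+\tfrac{C_\phi}{10}\Big(L_2+\tfrac{C_\phi}{1-C_\phi/4}\big(\tfrac{C_\phi^2M_\phi^2}{10m^2}+\tfrac{L_2}{4}\big)\Big),\ \tfrac{C_\phi M_\phi C_{\phi'}}{5m}+\tfrac{C_{\phi'}}{4N}\Big]\vee C_\phi,$$ and assume $q:=\sqrt{(L_0\vee L_1)^2+L_\wp^2}<1$. *Recursion.* Parameters are $\theta=(A,W,B,c)\in\Theta=\mathbb R^{N\times d}\times\mathbb R^{N\times N}\times\mathbb R^N\times\mathbb R$. States are $h=(u,v,\eta)$ with $u=(x,z)\in\mathbb R^{d}\times\mathbb R^{d_Z}$, $\eta\in\mathbb R$ and $v=(s,\tilde s^{A},\tilde s^{W},\tilde{\tilde s}^{AA},\tilde{\tilde s}^{WA},\tilde{\tilde s}^{WW})$, with entries $s^k$, $\tilde s^{A^{ij},k}$,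 $\tilde s^{W^{ij},k}$, $\tilde{\tilde s}^{A^{nm},A^{ij},k}$, etc. With $$p_k=\tfrac1d\sum_j\phi(A^{kj})x^j+\tfrac1N\sum_\ell\phi(W^{k\ell})s^\ell,\qquad a_{ijk}=\tfrac1d\delta_{ik}\phi'(A^{ij})x^j+\tfrac1N\sum_\ell\phi(W^{k\ell})\tilde s^{A^{ij},\ell},$$ $$w_{ijk}=\tfrac1N\delta_{ik}\phi'(W^{ij})s^j+\tfrac1N\sum_\ell\phi(W^{k\ell})\tilde s^{W^{ij},\ell},$$ let $F^\theta(u,v)$ have the components $F_{S,k}=\sigma(p_k)$, $F_{A^{ij},k}=\sigma'(p_k)a_{ijk}$, $F_{W^{ij},k}=\sigma'(p_k)w_{ijk}$, $$F_{A^{nm},A^{ij},k}=\sigma''(p_k)a_{ijk}a_{nmk}+\sigma'(p_k)\Big(\tfrac1d\delta_{ik}\delta_{ij=nm}\phi''(A^{ij})x^j+\tfrac1N\sum_\ell\phi(W^{k\ell})\tilde{\tilde s}^{A^{ij},A^{nm},\ell}\Big),$$ $$F_{W^{nm},A^{ij},k}=\sigma''(p_k)w_{nmk}a_{ijk}+\sigma'(p_k)\Big(\tfrac1N\delta_{kn}\phi'(W^{nm})\tilde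 s^{A^{ij},m}+\tfrac1N\sum_\ell\phi(W^{k\ell})\tilde{\tilde s}^{W^{nm},A^{ij},\ell}\Big),$$ $$F_{W^{nm},W^{ij},k}=\sigma''(p_k)w_{nmk}w_{ijk}+\sigma'(p_k)\Big(\tfrac1N\delta_{ik}\delta_{ij=nm}\phi''(W^{ij})s^j+\tfrac1N\sum_\ell\phi(W^{k\ell})\tilde{\tilde s}^{W^{nm},W^{ij},\ell}\Big).$$ The joint chain has the transition kernel $P_\theta((u,v,\eta),\cdot)=\wp(u,\cdot)\otimes\delta_{F^\theta(u,v)}\otimes\mu_\eta$; $P_\theta^t$ is its $t$-step kernel. Put $a_{AA}=\frac{C_{\phi'}^2M_\phi^2}{10d^2}+\frac{C_{\phi''}}{4d}$, $a_{WA}=\frac{C_{\phi'}^2M_\phi^2}{10Nd}+\frac{C_{\phi'}^2}{4Nd(4-C_\phi)}$, $a_{WW}=\frac{C_{\phi'}^2M_\phi^2}{10N^2}+\frac{C_{\phi''}}{4N}$, and let $\mathcal R$ be the set of all $h$ with $\|u\|\le1$, $s\in[0,1]^N$, $\|\tilde s^A\|\le\frac{C_{\phi'}}{d(4-C_\phi)}$,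 $\|\tilde s^W\|\le\frac{C_{\phi'}}{N(4-C_\phi)}$, $\|\tilde{\tilde s}^{\bullet}\|\le\frac{a_\bullet}{1-C_\phi/4}$ for $\bullet\in\{AA,WA,WW\}$, and $\eta\in E$. **Statement.** For every $\theta$ there is exactly one probability measure $\mu^\theta$ with $\mu^\theta(\mathcal R)=1$ that is invariant under $P_\theta$. (1) Let $Q(h;\theta)$ be real-valued and Lipschitz in $h\in\mathcal R$ uniformly in $\theta$. Suppose that $E$ is bounded (so that $\mathcal R$ is bounded) or, more generally, that $|Q((u,v,\eta);\theta)-Q((u,v,\eta');\theta)|$ is bounded uniformly over $\theta\in\Theta$ and $(u,v,\eta),(u,v,\eta')\in\mathcal R$. Then for all $h\in\mathcal R$, $\theta\in\Theta$ the integrals below exist, the series $$V(h;\theta)=\sum_{t=0}^\infty\Big(\int_{\mathcal R}Q(\mathsf h;\theta)\,P_\theta^t(h,d\mathsf h)-\int_{\mathcal R}Q(\mathsf h;\theta)\,\mu^\theta(d\mathsf h)\Big)$$ converges absolutely, and $$V(h;\theta)-\int_{\mathcal R}V(\mathsf h;\theta)\,P_\theta(h,d\mathsf h)=Q(h;\theta)-\int_{\mathcal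 R}Q(\mathsf h;\theta)\,\mu^\theta(d\mathsf h).$$ Moreover $V$ is bounded on $\mathcal R\times\Theta$ and is Lipschitz in $h\in\mathcal R$ uniformly in $\theta$. (2) With $r^\theta(h)=f(x,z,\eta)-\langle\lambda(B),s\rangle-\lambda(c)$, the function $L(\theta)=\int_{\mathcal R}\frac12 r^\theta(\mathsf h)^2\,\mu^\theta(d\mathsf h)$ is differentiable. Let $$g^\theta(h)=-r^\theta(h)\Big(\sum_k\lambda(B^k)\tilde s^{A,k},\ \sum_k\lambda(B^k)\tilde s^{W,k},\ \lambda'(B)\odot s,\ \lambda'(c)\Big),\qquad Q(h;\theta)=\nabla L(\theta)^\top g^\theta(h).$$ Then, for every $E$, all conclusions of (1) hold for this $Q$; in addition $\theta\mapsto V(h;\theta)$ is differentiable on $\Theta$ for each $h\in\mathcal R$, and $\partial V/\partial\theta$ is bounded on $\mathcal R\times\Theta$. -/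

import Mathlib

open MeasureTheory ProbabilityTheory
open scoped ENNReal

noncomputable section

namespace RNN

/-- The `p`-Wasserstein distance: the infimum over all couplings `γ` of `μ` and `ν` of
`(∫ ‖x - y‖ ^ p dγ) ^ (1 / p)`, as an extended nonnegative real. -/
def wass {X : Type*} [MeasurableSpace X] [PseudoEMetricSpace X] (p : ℝ) (μ ν : Measure X) :
    ℝ≥0∞ :=
  ⨅ (γ : Measure (X × X)) (_ : γ.map Prod.fst = μ ∧ γ.map Prod.snd = ν),
    (∫⁻ z, edist z.1 z.2 ^ p ∂γ) ^ (1 / p)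

/-! All spaces below are products of copies of `ℝ`; Mathlib's norm on them is the max norm. -/

/-- Data points `u = (x, z)`. -/
abbrev Input (d dZ : ℕ) : Type := (Fin d → ℝ) × (Fin dZ → ℝ)

/-- Parameters `θ = (A, W, B, c)`. -/
abbrev Params (d N : ℕ) : Type :=
  (Fin N → Fin d → ℝ) × (Fin N → Fin N → ℝ) × (Fin N → ℝ) × ℝ

namespace Params

variable {d N : ℕ} (θ : Params d N)

def A : Fin N → Fin d → ℝ := θ.1
def W : Fin N → Fin N → ℝ := θ.2.1
def B : Fin N → ℝ := θ.2.2.1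
def c : ℝ := θ.2.2.2

end Params

/-- Index of the entries of the memory layer, of its first derivatives (with respect to `A` and
`W`) and of its second derivatives (the blocks `AA`, `WA` and `WW`). -/
abbrev HiddenIndex (d N : ℕ) : Type :=
  Fin N ⊕
  (Fin N × Fin d × Fin N) ⊕
  (Fin N × Fin N × Fin N) ⊕
  (Fin N × Fin d × Fin N × Fin d × Fin N) ⊕
  (Fin N × Fin N × Fin N × Fin d × Fin N) ⊕
  (Fin N × Fin N × Fin N × Fin N × Fin N)

/-- Values `v = (s, s̃, s̃̃)` of the memory layer together with its first and second derivatives. -/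
abbrev Hidden (d N : ℕ) : Type := HiddenIndex d N → ℝ

namespace Hidden

variable {d N : ℕ} (v : Hidden d N)

/-- `v.s k` is the `k`-th neuron. -/
def s (k : Fin N) : ℝ := v (.inl k)
/-- `v.sA i j k` is the derivative of neuron `k` in the direction `A i j`. -/
def sA (i : Fin N) (j : Fin d) (k : Fin N) : ℝ := v (.inr (.inl (i, j, k)))
/-- `v.sW i j k` is the derivative of neuron `k` in the direction `W i j`. -/
def sW (i j k : Fin N) : ℝ := v (.inr (.inr (.inl (i, j, k))))
/-- `v.sAA n m i j k` is the second derivative of neuron `k` in the directions `A n m`, `A i j`. -/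
def sAA (n : Fin N) (m : Fin d) (i : Fin N) (j : Fin d) (k : Fin N) : ℝ := v (.inr (.inr (.inr (.inl (n, m, i, j, k)))))
/-- `v.sWA n m i j k` is the second derivative of neuron `k` in the directions `W n m`, `A i j`. -/
def sWA (n m i : Fin N) (j : Fin d) (k : Fin N) : ℝ := v (.inr (.inr (.inr (.inr (.inl (n, m, i, j, k))))))
/-- `v.sWW n m i j k` is the second derivative of neuron `k` in the directions `W n m`, `W i j`. -/
def sWW (n m i j k : Fin N) : ℝ := v (.inr (.inr (.inr (.inr (.inr (n, m, i, j, k))))))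

end Hidden

/-- States `h = (u, v, η)` of the joint chain. -/
abbrev State (d dZ N : ℕ) : Type := Input d dZ × Hidden d N × ℝ

/-- The data of the problem: the transition kernel of the input chain `(X_t, Z_t)`, the output map
`f`, the law of the noise `η_t` and a set of values of the noise, the functions `φ` and `λ` (written
`lam`), and the constants that bound them. -/
structure Model (d dZ N : ℕ) where
  ker : Kernel (Input d dZ) (Input d dZ)
  ker_markov : IsMarkovKernel ker
  f : Input d dZ × ℝ → ℝ
  noise : Measure ℝ
  noise_prob : IsProbabilityMeasure noise
  noiseSet : Set ℝ
  φ : ℝ → ℝ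
  lam : ℝ → ℝ
  /-- contraction constant of the input chain -/
  Lker : ℝ
  /-- Lipschitz constant and bound of `f` -/
  Lf : ℝ
  /-- bound of `|φ|` -/
  Cφ : ℝ
  /-- bound of the first derivative of `φ` -/
  Cφ₁ : ℝ
  /-- bound of the second derivative of `φ` -/
  Cφ₂ : ℝ

namespace Model

variable {d dZ N : ℕ} (M : Model d dZ N)

/-! ### Constants -/

def Mφ : ℝ := 1 + M.Cφ / (4 - M.Cφ)

/-- `min(N, d)` as a real number; the argument is only there to fix `N` and `d`. -/
def minNd (_M : Model d dZ N) : ℝ := ((min N d : ℕ) : ℝ)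

def L₀ : ℝ :=
  max (3 * M.Cφ₁ / M.minNd * (M.Cφ * M.Mφ / 10 + 1 / 4)) (3 * M.Cφ / 4)

def L₂ : ℝ :=
  max (M.Cφ₂ / M.minNd) (M.Cφ₁ ^ 2 / ((N : ℝ) * d * (4 - M.Cφ)))

def L₁ : ℝ :=
  max
    (4 * max
      (M.Mφ * M.Cφ ^ 2 / (5 * M.minNd ^ 2)
        + M.Cφ * M.Mφ ^ 2 * M.Cφ₁ ^ 2 / (8 * M.minNd ^ 2)
        + M.Cφ₂ / (4 * M.minNd)
        + M.Cφ / 10 * (M.L₂ + M.Cφ / (1 - M.Cφ / 4)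
            * (M.Cφ ^ 2 * M.Mφ ^ 2 / (10 * M.minNd ^ 2) + 1 / 4 * M.L₂)))
      (M.Cφ * M.Mφ * M.Cφ₁ / (5 * M.minNd) + M.Cφ₁ / (4 * N)))
    M.Cφ

/-- The contraction rate `q = √(L² + L_℘²)` with `L = L₀ ∨ L₁`. -/
def q : ℝ := Real.sqrt ((max M.L₀ M.L₁) ^ 2 + M.Lker ^ 2)

/-- The standing assumptions. -/
structure Assumptions : Prop where
  Lker_nonneg : 0 ≤ M.Lker
  Lker_lt_one : M.Lker < 1
  /-- the input chain is contractive in the 2-Wasserstein distance of the max norm -/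
  ker_contract : ∀ u u' : Input d dZ,
    wass 2 (M.ker u) (M.ker u') ≤ ENNReal.ofReal (M.Lker * ‖u - u'‖)
  /-- the input chain stays in the unit ball of the max norm -/
  ker_bounded : ∀ u : Input d dZ, ‖u‖ ≤ 1 → M.ker u {u' | ‖u'‖ ≤ 1} = 1
  f_lipschitz : ∀ p p' : Input d dZ × ℝ, |M.f p - M.f p'| ≤ M.Lf * ‖p - p'‖
  f_bounded : ∀ p : Input d dZ × ℝ, |M.f p| ≤ M.Lf
  /-- the noise takes its values in `noiseSet` -/
  noiseSet_meas : MeasurableSet M.noiseSet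
  noise_mem : M.noise M.noiseSet = 1
  φ_smooth : ContDiff ℝ 2 M.φ
  φ_bound : ∀ y, |M.φ y| ≤ M.Cφ
  φ_bound₁ : ∀ y, |deriv M.φ y| ≤ M.Cφ₁
  φ_bound₂ : ∀ y, |deriv (deriv M.φ) y| ≤ M.Cφ₂
  lam_smooth : ContDiff ℝ 2 M.lam
  lam_bound : ∃ C, ∀ y, |M.lam y| ≤ C
  lam_bound₁ : ∃ C, ∀ y, |deriv M.lam y| ≤ C
  lam_bound₂ : ∃ C, ∀ y, |deriv (deriv M.lam) y| ≤ C
  q_lt_one : M.q < 1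

/-! ### The recursion `v ↦ F^θ(u, v)` -/

/-- The argument `⟨φ(A^{k,:}), x⟩ / d + ⟨φ(W^{k,:}), s⟩ / N` of the sigmoid. -/
def pre (θ : Params d N) (u : Input d dZ) (v : Hidden d N) (k : Fin N) : ℝ :=
  1 / (d : ℝ) * ∑ j, M.φ (θ.A k j) * u.1 j + 1 / (N : ℝ) * ∑ l, M.φ (θ.W k l) * v.s l

/-- Derivative of `pre` in the direction `A i j`. -/
def preA (θ : Params d N) (u : Input d dZ) (v : Hidden d N) (i : Fin N) (j : Fin d) (k : Fin N) :
    ℝ :=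
  1 / (d : ℝ) * (if i = k then 1 else 0) * deriv M.φ (θ.A i j) * u.1 j
    + 1 / (N : ℝ) * ∑ l, M.φ (θ.W k l) * v.sA i j l

/-- Derivative of `pre` in the direction `W i j`. -/
def preW (θ : Params d N) (v : Hidden d N) (i j k : Fin N) : ℝ :=
  1 / (N : ℝ) * (if i = k then 1 else 0) * deriv M.φ (θ.W i j) * v.s j
    + 1 / (N : ℝ) * ∑ l, M.φ (θ.W k l) * v.sW i j l

def FS (θ : Params d N) (u : Input d dZ) (v : Hidden d N) (k : Fin N) : ℝ :=
  Real.sigmoid (M.pre θ u v k)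

def FA (θ : Params d N) (u : Input d dZ) (v : Hidden d N) (i : Fin N) (j : Fin d) (k : Fin N) : ℝ :=
  deriv Real.sigmoid (M.pre θ u v k) * M.preA θ u v i j k

def FW (θ : Params d N) (u : Input d dZ) (v : Hidden d N) (i j k : Fin N) : ℝ :=
  deriv Real.sigmoid (M.pre θ u v k) * M.preW θ v i j k

def FAA (θ : Params d N) (u : Input d dZ) (v : Hidden d N)
    (n : Fin N) (m : Fin d) (i : Fin N) (j : Fin d) (k : Fin N) : ℝ :=
  deriv (deriv Real.sigmoid) (M.pre θ u v k) * M.preA θ u v i j k * M.preA θ u v n m k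
    + deriv Real.sigmoid (M.pre θ u v k) *
      (1 / (d : ℝ) * (if i = k then 1 else 0) * (if i = n ∧ j = m then 1 else 0)
          * deriv (deriv M.φ) (θ.A i j) * u.1 j
        + 1 / (N : ℝ) * ∑ l, M.φ (θ.W k l) * v.sAA i j n m l)

def FWA (θ : Params d N) (u : Input d dZ) (v : Hidden d N)
    (n m i : Fin N) (j : Fin d) (k : Fin N) : ℝ :=
  deriv (deriv Real.sigmoid) (M.pre θ u v k) * M.preW θ v n m k * M.preA θ u v i j k
    + deriv Real.sigmoid (M.pre θ u v k) *
      (1 / (N : ℝ) * (if k = n then 1 else 0) * deriv M.φ (θ.W n m) * v.sA i j m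
        + 1 / (N : ℝ) * ∑ l, M.φ (θ.W k l) * v.sWA n m i j l)

def FWW (θ : Params d N) (u : Input d dZ) (v : Hidden d N) (n m i j k : Fin N) : ℝ :=
  deriv (deriv Real.sigmoid) (M.pre θ u v k) * M.preW θ v n m k * M.preW θ v i j k
    + deriv Real.sigmoid (M.pre θ u v k) *
      (1 / (N : ℝ) * (if i = k then 1 else 0) * (if i = n ∧ j = m then 1 else 0)
          * deriv (deriv M.φ) (θ.W i j) * v.s j
        + 1 / (N : ℝ) * ∑ l, M.φ (θ.W k l) * v.sWW n m i j l)

/-- The function `F^θ` with `(S, S̃, S̃̃)_{t+1} = F^θ(U_t, (S, S̃, S̃̃)_t)`. -/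
def F (θ : Params d N) (u : Input d dZ) (v : Hidden d N) : Hidden d N
  | .inl k => M.FS θ u v k
  | .inr (.inl (i, j, k)) => M.FA θ u v i j k
  | .inr (.inr (.inl (i, j, k))) => M.FW θ u v i j k
  | .inr (.inr (.inr (.inl (n, m, i, j, k)))) => M.FAA θ u v n m i j k
  | .inr (.inr (.inr (.inr (.inl (n, m, i, j, k))))) => M.FWA θ u v n m i j k
  | .inr (.inr (.inr (.inr (.inr (n, m, i, j, k))))) => M.FWW θ u v n m i j k

theorem measurable_F (θ : Params d N) :
    Measurable (fun h : State d dZ N => M.F θ h.1 h.2.1) := by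
  have h0 : Continuous Real.sigmoid := continuous_sigmoid
  have h1 : Continuous (deriv Real.sigmoid) := by
    rw [Real.deriv_sigmoid]; fun_prop
  have h2 : Continuous (deriv (deriv Real.sigmoid)) := by
    have h : ContDiff ℝ 2 Real.sigmoid := contDiff_sigmoid.of_le le_top
    have h' := h.continuous_iteratedDeriv 2 le_rfl
    rwa [iteratedDeriv_succ, iteratedDeriv_one] at h'
  have hp : ∀ k, Continuous (fun h : State d dZ N => M.pre θ h.1 h.2.1 k) := by
    intro k; unfold pre Hidden.s; fun_prop
  have hA : ∀ i j k, Continuous (fun h : State d dZ N => M.preA θ h.1 h.2.1 i j k) := by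
    intro i j k; unfold preA Hidden.sA; fun_prop
  have hW : ∀ i j k, Continuous (fun h : State d dZ N => M.preW θ h.2.1 i j k) := by
    intro i j k; unfold preW Hidden.s Hidden.sW; fun_prop
  apply Continuous.measurable
  refine continuous_pi ?_
  rintro (k | ⟨i, j, k⟩ | ⟨i, j, k⟩ | ⟨n, m, i, j, k⟩ | ⟨n, m, i, j, k⟩ | ⟨n, m, i, j, k⟩)
  · exact h0.comp (hp k)
  · exact (h1.comp (hp k)).mul (hA i j k)
  · exact (h1.comp (hp k)).mul (hW i j k)
  · refine (((h2.comp (hp k)).mul (hA i j k)).mul (hA n m k)).add ((h1.comp (hp k)).mul ?_)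
    unfold Hidden.sAA; fun_prop
  · refine (((h2.comp (hp k)).mul (hW n m k)).mul (hA i j k)).add ((h1.comp (hp k)).mul ?_)
    unfold Hidden.sWA Hidden.sA; fun_prop
  · refine (((h2.comp (hp k)).mul (hW n m k)).mul (hW i j k)).add ((h1.comp (hp k)).mul ?_)
    unfold Hidden.sWW Hidden.s; fun_prop

/-! ### The joint Markov chain -/

/-- The transition kernel `P_θ((u, v, η), ·) = ℘(u, ·) ⊗ δ_{F^θ(u, v)} ⊗ μ_η`; its `t`-step
transition kernel is the power `(M.P θ) ^ t`, multiplication of kernels being composition. -/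
def P (θ : Params d N) : Kernel (State d dZ N) (State d dZ N) :=
  (M.ker.comap (fun h : State d dZ N => h.1) measurable_fst) ×ₖ
    ((Kernel.deterministic (fun h : State d dZ N => M.F θ h.1 h.2.1) (M.measurable_F θ)) ×ₖ
      (Kernel.const (State d dZ N) M.noise))

def aAA : ℝ := M.Cφ₁ ^ 2 * M.Mφ ^ 2 / (10 * (d : ℝ) ^ 2) + M.Cφ₂ / (4 * d)

def aWA : ℝ :=
  M.Cφ₁ ^ 2 * M.Mφ ^ 2 / (10 * (N : ℝ) * d) + M.Cφ₁ ^ 2 / (4 * (N : ℝ) * d * (4 - M.Cφ))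

def aWW : ℝ := M.Cφ₁ ^ 2 * M.Mφ ^ 2 / (10 * (N : ℝ) ^ 2) + M.Cφ₂ / (4 * N)

/-- The hyper-rectangle `R` in which the joint chain lives. -/
def R : Set (State d dZ N) :=
  {h | (∀ j, |h.1.1 j| ≤ 1) ∧ (∀ j, |h.1.2 j| ≤ 1) ∧
    (∀ k, 0 ≤ h.2.1.s k ∧ h.2.1.s k ≤ 1) ∧
    (∀ i j k, |h.2.1.sA i j k| ≤ M.Cφ₁ / (d * (4 - M.Cφ))) ∧
    (∀ i j k, |h.2.1.sW i j k| ≤ M.Cφ₁ / (N * (4 - M.Cφ))) ∧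
    (∀ n m i j k, |h.2.1.sAA n m i j k| ≤ M.aAA / (1 - M.Cφ / 4)) ∧
    (∀ n m i j k, |h.2.1.sWA n m i j k| ≤ M.aWA / (1 - M.Cφ / 4)) ∧
    (∀ n m i j k, |h.2.1.sWW n m i j k| ≤ M.aWW / (1 - M.Cφ / 4)) ∧
    h.2.2 ∈ M.noiseSet}

/-- `μ` is a stationary distribution of `P_θ` on `R`. -/
def IsStationary (θ : Params d N) (μ : Measure (State d dZ N)) : Prop :=
  IsProbabilityMeasure μ ∧ μ M.R = 1 ∧ (M.P θ).Invariant μ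

/-- The stationary distribution `μ^θ`. -/
def stationary (θ : Params d N) : Measure (State d dZ N) :=
  Classical.epsilon (M.IsStationary θ)

/-! ### The Poisson equation -/

/-- The `t`-th term `∫_R Q(·; θ) dP_θ^t(h, ·) - ∫_R Q(·; θ) dμ^θ` of the series. -/
def poissonTerm (Q : Params d N → State d dZ N → ℝ) (θ : Params d N) (h : State d dZ N) (t : ℕ) :
    ℝ :=
  (∫ y in M.R, Q θ y ∂((M.P θ ^ t) h)) - ∫ y in M.R, Q θ y ∂(M.stationary θ)

/-- `V(h; θ) = ∑_t (∫_R Q(·; θ) dP_θ^t(h, ·) - ∫_R Q(·; θ) dμ^θ)`. -/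
def V (Q : Params d N → State d dZ N → ℝ) (θ : Params d N) (h : State d dZ N) : ℝ :=
  ∑' t, M.poissonTerm Q θ h t

/-- The series defining `V` converges: all the integrals exist and the terms are summable. -/
def SeriesConverges (Q : Params d N → State d dZ N → ℝ) : Prop :=
  ∀ θ, IntegrableOn (Q θ) M.R (M.stationary θ) ∧
    ∀ h ∈ M.R, (∀ t : ℕ, IntegrableOn (Q θ) M.R ((M.P θ ^ t) h)) ∧
      Summable (M.poissonTerm Q θ h)

/-- `w` solves the Poisson equation
`w(h; θ) - ∫_R w(·; θ) dP_θ(h, ·) = Q(h; θ) - ∫_R Q(·; θ) dμ^θ` for all `h ∈ R`. -/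
def SolvesPoisson (Q w : Params d N → State d dZ N → ℝ) : Prop :=
  ∀ θ, IntegrableOn (Q θ) M.R (M.stationary θ) ∧
    ∀ h ∈ M.R, IntegrableOn (w θ) M.R (M.P θ h) ∧
      w θ h - ∫ y in M.R, w θ y ∂(M.P θ h) = Q θ h - ∫ y in M.R, Q θ y ∂(M.stationary θ)

/-- Bounded on `R`, uniformly in `(h, θ)`. -/
def UnifBounded (w : Params d N → State d dZ N → ℝ) : Prop :=
  ∃ C : ℝ, ∀ θ, ∀ h ∈ M.R, |w θ h| ≤ C

/-- Globally Lipschitz in `h ∈ R` for the max norm, uniformly in `θ`. -/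
def UnifLipschitz (w : Params d N → State d dZ N → ℝ) : Prop :=
  ∃ C : ℝ, ∀ θ, ∀ h ∈ M.R, ∀ h' ∈ M.R, |w θ h - w θ h'| ≤ C * ‖h - h'‖

/-- Bounded oscillation in the noise variable. For a uniformly Lipschitz function this is automatic
as soon as the set of values of the noise is bounded. -/
def BoundedNoiseOsc (w : Params d N → State d dZ N → ℝ) : Prop :=
  ∃ D : ℝ, ∀ θ u v η η', (u, v, η) ∈ M.R → (u, v, η') ∈ M.R →
    |w θ (u, v, η) - w θ (u, v, η')| ≤ D

/-! ### The loss and the function `Q = ∇L^⊤ g^θ` -/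

/-- The residual `f(x, z, η) - ⟨λ(B), s⟩ - λ(c)`. -/
def residual (θ : Params d N) (h : State d dZ N) : ℝ :=
  M.f (h.1, h.2.2) - ∑ k, M.lam (θ.B k) * h.2.1.s k - M.lam θ.c

/-- The limit loss `L(θ)`. -/
def loss (θ : Params d N) : ℝ :=
  ∫ h in M.R, 1 / 2 * M.residual θ h ^ 2 ∂(M.stationary θ)

/-- The vector `g^θ(h)`, with its entries arranged in the shape of `θ`. -/
def g (θ : Params d N) (h : State d dZ N) : Params d N :=
  (fun i j => -M.residual θ h * ∑ k, M.lam (θ.B k) * h.2.1.sA i j k,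
   fun i j => -M.residual θ h * ∑ k, M.lam (θ.B k) * h.2.1.sW i j k,
   fun i => -M.residual θ h * (deriv M.lam (θ.B i) * h.2.1.s i),
   -M.residual θ h * deriv M.lam θ.c)

/-- `Q(h; θ) = ∇L(θ)^⊤ g^θ(h)`, the derivative of `L` at `θ` applied to the vector `g^θ(h)`. -/
def gradQ (θ : Params d N) (h : State d dZ N) : ℝ :=
  fderiv ℝ M.loss θ (M.g θ h)

end Model

end RNN

end

/-!
Of the assumption `q < 1` only `Cφ < 1` and `Lker < 1` are used, through two contractions.

*The memory contracts.* The entries of the memory layer have levels `0`, `1`, `2`, the order of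
differentiation that they stand for. Once the entries of lower levels are fixed, an update is affine
in the entries of its own level (a sigmoid of an affine function for level `0`), with Lipschitz
constant at most `Cφ / 4`, as `|σ'| ≤ 1 / 4` (`abs_netF_add_sub_le`). Lower levels may have a large
influence, but if entries of level `k` are multiplied by `β ^ k` for a small `β`, then their influence
becomes small and the recursion contracts the hyper-rectangle with rate `1 / 2`
(`norm_levelScale_fderiv_le`). The bounds that define the hyper-rectangle are fixed points of
the recursions for the bounds, so it is preserved (`Model.Assumptions.preserves_netF`).

*The chain contracts.* A nearly optimal coupling of the inputs, which contract in the Wasserstein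
distance, together with the contraction of the memory shows that expectations of Lipschitz observables
forget the initial state geometrically fast, uniformly in the parameter
(`Driver.norm_iter_succ_sub_le`). After one step the initial noise is forgotten altogether, so that
only the oscillation of `Q` in the noise has to be bounded. This gives uniqueness of the stationary
distribution (`Driver.eq_of_invariant`), existence by tightness (`Driver.exists_invariant`), and
absolute convergence, the Poisson equation, and the bounds of the solution
(`Model.Assumptions.poisson`).

*Derivatives in the parameter.* Augment the chain by the derivative `J` of the memory in the
parameter. This tangent chain contracts as well (`ParamSystem.contracts_tangentMap`), and at nearby
parameters the memories differ by `J Δ` up to a small multiple of the norm of the difference `Δ` of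
the parameters, at all times (`FirstOrder.step`). Therefore expectations at
time `t` are differentiable (`Driver.hasFDerivAt_meanObs`), their derivatives converge geometrically
and uniformly (`Driver.exists_norm_meanTangentObs_sub_le`), and limits and series can be
differentiated term by term (`exists_hasFDerivAt_limit`, `hasFDerivAt_tsum_sub_limit`).

To have a compact set of parameters, the recursion is written as a function of the jet of `θ`,
the values of `φ`, `λ` and of their derivatives at the entries of `θ`. As `φ''` need not be
differentiable, neither is the full jet, but the residual and the vector `g` depend on entries of
level at most `1` only, which do not see `φ''`. So the differentiable curve `Model.jet₁`, with the
second derivatives replaced by zero, has the same expectations (`meanObs_jet₁_eq`).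

*The gradient of the loss.* Started from the zero memory, the entries of level `1` are exactly the
derivative of `s` in the parameter (`StoresDerivative.tangentMap`), hence `∇L = ∫ g dμ`
(`hasFDerivAt_loss`). The Poisson equation is linear, so `V` for `∇L^⊤ g` is the pairing of `∫ g dμ`
with the solution for `g` (`V_gradQ_eq`). Both factors are bounded and have bounded derivatives.
-/

set_option linter.unusedSectionVars false

noncomputable section

namespace RNN

/-! ### Comparing integrals through the Wasserstein distance -/

theorem lintegral_le_sqrt_lintegral_sq {X : Type*} [MeasurableSpace X] (μ : Measure X)
    [IsProbabilityMeasure μ] {f : X → ℝ≥0∞} (hf : AEMeasurable f μ) :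
    ∫⁻ x, f x ∂μ ≤ (∫⁻ x, f x ^ (2 : ℝ) ∂μ) ^ (1 / (2 : ℝ)) := by
  have := ENNReal.lintegral_mul_le_Lp_mul_Lq μ Real.HolderConjugate.two_two hf
    (aemeasurable_const (b := (1 : ℝ≥0∞)))
  simpa using this

/-- If `‖f x - g y‖ ≤ a + A ‖x - y‖` on a set that carries both measures, then the integrals of `f`
and `g` differ by at most `a + A ℓ`, where `ℓ` bounds the Wasserstein distance. -/
theorem norm_integral_sub_le_of_wass {X F : Type*} [NormedAddCommGroup X] [MeasurableSpace X]
    [BorelSpace X] [SecondCountableTopology X] [NormedAddCommGroup F] [NormedSpace ℝ F]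
    {μ ν : Measure X} [IsProbabilityMeasure μ] [IsProbabilityMeasure ν] {B : Set X}
    (hμ : ∀ᵐ x ∂μ, x ∈ B) (hν : ∀ᵐ x ∂ν, x ∈ B) {f g : X → F} (hf : Integrable f μ)
    (hg : Integrable g ν) {a A ℓ : ℝ} (hA : 0 ≤ A) (hℓ : 0 ≤ ℓ)
    (h : ∀ x ∈ B, ∀ y ∈ B, ‖f x - g y‖ ≤ a + A * ‖x - y‖)
    (hw : wass 2 μ ν ≤ ENNReal.ofReal ℓ) :
    ‖∫ x, f x ∂μ - ∫ x, g x ∂ν‖ ≤ a + A * ℓ := by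
  have key : ∀ ε > 0, ‖∫ x, f x ∂μ - ∫ x, g x ∂ν‖ ≤ a + A * (ℓ + ε) := by
    intro ε hε
    have hlt : wass 2 μ ν < ENNReal.ofReal (ℓ + ε) :=
      hw.trans_lt ((ENNReal.ofReal_lt_ofReal_iff (by linarith)).2 (by linarith))
    simp only [wass, iInf_lt_iff] at hlt
    obtain ⟨γ, ⟨h1, h2⟩, hγ⟩ := hlt
    have : IsProbabilityMeasure γ := by
      refine ⟨?_⟩
      have := congrArg (fun m => m Set.univ) h1
      simpa [Measure.map_apply measurable_fst] using this
    have e1 : ∫ x, f x ∂μ = ∫ z, f z.1 ∂γ := by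
      subst h1
      exact integral_map measurable_fst.aemeasurable hf.1
    have e2 : ∫ x, g x ∂ν = ∫ z, g z.2 ∂γ := by
      subst h2
      exact integral_map measurable_snd.aemeasurable hg.1
    have i1 : Integrable (fun z : X × X => f z.1) γ := by
      subst h1
      exact (integrable_map_measure hf.1 measurable_fst.aemeasurable).1 hf
    have i2 : Integrable (fun z : X × X => g z.2) γ := by
      subst h2
      exact (integrable_map_measure hg.1 measurable_snd.aemeasurable).1 hg
    have hmeas : Measurable fun z : X × X => edist z.1 z.2 := by fun_prop
    have hle : ∫⁻ z, edist z.1 z.2 ∂γ ≤ ENNReal.ofReal (ℓ + ε) :=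
      (lintegral_le_sqrt_lintegral_sq γ hmeas.aemeasurable).trans hγ.le
    have hcon : ∀ z : X × X, ‖z.1 - z.2‖ₑ = edist z.1 z.2 := fun z => (edist_eq_enorm_sub _ _).symm
    have i3 : Integrable (fun z : X × X => ‖z.1 - z.2‖) γ := by
      refine Integrable.norm ⟨(measurable_fst.sub measurable_snd).aestronglyMeasurable, ?_⟩
      simp only [HasFiniteIntegral, hcon]
      exact hle.trans_lt ENNReal.ofReal_lt_top
    have i4 : ∫ z : X × X, ‖z.1 - z.2‖ ∂γ ≤ ℓ + ε := by
      rw [integral_norm_eq_lintegral_enorm (f := fun z : X × X => z.1 - z.2)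
        (measurable_fst.sub measurable_snd).aestronglyMeasurable]
      simp only [hcon]
      exact ENNReal.toReal_le_of_le_ofReal (by linarith) hle
    have a1 : ∀ᵐ z ∂γ, z.1 ∈ B := by
      subst h1; exact ae_of_ae_map measurable_fst.aemeasurable hμ
    have a2 : ∀ᵐ z ∂γ, z.2 ∈ B := by
      subst h2; exact ae_of_ae_map measurable_snd.aemeasurable hν
    rw [e1, e2, ← integral_sub i1 i2]
    calc ‖∫ z, (f z.1 - g z.2) ∂γ‖ ≤ ∫ z, (a + A * ‖z.1 - z.2‖) ∂γ := by
          refine norm_integral_le_of_norm_le ((integrable_const a).add (i3.const_mul A)) ?_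
          filter_upwards [a1, a2] with z h1 h2 using h _ h1 _ h2
      _ = a + A * ∫ z : X × X, ‖z.1 - z.2‖ ∂γ := by
          rw [integral_add (integrable_const a) (i3.const_mul A), integral_const_mul]
          simp
      _ ≤ a + A * (ℓ + ε) := by gcongr
  refine le_of_forall_pos_le_add fun ε hε => ?_
  have hA1 : 0 < A + 1 := by linarith
  refine (key (ε / (A + 1)) (by positivity)).trans ?_
  have : A * (ε / (A + 1)) ≤ ε := by
    rw [mul_div_assoc', div_le_iff₀ hA1]; nlinarith
  linarith

/-! ### Chains driven by a contracting input chain -/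

/-- A map `G` updates the memory `w` with the current input `u`; the input moves by `κ` and a fresh
noise with law `ν` is drawn. -/
def drive {U W : Type*} [MeasurableSpace U] [MeasurableSpace W] (κ : Kernel U U) (ν : Measure ℝ)
    (G : U → W → W) (hG : Measurable fun h : U × W × ℝ => G h.1 h.2.1) :
    Kernel (U × W × ℝ) (U × W × ℝ) :=
  (κ.comap (fun h : U × W × ℝ => h.1) measurable_fst) ×ₖ
    ((Kernel.deterministic (fun h : U × W × ℝ => G h.1 h.2.1) hG) ×ₖ
      (Kernel.const (U × W × ℝ) ν))

/-- The assumptions on the input chain `κ`, with contraction constant `ℓ`, and on the noise law `ν`,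
which is carried by `E`. -/
structure Driver {U : Type*} [NormedAddCommGroup U] [MeasurableSpace U] (κ : Kernel U U)
    (ν : Measure ℝ) (ℓ : ℝ) (E : Set ℝ) : Prop where
  markov : IsMarkovKernel κ
  prob : IsProbabilityMeasure ν
  nonneg : 0 ≤ ℓ
  lt_one : ℓ < 1
  contract : ∀ u u' : U, wass 2 (κ u) (κ u') ≤ ENNReal.ofReal (ℓ * ‖u - u'‖)
  bounded : ∀ u : U, ‖u‖ ≤ 1 → κ u {u' | ‖u'‖ ≤ 1} = 1
  meas : MeasurableSet E
  mem : ν E = 1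

/-- States with input in the unit ball, memory in `S` and noise in `E`. -/
def region (U : Type*) [NormedAddCommGroup U] {W : Type*} (S : Set W) (E : Set ℝ) :
    Set (U × W × ℝ) :=
  {h | ‖h.1‖ ≤ 1 ∧ h.2.1 ∈ S ∧ h.2.2 ∈ E}

/-- `S` is invariant under `G(u, ·)` for every `u` in the unit ball. -/
def Preserves {U W : Type*} [NormedAddCommGroup U] (G : U → W → W) (S : Set W) : Prop :=
  ∀ u, ‖u‖ ≤ 1 → ∀ w ∈ S, G u w ∈ S

/-- The integral of `ψ` after `t` steps from the state `h`. -/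
def iter {X F : Type*} [MeasurableSpace X] [NormedAddCommGroup F] [NormedSpace ℝ F]
    (P : Kernel X X) (t : ℕ) (ψ : X → F) (h : X) : F :=
  ∫ y, ψ y ∂((P ^ t) h)

/-- A strongly measurable function that is bounded by `C` on `R`. -/
structure Observable {X F : Type*} [MeasurableSpace X] [NormedAddCommGroup F]
    (R : Set X) (ψ : X → F) (C : ℝ) : Prop where
  meas : StronglyMeasurable ψ
  bound : ∀ h ∈ R, ‖ψ h‖ ≤ C

section Pow

variable {X F : Type*} [MeasurableSpace X] [NormedAddCommGroup F] [NormedSpace ℝ F]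
  {P : Kernel X X} {R : Set X}

theorem integral_bind_kernel {κ : Kernel X X} {μ : Measure X} {ψ : X → F}
    (hψ : Integrable ψ (μ.bind κ)) : ∫ y, ψ y ∂(μ.bind κ) = ∫ x, ∫ y, ψ y ∂κ x ∂μ := by
  have e : μ.bind κ = (κ ∘ₖ Kernel.const Unit μ) () := by
    rw [Kernel.comp_apply, Kernel.const_apply]
  rw [e] at hψ ⊢
  rw [Kernel.integral_comp hψ, Kernel.const_apply]

theorem pow_succ_apply (t : ℕ) (h : X) : (P ^ (t + 1)) h = ((P ^ t) ∘ₖ P) h := by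
  rw [pow_succ]; rfl

theorem iter_zero [CompleteSpace F] {ψ : X → F} (hψ : StronglyMeasurable ψ) (h : X) : iter P 0 ψ h = ψ h := by
  rw [iter, pow_zero]
  change ∫ y, ψ y ∂(Kernel.id h) = _
  rw [Kernel.id_apply, integral_dirac' _ _ hψ]

variable [IsMarkovKernel P]

instance isMarkovKernel_pow (t : ℕ) : IsMarkovKernel (P ^ t) := by
  induction t with
  | zero => rw [pow_zero]; exact inferInstanceAs (IsMarkovKernel Kernel.id)
  | succ t ih => rw [pow_succ]; exact inferInstanceAs (IsMarkovKernel ((P ^ t) ∘ₖ P))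

theorem ae_pow_mem (hR : MeasurableSet R) (hP : ∀ h ∈ R, ∀ᵐ y ∂P h, y ∈ R) (t : ℕ) {h : X}
    (hh : h ∈ R) : ∀ᵐ y ∂(P ^ t) h, y ∈ R := by
  induction t generalizing h with
  | zero =>
    rw [pow_zero]
    change ∀ᵐ y ∂(Kernel.id h), y ∈ R
    rw [Kernel.id_apply]; exact (ae_dirac_iff hR).2 hh
  | succ t ih =>
    rw [pow_succ_apply]
    rw [ae_iff]
    have : {a | ¬ a ∈ R} = Rᶜ := rfl
    rw [this, Kernel.comp_apply' _ _ _ hR.compl, lintegral_eq_zero_iff (Kernel.measurable_coe _ hR.compl)]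
    filter_upwards [hP h hh] with y hy
    exact ae_iff.1 (ih hy)

theorem Observable.integrable {ψ : X → F} {C : ℝ} (hψ : Observable R ψ C) {μ : Measure X}
    [IsFiniteMeasure μ] (hμ : ∀ᵐ y ∂μ, y ∈ R) : Integrable ψ μ :=
  Integrable.of_bound hψ.meas.aestronglyMeasurable C (hμ.mono hψ.bound)

theorem Observable.norm_integral_le {ψ : X → F} {C : ℝ} (hψ : Observable R ψ C) {μ : Measure X}
    [IsProbabilityMeasure μ] (hμ : ∀ᵐ y ∂μ, y ∈ R) : ‖∫ y, ψ y ∂μ‖ ≤ C := by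
  simpa using norm_integral_le_of_norm_le_const (hμ.mono hψ.bound)

theorem Observable.iter (hR : MeasurableSet R) (hP : ∀ h ∈ R, ∀ᵐ y ∂P h, y ∈ R) {ψ : X → F}
    {C : ℝ} (hψ : Observable R ψ C) (t : ℕ) : Observable R (iter P t ψ) C where
  meas := hψ.meas.integral_kernel
  bound _ hh := hψ.norm_integral_le (ae_pow_mem hR hP t hh)

theorem iter_succ (hR : MeasurableSet R) (hP : ∀ h ∈ R, ∀ᵐ y ∂P h, y ∈ R) {ψ : X → F}
    {C : ℝ} (hψ : Observable R ψ C) (t : ℕ) {h : X} (hh : h ∈ R) :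
    RNN.iter P (t + 1) ψ h = ∫ y, RNN.iter P t ψ y ∂P h := by
  have hi := hψ.integrable (ae_pow_mem hR hP (t + 1) hh)
  rw [pow_succ_apply] at hi
  rw [RNN.iter, pow_succ_apply, Kernel.integral_comp hi]
  rfl

end Pow

section Drive

variable {U W W' F : Type*} [NormedAddCommGroup U] [MeasurableSpace U] [BorelSpace U]
  [SecondCountableTopology U] [MeasurableSpace W] [MeasurableSpace W']
  [NormedAddCommGroup F] [NormedSpace ℝ F]
  {κ : Kernel U U} {ν : Measure ℝ} {ℓ : ℝ} {E : Set ℝ}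
  {G : U → W → W} {hG : Measurable fun h : U × W × ℝ => G h.1 h.2.1} {S : Set W}
  {G' : U → W' → W'} {hG' : Measurable fun h : U × W' × ℝ => G' h.1 h.2.1} {S' : Set W'}

theorem measurableSet_region (hS : MeasurableSet S) (hE : MeasurableSet E) :
    MeasurableSet (region U S E) := by
  have h1 : MeasurableSet {h : U × W × ℝ | ‖h.1‖ ≤ 1} :=
    measurableSet_le measurable_fst.norm measurable_const
  exact h1.inter ((measurable_snd.fst hS).inter (measurable_snd.snd hE))

theorem Driver.isMarkovKernel_drive (hD : Driver κ ν ℓ E) : IsMarkovKernel (drive κ ν G hG) := by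
  have := hD.markov
  have := hD.prob
  unfold drive; infer_instance

theorem Driver.drive_apply (hD : Driver κ ν ℓ E) (h : U × W × ℝ) :
    drive κ ν G hG h = ((κ h.1).prod ν).map (fun p => (p.1, G h.1 h.2.1, p.2)) := by
  have := hD.markov
  have := hD.prob
  rw [drive, Kernel.prod_apply, Kernel.prod_apply, Kernel.comap_apply, Kernel.const_apply,
    Kernel.deterministic_apply, Measure.dirac_prod]
  have h1 : κ h.1 = (κ h.1).map id := Measure.map_id.symm
  conv_lhs => rw [h1]
  rw [Measure.map_prod_map _ _ measurable_id measurable_prodMk_left]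
  rfl

theorem Driver.ae_prod (hD : Driver κ ν ℓ E) {u : U} (hu : ‖u‖ ≤ 1) :
    ∀ᵐ p ∂(κ u).prod ν, ‖p.1‖ ≤ 1 ∧ p.2 ∈ E := by
  have := hD.markov
  have := hD.prob
  have h1 : ∀ᵐ x ∂κ u, ‖x‖ ≤ 1 :=
    (prob_compl_eq_zero_iff (measurableSet_le measurable_norm measurable_const)).2 (hD.bounded u hu)
  have h2 : ∀ᵐ η ∂ν, η ∈ E := (prob_compl_eq_zero_iff hD.meas).2 hD.mem
  have h1' := Measure.quasiMeasurePreserving_fst (μ := κ u) (ν := ν) |>.ae h1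
  have h2' := Measure.quasiMeasurePreserving_snd (μ := κ u) (ν := ν) |>.ae h2
  filter_upwards [h1', h2'] with p a b using ⟨a, b⟩

theorem Driver.ae_drive (hD : Driver κ ν ℓ E) (hS : MeasurableSet S) {h : U × W × ℝ}
    (hu : ‖h.1‖ ≤ 1) (hw : G h.1 h.2.1 ∈ S) :
    ∀ᵐ y ∂drive κ ν G hG h, y ∈ region U S E := by
  rw [hD.drive_apply]
  refine (ae_map_iff (p := fun y => y ∈ region U S E) (by fun_prop)
    (measurableSet_region hS hD.meas)).2 ?_
  filter_upwards [hD.ae_prod hu] with p hp using ⟨hp.1, hw, hp.2⟩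

theorem Driver.integrable_integral (hD : Driver κ ν ℓ E)
    {ψ : U × W × ℝ → F} {C : ℝ} (hψ : Observable (region U S E) ψ C)
    {h : U × W × ℝ} (hu : ‖h.1‖ ≤ 1) (hw : G h.1 h.2.1 ∈ S) :
    Integrable (fun x => ∫ η, ψ (x, G h.1 h.2.1, η) ∂ν) (κ h.1) ∧
      (∀ x, ‖x‖ ≤ 1 → Integrable (fun η => ψ (x, G h.1 h.2.1, η)) ν) ∧
      ∫ y, ψ y ∂drive κ ν G hG h = ∫ x, ∫ η, ψ (x, G h.1 h.2.1, η) ∂ν ∂κ h.1 := by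
  have := hD.markov
  have := hD.prob
  have hm : Measurable fun p : U × ℝ => (p.1, G h.1 h.2.1, p.2) := by fun_prop
  have hi : Integrable (fun p : U × ℝ => ψ (p.1, G h.1 h.2.1, p.2)) ((κ h.1).prod ν) := by
    refine Integrable.of_bound (hψ.meas.comp_measurable hm).aestronglyMeasurable C ?_
    filter_upwards [hD.ae_prod hu] with p hp using hψ.bound _ ⟨hp.1, hw, hp.2⟩
  refine ⟨hi.integral_prod_left, fun x hx => ?_, ?_⟩
  · refine Integrable.of_bound
      (hψ.meas.comp_measurable (measurable_prodMk_left.comp measurable_prodMk_left)).aestronglyMeasurable C ?_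
    have h2 : ∀ᵐ η ∂ν, η ∈ E := (prob_compl_eq_zero_iff hD.meas).2 hD.mem
    filter_upwards [h2] with η hη using hψ.bound _ ⟨hx, hw, hη⟩
  · rw [hD.drive_apply, integral_map hm.aemeasurable hψ.meas.aestronglyMeasurable,
      integral_prod _ hi]

/-- One step of two driven chains: if the observables, after the memory has been updated, differ by
at most `a + A ‖x - x'‖` at inputs `x`, `x'` and a common noise, then their integrals differ by at
most `a + A ℓ ‖u - u'‖`. -/
theorem Driver.norm_integral_drive_sub_le (hD : Driver κ ν ℓ E)
    {ψ : U × W × ℝ → F} {ψ' : U × W' × ℝ → F} {C C' : ℝ}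
    (hψ : Observable (region U S E) ψ C) (hψ' : Observable (region U S' E) ψ' C')
    {h : U × W × ℝ} {h' : U × W' × ℝ} (hu : ‖h.1‖ ≤ 1) (hu' : ‖h'.1‖ ≤ 1)
    (hw : G h.1 h.2.1 ∈ S) (hw' : G' h'.1 h'.2.1 ∈ S') {a A : ℝ} (hA : 0 ≤ A)
    (H : ∀ x x' η, ‖x‖ ≤ 1 → ‖x'‖ ≤ 1 → η ∈ E →
      ‖ψ (x, G h.1 h.2.1, η) - ψ' (x', G' h'.1 h'.2.1, η)‖ ≤ a + A * ‖x - x'‖) :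
    ‖∫ y, ψ y ∂drive κ ν G hG h - ∫ y, ψ' y ∂drive κ ν G' hG' h'‖
      ≤ a + A * (ℓ * ‖h.1 - h'.1‖) := by
  have := hD.markov
  have := hD.prob
  obtain ⟨i1, j1, e1⟩ := hD.integrable_integral (hG := hG) hψ hu hw
  obtain ⟨i2, j2, e2⟩ := hD.integrable_integral (hG := hG') hψ' hu' hw'
  rw [e1, e2]
  have hB : ∀ u : U, ‖u‖ ≤ 1 → ∀ᵐ x ∂κ u, x ∈ {x : U | ‖x‖ ≤ 1} := fun u hu =>
    (prob_compl_eq_zero_iff (measurableSet_le measurable_norm measurable_const)).2 (hD.bounded u hu)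
  refine norm_integral_sub_le_of_wass (hB _ hu) (hB _ hu') i1 i2 hA
    (mul_nonneg hD.nonneg (norm_nonneg _)) (fun x hx x' hx' => ?_) (hD.contract _ _)
  rw [← integral_sub (j1 x hx) (j2 x' hx')]
  have h2 : ∀ᵐ η ∂ν, η ∈ E := (prob_compl_eq_zero_iff hD.meas).2 hD.mem
  simpa using norm_integral_le_of_norm_le_const (μ := ν)
    (h2.mono fun η hη => H x x' η hx hx' hη)

/-- One step of two driven chains that receive the same input. -/
theorem Driver.norm_integral_drive_sub_le_of_eq (hD : Driver κ ν ℓ E)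
    {ψ : U × W × ℝ → F} {ψ' : U × W' × ℝ → F} {C C' : ℝ}
    (hψ : Observable (region U S E) ψ C) (hψ' : Observable (region U S' E) ψ' C')
    {u : U} {w : W} {w' : W'} {η η' : ℝ} (hu : ‖u‖ ≤ 1) (hw : G u w ∈ S) (hw' : G' u w' ∈ S')
    {ε : ℝ} (H : ∀ x η, ‖x‖ ≤ 1 → η ∈ E → ‖ψ (x, G u w, η) - ψ' (x, G' u w', η)‖ ≤ ε) :
    ‖∫ y, ψ y ∂drive κ ν G hG (u, w, η) - ∫ y, ψ' y ∂drive κ ν G' hG' (u, w', η')‖ ≤ ε := by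
  have := hD.markov
  have := hD.prob
  obtain ⟨i1, j1, e1⟩ := hD.integrable_integral (hG := hG) (h := (u, w, η)) hψ hu hw
  obtain ⟨i2, j2, e2⟩ := hD.integrable_integral (hG := hG') (h := (u, w', η')) hψ' hu hw'
  rw [e1, e2, ← integral_sub i1 i2]
  have h1 : ∀ᵐ x ∂κ u, ‖x‖ ≤ 1 :=
    (prob_compl_eq_zero_iff (measurableSet_le measurable_norm measurable_const)).2 (hD.bounded u hu)
  have h2 : ∀ᵐ η ∂ν, η ∈ E := (prob_compl_eq_zero_iff hD.meas).2 hD.mem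
  have h3 : ∀ᵐ x ∂κ u, ‖(∫ ξ, ψ (x, G u w, ξ) ∂ν) - ∫ ξ, ψ' (x, G' u w', ξ) ∂ν‖ ≤ ε := by
    filter_upwards [h1] with x hx
    rw [← integral_sub (j1 x hx) (j2 x hx)]
    simpa using norm_integral_le_of_norm_le_const (μ := ν) (h2.mono fun ξ hξ => H x ξ hx hξ)
  simpa using norm_integral_le_of_norm_le_const (μ := κ u) h3

end Drive

/-! ### Geometric convergence of expectations -/

section Drive

variable {U W W' F : Type*} [NormedAddCommGroup U] [MeasurableSpace U] [BorelSpace U]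
  [SecondCountableTopology U] [MeasurableSpace W] [MeasurableSpace W']
  [NormedAddCommGroup F] [NormedSpace ℝ F] [CompleteSpace F]
  {κ : Kernel U U} {ν : Measure ℝ} {ℓ : ℝ} {E : Set ℝ}
  {G : U → W → W} {hG : Measurable fun h : U × W × ℝ => G h.1 h.2.1} {S : Set W}
  {G' : U → W' → W'} {hG' : Measurable fun h : U × W' × ℝ => G' h.1 h.2.1} {S' : Set W'}

theorem Driver.ae_drive_region (hD : Driver κ ν ℓ E) (hS : MeasurableSet S) (hGS : Preserves G S) :
    ∀ h ∈ region U S E, ∀ᵐ y ∂drive κ ν G hG h, y ∈ region U S E :=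
  fun _ hh => hD.ae_drive hS hh.1 (hGS _ hh.1 _ hh.2.1)

theorem Driver.observable_iter (hD : Driver κ ν ℓ E) (hS : MeasurableSet S) (hGS : Preserves G S)
    {ψ : U × W × ℝ → F} {C : ℝ} (hψ : Observable (region U S E) ψ C) (t : ℕ) :
    Observable (region U S E) (iter (drive κ ν G hG) t ψ) C := by
  have := hD.isMarkovKernel_drive (G := G) (hG := hG)
  exact hψ.iter (measurableSet_region hS hD.meas) (hD.ae_drive_region hS hGS) t

theorem Driver.iter_succ (hD : Driver κ ν ℓ E) (hS : MeasurableSet S) (hGS : Preserves G S)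
    {ψ : U × W × ℝ → F} {C : ℝ} (hψ : Observable (region U S E) ψ C) (t : ℕ) {h : U × W × ℝ}
    (hh : h ∈ region U S E) :
    iter (drive κ ν G hG) (t + 1) ψ h
      = ∫ y, iter (drive κ ν G hG) t ψ y ∂drive κ ν G hG h := by
  have := hD.isMarkovKernel_drive (G := G) (hG := hG)
  exact RNN.iter_succ (measurableSet_region hS hD.meas) (hD.ae_drive_region hS hGS) hψ t hh

/-- Two chains with the same input, whose memories stay in a relation `Rel`: observables that differ
by at most `ε` on `Rel` have expectations that differ by at most `ε` at all times. -/
theorem Driver.norm_iter_sub_le_of_rel (hD : Driver κ ν ℓ E) (hS : MeasurableSet S)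
    (hGS : Preserves G S) (hS' : MeasurableSet S') (hGS' : Preserves G' S') {Rel : W → W' → Prop}
    (hRel : ∀ u w w', ‖u‖ ≤ 1 → Rel w w' → Rel (G u w) (G' u w'))
    (hsub : ∀ w w', Rel w w' → w ∈ S ∧ w' ∈ S') {ψ : U × W × ℝ → F} {ψ' : U × W' × ℝ → F}
    {C C' ε : ℝ} (hψ : Observable (region U S E) ψ C) (hψ' : Observable (region U S' E) ψ' C')
    (H : ∀ u w w' η, ‖u‖ ≤ 1 → Rel w w' → η ∈ E → ‖ψ (u, w, η) - ψ' (u, w', η)‖ ≤ ε) (t : ℕ) :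
    ∀ u w w' η, ‖u‖ ≤ 1 → Rel w w' → η ∈ E →
      ‖iter (drive κ ν G hG) t ψ (u, w, η) - iter (drive κ ν G' hG') t ψ' (u, w', η)‖ ≤ ε := by
  induction t with
  | zero =>
    intro u w w' η hu hw hη
    rw [iter_zero hψ.meas, iter_zero hψ'.meas]
    exact H u w w' η hu hw hη
  | succ t ih =>
    intro u w w' η hu hw hη
    obtain ⟨hwS, hwS'⟩ := hsub _ _ hw
    rw [hD.iter_succ hS hGS hψ t ⟨hu, hwS, hη⟩, hD.iter_succ hS' hGS' hψ' t ⟨hu, hwS', hη⟩]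
    exact hD.norm_integral_drive_sub_le_of_eq
      (hD.observable_iter (hG := hG) hS hGS hψ t) (hD.observable_iter (hG := hG') hS' hGS' hψ' t)
      hu (hGS _ hu _ hwS) (hGS' _ hu _ hwS')
      fun x ξ hx hξ => ih x _ _ ξ hx (hRel u w w' hu hw) hξ

/-- `G` preserves `S` and contracts `d` on `S`, with rate `c` in the memory and Lipschitz constant
`C` in the input. Only the nonnegativity of the distance `d` is needed, it need not be a metric. -/
structure Contracts (G : U → W → W) (S : Set W) (d : W → W → ℝ) (C c : ℝ) : Prop where
  meas : MeasurableSet S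
  preserves : Preserves G S
  nonneg : ∀ w w', 0 ≤ d w w'
  rate_nonneg : 0 ≤ c
  rate_lt_one : c < 1
  lip : ∀ u u', ‖u‖ ≤ 1 → ‖u'‖ ≤ 1 → ∀ w ∈ S, ∀ w' ∈ S,
    d (G u w) (G u' w') ≤ C * ‖u - u'‖ + c * d w w'

/-- The contraction rate of a chain whose input contracts at rate `ℓ` and whose memory contracts at
rate `c`. -/
def rate (ℓ c : ℝ) : ℝ := (1 + max c ℓ) / 2

/-- The weight `A` for which the distance `A ‖u - u'‖ + d w w'` contracts at the rate `rate ℓ c`. -/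
def weight (ℓ C c : ℝ) : ℝ := max 1 (C / (rate ℓ c - ℓ))

theorem rate_lt_one {c : ℝ} (hℓ : ℓ < 1) (hc : c < 1) : rate ℓ c < 1 := by
  have := max_lt hc hℓ
  unfold rate; linarith

theorem le_rate {c : ℝ} (hℓ : ℓ < 1) (hc : c < 1) : c ≤ rate ℓ c := by
  have := max_lt hc hℓ
  have := le_max_left c ℓ
  unfold rate; linarith

theorem lt_rate {c : ℝ} (hℓ : ℓ < 1) (hc : c < 1) : ℓ < rate ℓ c := by
  have := max_lt hc hℓ
  have := le_max_right c ℓ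
  unfold rate; linarith

/-- One step maps the coefficients `(A, 1)` of `‖u - u'‖` and `d w w'` to at most
`(A * ℓ + C, c)`, which are at most `rate ℓ c` times the old ones. -/
theorem weight_contracts {C c : ℝ} (hℓ : ℓ < 1) (hc : c < 1) :
    weight ℓ C c * ℓ + C ≤ rate ℓ c * weight ℓ C c := by
  have h1 : 0 < rate ℓ c - ℓ := sub_pos.2 (lt_rate hℓ hc)
  have h2 : C / (rate ℓ c - ℓ) ≤ weight ℓ C c := le_max_right _ _
  rw [div_le_iff₀ h1] at h2
  linarith

/-- `ψ` is `K`-Lipschitz in input and memory on the region. -/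
def MemLipschitz (S : Set W) (E : Set ℝ) (d : W → W → ℝ) (ψ : U × W × ℝ → F) (K : ℝ) : Prop :=
  ∀ u u' w w' η, ‖u‖ ≤ 1 → ‖u'‖ ≤ 1 → w ∈ S → w' ∈ S → η ∈ E →
    ‖ψ (u, w, η) - ψ (u', w', η)‖ ≤ K * (‖u - u'‖ + d w w')

variable {d : W → W → ℝ} {C c : ℝ}

/-- Geometric contraction of expectations. After at least one step the expectation does not depend
on the initial noise. -/
theorem Driver.norm_iter_succ_sub_le (hD : Driver κ ν ℓ E) (hG' : Contracts G S d C c)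
    {ψ : U × W × ℝ → F} {B K : ℝ} (hψ : Observable (region U S E) ψ B) (hK : 0 ≤ K)
    (hL : MemLipschitz S E d ψ K) (t : ℕ) :
    ∀ h ∈ region U S E, ∀ h' ∈ region U S E,
      ‖iter (drive κ ν G hG) (t + 1) ψ h - iter (drive κ ν G hG) (t + 1) ψ h'‖
        ≤ K * rate ℓ c ^ (t + 1) * (weight ℓ C c * ‖h.1 - h'.1‖ + d h.2.1 h'.2.1) := by
  have hr := weight_contracts (C := C) hD.lt_one hG'.rate_lt_one
  have hc := le_rate hD.lt_one hG'.rate_lt_one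
  have hr0 : 0 ≤ rate ℓ c := hG'.rate_nonneg.trans hc
  have hA1 : 1 ≤ weight ℓ C c := le_max_left _ _
  have hA : 0 ≤ weight ℓ C c := zero_le_one.trans hA1
  have step : ∀ (t : ℕ), (∀ u u' w w' η, ‖u‖ ≤ 1 → ‖u'‖ ≤ 1 → w ∈ S → w' ∈ S → η ∈ E →
      ‖iter (drive κ ν G hG) t ψ (u, w, η) - iter (drive κ ν G hG) t ψ (u', w', η)‖
        ≤ K * rate ℓ c ^ t * (weight ℓ C c * ‖u - u'‖ + d w w')) →
      ∀ h ∈ region U S E, ∀ h' ∈ region U S E,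
      ‖iter (drive κ ν G hG) (t + 1) ψ h - iter (drive κ ν G hG) (t + 1) ψ h'‖
        ≤ K * rate ℓ c ^ (t + 1) * (weight ℓ C c * ‖h.1 - h'.1‖ + d h.2.1 h'.2.1) := by
    intro t ht h hh h' hh'
    have hKt : 0 ≤ K * rate ℓ c ^ t := by positivity
    have hdl := hG'.lip _ _ hh.1 hh'.1 _ hh.2.1 _ hh'.2.1
    have hd := hG'.nonneg h.2.1 h'.2.1
    rw [hD.iter_succ hG'.meas hG'.preserves hψ t hh, hD.iter_succ hG'.meas hG'.preserves hψ t hh']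
    refine (hD.norm_integral_drive_sub_le
      (hD.observable_iter (hG := hG) hG'.meas hG'.preserves hψ t)
      (hD.observable_iter (hG := hG) hG'.meas hG'.preserves hψ t) hh.1 hh'.1
      (hG'.preserves _ hh.1 _ hh.2.1) (hG'.preserves _ hh'.1 _ hh'.2.1)
      (a := K * rate ℓ c ^ t * d (G h.1 h.2.1) (G h'.1 h'.2.1))
      (A := K * rate ℓ c ^ t * weight ℓ C c) (mul_nonneg hKt hA) ?_).trans ?_
    · intro x x' η hx hx' hη
      refine (ht x x' _ _ η hx hx' (hG'.preserves _ hh.1 _ hh.2.1)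
        (hG'.preserves _ hh'.1 _ hh'.2.1) hη).trans (le_of_eq (by ring))
    · have hn := norm_nonneg (h.1 - h'.1)
      calc K * rate ℓ c ^ t * d (G h.1 h.2.1) (G h'.1 h'.2.1)
            + K * rate ℓ c ^ t * weight ℓ C c * (ℓ * ‖h.1 - h'.1‖)
          ≤ K * rate ℓ c ^ t * ((C * ‖h.1 - h'.1‖ + c * d h.2.1 h'.2.1)
            + weight ℓ C c * (ℓ * ‖h.1 - h'.1‖)) := by
            rw [mul_assoc (K * rate ℓ c ^ t) (weight ℓ C c), ← mul_add]
            gcongr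
        _ ≤ K * rate ℓ c ^ t *
            (rate ℓ c * (weight ℓ C c * ‖h.1 - h'.1‖ + d h.2.1 h'.2.1)) := by
            refine mul_le_mul_of_nonneg_left ?_ hKt
            nlinarith [mul_le_mul_of_nonneg_right hr hn, mul_le_mul_of_nonneg_right hc hd]
        _ = _ := by ring
  induction t with
  | zero =>
    refine step 0 fun u u' w w' η hu hu' hw hw' hη => ?_
    rw [iter_zero hψ.meas, iter_zero hψ.meas, pow_zero, mul_one]
    refine (hL u u' w w' η hu hu' hw hw' hη).trans (mul_le_mul_of_nonneg_left ?_ hK)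
    have := mul_le_mul_of_nonneg_right hA1 (norm_nonneg (u - u'))
    linarith
  | succ t ih =>
    exact step (t + 1) fun u u' w w' η hu hu' hw hw' hη =>
      ih (u, w, η) ⟨hu, hw, hη⟩ (u', w', η) ⟨hu', hw', hη⟩

/-- A bound for the distance of the `t`-step expectation to its limit, divided by `rate ^ t`. -/
def mixConst (ℓ C c Δ B K : ℝ) : ℝ := 2 * B + K * (weight ℓ C c * 2 + Δ)

theorem Driver.norm_iter_sub_le (hD : Driver κ ν ℓ E) (hG' : Contracts G S d C c) {Δ : ℝ}
    (hΔ : ∀ w ∈ S, ∀ w' ∈ S, d w w' ≤ Δ) {ψ : U × W × ℝ → F} {B K : ℝ}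
    (hψ : Observable (region U S E) ψ B) (hK : 0 ≤ K)
    (hL : MemLipschitz S E d ψ K) (t : ℕ) {h h' : U × W × ℝ} (hh : h ∈ region U S E)
    (hh' : h' ∈ region U S E) :
    ‖iter (drive κ ν G hG) t ψ h - iter (drive κ ν G hG) t ψ h'‖
      ≤ mixConst ℓ C c Δ B K * rate ℓ c ^ t := by
  have hr0 : 0 ≤ rate ℓ c := hG'.rate_nonneg.trans (le_rate hD.lt_one hG'.rate_lt_one)
  have hA : 0 ≤ weight ℓ C c := zero_le_one.trans (le_max_left _ _)
  have hB : 0 ≤ B := (norm_nonneg _).trans (hψ.bound h hh)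
  have hd : 0 ≤ Δ := (hG'.nonneg _ _).trans (hΔ _ hh.2.1 _ hh'.2.1)
  rcases t with _ | t
  · rw [iter_zero hψ.meas, iter_zero hψ.meas, pow_zero, mul_one, mixConst]
    have := norm_sub_le (ψ h) (ψ h')
    have := hψ.bound h hh
    have := hψ.bound h' hh'
    have : 0 ≤ K * (weight ℓ C c * 2 + Δ) := by positivity
    linarith
  · refine (hD.norm_iter_succ_sub_le hG' hψ hK hL t h hh h' hh').trans ?_
    have h2 : ‖h.1 - h'.1‖ ≤ 2 := by
      have := norm_sub_le h.1 h'.1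
      linarith [hh.1, hh'.1]
    have h3 := hΔ _ hh.2.1 _ hh'.2.1
    have h4 : weight ℓ C c * ‖h.1 - h'.1‖ + d h.2.1 h'.2.1 ≤ weight ℓ C c * 2 + Δ := by gcongr
    have hrt : 0 ≤ rate ℓ c ^ (t + 1) := by positivity
    calc K * rate ℓ c ^ (t + 1) * (weight ℓ C c * ‖h.1 - h'.1‖ + d h.2.1 h'.2.1)
        ≤ K * rate ℓ c ^ (t + 1) * (weight ℓ C c * 2 + Δ) := by gcongr
      _ ≤ mixConst ℓ C c Δ B K * rate ℓ c ^ (t + 1) := by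
        rw [mixConst]; nlinarith

theorem Driver.norm_iter_sub_integral_le (hD : Driver κ ν ℓ E) (hG' : Contracts G S d C c) {Δ : ℝ}
    (hΔ : ∀ w ∈ S, ∀ w' ∈ S, d w w' ≤ Δ) {ψ : U × W × ℝ → F} {B K : ℝ}
    (hψ : Observable (region U S E) ψ B) (hK : 0 ≤ K)
    (hL : MemLipschitz S E d ψ K) (t : ℕ) {h : U × W × ℝ} (hh : h ∈ region U S E)
    {μ : Measure (U × W × ℝ)} [IsProbabilityMeasure μ] (hμ : ∀ᵐ y ∂μ, y ∈ region U S E) :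
    ‖iter (drive κ ν G hG) t ψ h - ∫ y, iter (drive κ ν G hG) t ψ y ∂μ‖
      ≤ mixConst ℓ C c Δ B K * rate ℓ c ^ t := by
  have hi := (hD.observable_iter (hG := hG) hG'.meas hG'.preserves hψ t).integrable hμ
  have e : iter (drive κ ν G hG) t ψ h = ∫ y, iter (drive κ ν G hG) t ψ h ∂μ := by simp
  rw [e, ← integral_sub (integrable_const _) hi]
  simpa using norm_integral_le_of_norm_le_const
    (hμ.mono fun y hy => hD.norm_iter_sub_le hG' hΔ hψ hK hL t hh hy)

theorem Driver.norm_iter_succ_sub_iter_le (hD : Driver κ ν ℓ E) (hG' : Contracts G S d C c) {Δ : ℝ}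
    (hΔ : ∀ w ∈ S, ∀ w' ∈ S, d w w' ≤ Δ) {ψ : U × W × ℝ → F} {B K : ℝ}
    (hψ : Observable (region U S E) ψ B) (hK : 0 ≤ K)
    (hL : MemLipschitz S E d ψ K) (t : ℕ) {h : U × W × ℝ} (hh : h ∈ region U S E) :
    ‖iter (drive κ ν G hG) (t + 1) ψ h - iter (drive κ ν G hG) t ψ h‖
      ≤ mixConst ℓ C c Δ B K * rate ℓ c ^ t := by
  have := hD.isMarkovKernel_drive (G := G) (hG := hG)
  rw [hD.iter_succ hG'.meas hG'.preserves hψ t hh, norm_sub_rev]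
  exact hD.norm_iter_sub_integral_le hG' hΔ hψ hK hL t hh
    (hD.ae_drive_region hG'.meas hG'.preserves h hh)

/-- Stationarity: the expectation of an observable does not change in time. -/
theorem Driver.integral_iter_of_invariant (hD : Driver κ ν ℓ E) (hS : MeasurableSet S)
    (hGS : Preserves G S) {ψ : U × W × ℝ → F} {B : ℝ} (hψ : Observable (region U S E) ψ B)
    {μ : Measure (U × W × ℝ)} [IsProbabilityMeasure μ] (hμ : ∀ᵐ y ∂μ, y ∈ region U S E)
    (hinv : (drive κ ν G hG).Invariant μ) (t : ℕ) :
    ∫ y, iter (drive κ ν G hG) t ψ y ∂μ = ∫ y, ψ y ∂μ := by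
  induction t with
  | zero => simp only [iter_zero hψ.meas]
  | succ t ih =>
    have hi := (hD.observable_iter (hG := hG) hS hGS hψ t).integrable hμ
    rw [← ih, integral_congr_ae (hμ.mono fun y hy => hD.iter_succ hS hGS hψ t hy)]
    nth_rewrite 2 [← hinv.def]
    rw [← hinv.def] at hi
    exact (integral_bind_kernel hi).symm

end Drive

/-! ### Stationary distributions -/

/-- Bounded Lipschitz functions separate probability measures. -/
theorem eq_of_forall_lipschitz_integral_eq {X : Type*} [MeasurableSpace X] [MetricSpace X]
    [BorelSpace X] {μ μ' : Measure X} [hμ : IsProbabilityMeasure μ] [hμ' : IsProbabilityMeasure μ']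
    (h : ∀ f : X → ℝ, (∃ C : ℝ, ∀ x y, dist (f x) (f y) ≤ C) → (∃ L, LipschitzWith L f) →
      ∫ x, f x ∂μ = ∫ x, f x ∂μ') : μ = μ' := by
  let m : ProbabilityMeasure X := ⟨μ, hμ⟩
  let m' : ProbabilityMeasure X := ⟨μ', hμ'⟩
  have h1 : Filter.Tendsto (fun _ : ℕ => m) Filter.atTop (nhds m') := by
    rw [tendsto_iff_forall_lipschitz_integral_tendsto]
    intro f hf hL
    change Filter.Tendsto (fun _ => ∫ x, f x ∂μ) _ (nhds (∫ x, f x ∂μ'))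
    rw [h f hf hL]
    exact tendsto_const_nhds
  have := tendsto_nhds_unique h1 tendsto_const_nhds
  exact (congrArg Subtype.val this).symm

section Stationary

variable {U W F : Type*} [NormedAddCommGroup U] [MeasurableSpace U] [BorelSpace U]
  [SecondCountableTopology U] [NormedAddCommGroup W] [MeasurableSpace W] [BorelSpace W]
  [SecondCountableTopology W] [NormedAddCommGroup F] [NormedSpace ℝ F] [CompleteSpace F]
  {κ : Kernel U U} {ν : Measure ℝ} {ℓ : ℝ} {E : Set ℝ}
  {G : U → W → W} {hG : Measurable fun h : U × W × ℝ => G h.1 h.2.1} {S : Set W}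
  {d : W → W → ℝ} {C c Δ : ℝ}

theorem Driver.rate_nonneg (hD : Driver κ ν ℓ E) : 0 ≤ rate ℓ c := by
  have := le_max_right c ℓ
  have := hD.nonneg
  unfold rate; linarith

theorem Driver.tendsto_const_mul_rate_pow (hD : Driver κ ν ℓ E) (hc : c < 1) (K : ℝ) :
    Filter.Tendsto (fun t : ℕ => K * rate ℓ c ^ t) Filter.atTop (nhds 0) := by
  simpa using (tendsto_pow_atTop_nhds_zero_of_lt_one hD.rate_nonneg
    (rate_lt_one hD.lt_one hc)).const_mul K

theorem Driver.tendsto_iter (hD : Driver κ ν ℓ E) (hC : Contracts G S d C c)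
    (hΔ : ∀ w ∈ S, ∀ w' ∈ S, d w w' ≤ Δ) {ψ : U × W × ℝ → F} {B K : ℝ}
    (hψ : Observable (region U S E) ψ B) (hK : 0 ≤ K)
    (hL : MemLipschitz S E d ψ K) {h : U × W × ℝ} (hh : h ∈ region U S E)
    {μ : Measure (U × W × ℝ)} [IsProbabilityMeasure μ] (hμ : ∀ᵐ y ∂μ, y ∈ region U S E)
    (hinv : (drive κ ν G hG).Invariant μ) :
    Filter.Tendsto (fun t => iter (drive κ ν G hG) t ψ h) Filter.atTop (nhds (∫ y, ψ y ∂μ)) := by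
  rw [tendsto_iff_norm_sub_tendsto_zero]
  refine squeeze_zero (fun _ => norm_nonneg _) (fun t => ?_)
    (hD.tendsto_const_mul_rate_pow hC.rate_lt_one (mixConst ℓ C c Δ B K))
  rw [← hD.integral_iter_of_invariant hC.meas hC.preserves hψ hμ hinv t]
  exact hD.norm_iter_sub_integral_le hC hΔ hψ hK hL t hh hμ

theorem observable_of_lipschitz {f : U × W × ℝ → ℝ} {R : Set (U × W × ℝ)}
    (hf : ∃ C : ℝ, ∀ x y, dist (f x) (f y) ≤ C) {L : NNReal} (hL : LipschitzWith L f) :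
    ∃ B, Observable R f B := by
  obtain ⟨C, hC⟩ := hf
  refine ⟨‖f 0‖ + C, hL.continuous.stronglyMeasurable, fun h _ => ?_⟩
  have := hC h 0
  rw [dist_eq_norm] at this
  have h2 := norm_le_norm_add_norm_sub' (f h) (f 0)
  linarith

theorem memLipschitz_of_lipschitz {f : U × W × ℝ → ℝ} {L : NNReal} (hL : LipschitzWith L f)
    {b : ℝ} (hb1 : 1 ≤ b) (hd0 : ∀ w w', 0 ≤ d w w')
    (hb : ∀ w ∈ S, ∀ w' ∈ S, ‖w - w'‖ ≤ b * d w w') :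
    MemLipschitz S E d f (L * b) := by
  intro u u' w w' η _ _ hw hw' _
  refine (hL.norm_sub_le _ _).trans ?_
  rw [mul_assoc]
  refine mul_le_mul_of_nonneg_left ?_ L.2
  have h0 := hd0 w w'
  have h1 := norm_nonneg (u - u')
  simp only [Prod.mk_sub_mk, sub_self, Prod.norm_mk, norm_zero, sup_le_iff]
  refine ⟨by nlinarith, (hb w hw w' hw').trans (by nlinarith), by positivity⟩

/-- Uniqueness of the stationary distribution: stationary expectations are the limits of the
expectations from any initial state. The assumption `hb` lets `d` dominate the norm, so that bounded
Lipschitz functions are admissible observables. -/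
theorem Driver.eq_of_invariant (hD : Driver κ ν ℓ E) (hC : Contracts G S d C c)
    (hΔ : ∀ w ∈ S, ∀ w' ∈ S, d w w' ≤ Δ) {b : ℝ} (hb1 : 1 ≤ b)
    (hb : ∀ w ∈ S, ∀ w' ∈ S, ‖w - w'‖ ≤ b * d w w')
    {μ μ' : Measure (U × W × ℝ)} [IsProbabilityMeasure μ] [IsProbabilityMeasure μ']
    (hμ : ∀ᵐ y ∂μ, y ∈ region U S E) (hinv : (drive κ ν G hG).Invariant μ)
    (hμ' : ∀ᵐ y ∂μ', y ∈ region U S E) (hinv' : (drive κ ν G hG).Invariant μ') : μ = μ' := by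
  refine eq_of_forall_lipschitz_integral_eq fun f hf ⟨L, hL⟩ => ?_
  obtain ⟨B, hB⟩ := observable_of_lipschitz (R := region U S E) hf hL
  have hM := memLipschitz_of_lipschitz (E := E) hL hb1 hC.nonneg hb
  obtain ⟨h, hh⟩ := hμ.exists
  have hK : 0 ≤ (L : ℝ) * b := by positivity
  exact tendsto_nhds_unique (hD.tendsto_iter (hG := hG) hC hΔ hB hK hM hh hμ hinv)
    (hD.tendsto_iter hC hΔ hB hK hM hh hμ' hinv')

/-- The set `E` of noise values can be enlarged to the whole line. -/
theorem Driver.univ (hD : Driver κ ν ℓ E) : Driver κ ν ℓ Set.univ :=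
  ⟨hD.markov, hD.prob, hD.nonneg, hD.lt_one, hD.contract, hD.bounded, .univ,
    by have := hD.prob; exact measure_univ⟩

theorem pow_succ_apply' {X : Type*} [MeasurableSpace X] {P : Kernel X X} (t : ℕ) (h : X) :
    (P ^ (t + 1)) h = ((P ^ t) h).bind P := by
  rw [pow_succ']; rfl

/-- After one step the noise has law `ν`. -/
theorem Driver.drive_compl_le (hD : Driver κ ν ℓ E) (hS : MeasurableSet S) (hGS : Preserves G S)
    {h : U × W × ℝ} (hh : h ∈ region U S Set.univ) {I : Set ℝ} (hI : MeasurableSet I) :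
    drive κ ν G hG h (Metric.closedBall 0 1 ×ˢ S ×ˢ I)ᶜ ≤ ν Iᶜ := by
  have := hD.markov
  have := hD.prob
  have hm : MeasurableSet (Metric.closedBall (0 : U) 1 ×ˢ S ×ˢ I)ᶜ :=
    (Metric.isClosed_closedBall.measurableSet.prod (hS.prod hI)).compl
  rw [hD.drive_apply, Measure.map_apply (by fun_prop) hm]
  calc ((κ h.1).prod ν) ((fun p : U × ℝ => (p.1, G h.1 h.2.1, p.2)) ⁻¹'
          (Metric.closedBall (0 : U) 1 ×ˢ S ×ˢ I)ᶜ)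
      ≤ ((κ h.1).prod ν) (Prod.snd ⁻¹' Iᶜ) := by
        refine measure_mono_ae ?_
        filter_upwards [hD.ae_prod hh.1] with p hp hpI hI'
        refine hpI ⟨by simpa using hp.1, hGS _ hh.1 _ hh.2.1, hI'⟩
    _ = ν Iᶜ := by
        rw [← Measure.snd_apply hI.compl, Measure.snd_prod]

/-- Existence of a stationary distribution: by Prokhorov's theorem the laws of the chain have a
weak limit point, and it is invariant because expectations at consecutive times merge. -/
theorem Driver.exists_invariant [ProperSpace U] (hD : Driver κ ν ℓ E) (hC : Contracts G S d C c)
    (hΔ : ∀ w ∈ S, ∀ w' ∈ S, d w w' ≤ Δ) {b : ℝ} (hb1 : 1 ≤ b)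
    (hb : ∀ w ∈ S, ∀ w' ∈ S, ‖w - w'‖ ≤ b * d w w') {b' : ℝ} (hb0 : 0 ≤ b')
    (hb' : ∀ w ∈ S, ∀ w' ∈ S, d w w' ≤ b' * ‖w - w'‖) (hS : IsCompact S) (hne : S.Nonempty) :
    ∃ μ : Measure (U × W × ℝ), IsProbabilityMeasure μ ∧ (∀ᵐ y ∂μ, y ∈ region U S E) ∧
      (drive κ ν G hG).Invariant μ := by
  have hDu := hD.univ
  have := hD.prob
  have hP := hD.isMarkovKernel_drive (G := G) (hG := hG)
  set P := drive κ ν G hG with hPdef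
  obtain ⟨w₀, hw₀⟩ := hne
  set h₀ : U × W × ℝ := (0, w₀, 0)
  have hh₀ : h₀ ∈ region U S Set.univ := ⟨by simp [h₀], hw₀, trivial⟩
  have hRm : MeasurableSet (region U S Set.univ) := measurableSet_region hC.meas .univ
  have hae : ∀ t, ∀ᵐ y ∂(P ^ t) h₀, y ∈ region U S Set.univ := fun t =>
    ae_pow_mem hRm (hDu.ae_drive_region hC.meas hC.preserves) t hh₀
  let I : ℕ → Set ℝ := fun n => Metric.closedBall 0 n
  let K : ℕ → Set (U × W × ℝ) := fun n => Metric.closedBall 0 1 ×ˢ S ×ˢ I n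
  let v : ℕ → NNReal := fun n => (ν (I n)ᶜ).toNNReal
  have hKc : ∀ n, IsCompact (K n) := fun n =>
    (isCompact_closedBall _ _).prod (hS.prod (isCompact_closedBall _ _))
  have hI : ∀ n, MeasurableSet (I n) := fun n => Metric.isClosed_closedBall.measurableSet
  have hv : Filter.Tendsto v Filter.atTop (nhds 0) := by
    have h1 : Filter.Tendsto (fun n => ν (I n)ᶜ) Filter.atTop (nhds (ν (⋂ n, (I n)ᶜ))) := by
      refine tendsto_measure_iInter_atTop (fun n => (hI n).compl.nullMeasurableSet) ?_
        ⟨0, measure_ne_top _ _⟩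
      intro m n hmn
      exact Set.compl_subset_compl.2 (Metric.closedBall_subset_closedBall (by exact_mod_cast hmn))
    have h2 : ⋂ n, (I n)ᶜ = ∅ := by
      rw [← Set.compl_iUnion, Metric.iUnion_closedBall_nat, Set.compl_univ]
    rw [h2, measure_empty] at h1
    have := (ENNReal.tendsto_toNNReal ENNReal.zero_ne_top).comp h1
    simpa using! this
  have hcpt := isCompact_setOfPred_probabilityMeasure_mass_eq_compl_isCompact_le hv hKc
    (Or.inl inferInstance)
  let μs : ℕ → ProbabilityMeasure (U × W × ℝ) := fun n => ⟨(P ^ (n + 1)) h₀, inferInstance⟩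
  have hmem : ∀ m n, (μs m) (K n)ᶜ ≤ v n := by
    intro m n
    have h1 : ((P ^ (m + 1)) h₀) (K n)ᶜ ≤ ν (I n)ᶜ := by
      rw [pow_succ_apply', Measure.bind_apply (hKc n).measurableSet.compl P.aemeasurable]
      calc ∫⁻ y, P y (K n)ᶜ ∂(P ^ m) h₀ ≤ ∫⁻ y, ν (I n)ᶜ ∂(P ^ m) h₀ := by
            refine lintegral_mono_ae ?_
            filter_upwards [hae m] with y hy
            exact hD.drive_compl_le hC.meas hC.preserves hy (hI n)
        _ = ν (I n)ᶜ := by simp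
    exact ENNReal.toNNReal_mono (measure_ne_top _ _) h1
  obtain ⟨μ, hμ, hlim⟩ := isCompact_iff_ultrafilter_le_nhds.1 hcpt
    (Ultrafilter.map μs (Filter.hyperfilter ℕ)) (by
      rw [Filter.le_principal_iff]
      exact Filter.univ_mem' (f := (Filter.hyperfilter ℕ : Filter ℕ)) hmem)
  have hlim' : Filter.Tendsto μs (Filter.hyperfilter ℕ) (nhds μ) := hlim
  have hhyp : (Filter.hyperfilter ℕ : Filter ℕ) ≤ Filter.atTop := by
    rw [← Nat.cofinite_eq_atTop]; exact Filter.hyperfilter_le_cofinite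
  rw [ProbabilityMeasure.tendsto_iff_forall_integral_tendsto] at hlim'
  have hμu : ∀ᵐ y ∂(μ : Measure (U × W × ℝ)), y ∈ region U S Set.univ := by
    have h1 : ∀ n, (μ : Measure (U × W × ℝ)) (region U S Set.univ)ᶜ ≤ v n := by
      intro n
      have h2 : (region U S Set.univ : Set (U × W × ℝ))ᶜ ⊆ (K n)ᶜ :=
        Set.compl_subset_compl.2 fun y hy => ⟨by simpa using hy.1, hy.2.1, trivial⟩
      refine (measure_mono h2).trans ?_
      rw [← ProbabilityMeasure.ennreal_coeFn_eq_coeFn_toMeasure]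
      exact_mod_cast hμ n
    have h3 : Filter.Tendsto (fun n => (v n : ℝ≥0∞)) Filter.atTop (nhds 0) := by
      rw [← ENNReal.coe_zero, ENNReal.tendsto_coe]; exact hv
    exact le_antisymm (ge_of_tendsto' h3 h1) bot_le
  have hinv : P.Invariant (μ : Measure (U × W × ℝ)) := by
    refine eq_of_forall_lipschitz_integral_eq fun f hf ⟨L, hL⟩ => ?_
    obtain ⟨B, hB⟩ := observable_of_lipschitz (R := region U S Set.univ) hf hL
    have hM := memLipschitz_of_lipschitz (E := Set.univ) hL hb1 hC.nonneg hb
    have hKL : 0 ≤ (L : ℝ) * b := by positivity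
    have hB1 := hDu.observable_iter (hG := hG) hC.meas hC.preserves hB 1
    set g := iter P 1 f with hg
    have hgP : ∀ y, ∫ z, f z ∂P y = g y := fun y => by rw [hg, iter, pow_one]
    -- `g` is Lipschitz on the region; extend it to a bounded continuous function
    have hgL : ∃ M : NNReal, LipschitzOnWith M g (region U S Set.univ) := by
      refine ⟨(L * b * rate ℓ c * (weight ℓ C c + b')).toNNReal, ?_⟩
      rw [lipschitzOnWith_iff_norm_sub_le]
      intro x hx y hy
      have h1 := hDu.norm_iter_succ_sub_le (hG := hG) hC hB hKL hM 0 x hx y hy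
      have hA : 0 ≤ weight ℓ C c := zero_le_one.trans (le_max_left _ _)
      have hr : 0 ≤ rate ℓ c := hD.rate_nonneg
      have h2 : ‖x.1 - y.1‖ ≤ ‖x - y‖ := norm_fst_le (x - y)
      have h3 : ‖x.2.1 - y.2.1‖ ≤ ‖x - y‖ := (norm_fst_le (x - y).2).trans (norm_snd_le (x - y))
      have h4 := hb' _ hx.2.1 _ hy.2.1
      refine h1.trans ?_
      rw [Real.coe_toNNReal _ (by positivity), zero_add, pow_one, mul_assoc _ (_ + _)]
      refine mul_le_mul_of_nonneg_left ?_ (by positivity)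
      calc weight ℓ C c * ‖x.1 - y.1‖ + d x.2.1 y.2.1
          ≤ weight ℓ C c * ‖x - y‖ + b' * ‖x - y‖ := by
            gcongr
            exact h4.trans (mul_le_mul_of_nonneg_left h3 hb0)
        _ = _ := by ring
    obtain ⟨M, hM'⟩ := hgL
    obtain ⟨g', hg'L, hg'⟩ := hM'.extend_real
    let γ : BoundedContinuousFunction (U × W × ℝ) ℝ :=
      BoundedContinuousFunction.ofNormedAddCommGroup (fun x => max (-B) (min B (g' x)))
        (continuous_const.max (continuous_const.min hg'L.continuous)) |B| (fun x => by
          rw [Real.norm_eq_abs, abs_le]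
          rcases abs_cases B with ⟨h, _⟩ | ⟨h, _⟩ <;> rw [h] <;> constructor <;>
            simp <;> grind)
    have hγ : ∀ y ∈ region U S Set.univ, γ y = g y := by
      intro y hy
      have h1 := hB1.bound y hy
      rw [Real.norm_eq_abs, abs_le] at h1
      change max (-B) (min B (g' y)) = g y
      rw [← hg' hy, min_eq_right h1.2, max_eq_right h1.1]
    have hfμ : Integrable f ((μ : Measure (U × W × ℝ)).bind P) := by
      refine Integrable.of_bound hL.continuous.aestronglyMeasurable (‖f 0‖ + hf.choose)
        (Filter.Eventually.of_forall fun y => ?_)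
      have h1 := hf.choose_spec y 0
      rw [dist_eq_norm] at h1
      have h2 := norm_le_norm_add_norm_sub' (f y) (f 0)
      linarith
    rw [integral_bind_kernel hfμ]
    simp only [hgP]
    rw [← integral_congr_ae (hμu.mono hγ)]
    have t1 := hlim' γ
    have e1 : ∀ n, ∫ y, γ y ∂(μs n : Measure (U × W × ℝ)) = iter P (n + 1 + 1) f h₀ := by
      intro n
      change ∫ y, γ y ∂(P ^ (n + 1)) h₀ = _
      rw [integral_congr_ae ((hae (n + 1)).mono hγ), iter, pow_succ_apply' (n + 1),
        integral_bind_kernel]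
      · simp only [hgP]
      · rw [← pow_succ_apply']
        exact hB.integrable (hae _)
    simp only [e1] at t1
    have t2 : Filter.Tendsto (fun n => iter P (n + 1) f h₀) (Filter.hyperfilter ℕ)
        (nhds (∫ y, f y ∂(μ : Measure (U × W × ℝ)))) :=
      hlim' (BoundedContinuousFunction.mk ⟨f, hL.continuous⟩ hf)
    have t3 : Filter.Tendsto (fun n => iter P (n + 1 + 1) f h₀ - iter P (n + 1) f h₀)
        (Filter.hyperfilter ℕ) (nhds 0) := by
      refine Filter.Tendsto.mono_left ?_ hhyp
      refine squeeze_zero_norm (fun n =>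
        hDu.norm_iter_succ_sub_iter_le (hG := hG) hC hΔ hB hKL hM (n + 1) hh₀) ?_
      exact (Filter.tendsto_add_atTop_iff_nat 1).2
        (hD.tendsto_const_mul_rate_pow hC.rate_lt_one _)
    have t4 := tendsto_nhds_unique t3 (t1.sub t2)
    linarith
  refine ⟨μ, inferInstance, ?_, hinv⟩
  have hRE : MeasurableSet (region U S E) := measurableSet_region hC.meas hD.meas
  have h1 : (μ : Measure (U × W × ℝ)) (region U S E)ᶜ = 0 := by
    rw [← hinv.def, Measure.bind_apply hRE.compl P.aemeasurable,
      lintegral_eq_zero_iff (P.measurable_coe hRE.compl)]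
    filter_upwards [hμu] with y hy
    exact hD.ae_drive hC.meas hy.1 (hC.preserves _ hy.1 _ hy.2.1)
  exact h1

end Stationary

/-! ### Uniform bounds for twice continuously differentiable maps on compact convex sets -/

/-- A `C²` map and its derivative are bounded and Lipschitz on a compact convex set, and the second
order Taylor estimate holds there, all with a single constant. -/
theorem exists_taylor_bound {X F : Type*} [NormedAddCommGroup X] [NormedSpace ℝ X]
    [NormedAddCommGroup F] [NormedSpace ℝ F] {H : X → F} (hH : ContDiff ℝ 2 H) {Z : Set X}
    (hZ : IsCompact Z) (hc : Convex ℝ Z) :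
    ∃ K : ℝ, 0 ≤ K ∧ (∀ z ∈ Z, ‖H z‖ ≤ K) ∧ (∀ z ∈ Z, ‖fderiv ℝ H z‖ ≤ K) ∧
      (∀ z ∈ Z, ∀ z' ∈ Z, ‖H z' - H z‖ ≤ K * ‖z' - z‖) ∧
      (∀ z ∈ Z, ∀ z' ∈ Z, ‖fderiv ℝ H z' - fderiv ℝ H z‖ ≤ K * ‖z' - z‖) ∧
      (∀ z ∈ Z, ∀ z' ∈ Z, ‖H z' - H z - fderiv ℝ H z (z' - z)‖ ≤ K * ‖z' - z‖ ^ 2) := by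
  have h1 : ContDiff ℝ 1 (fderiv ℝ H) := hH.fderiv_right (by norm_num)
  have hd : Differentiable ℝ H := hH.differentiable (by norm_num)
  have hd1 : Differentiable ℝ (fderiv ℝ H) := h1.differentiable (by norm_num)
  obtain ⟨K0, hK0⟩ := hZ.exists_bound_of_continuousOn hH.continuous.continuousOn
  obtain ⟨K1, hK1⟩ := hZ.exists_bound_of_continuousOn h1.continuous.continuousOn
  obtain ⟨K2, hK2⟩ := hZ.exists_bound_of_continuousOn
    (h1.continuous_fderiv (by norm_num)).continuousOn
  have hK : ∃ K, 0 ≤ K ∧ K0 ≤ K ∧ K1 ≤ K ∧ K2 ≤ K :=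
    ⟨max 0 (max K0 (max K1 K2)), by simp, by simp, by simp, by simp⟩
  obtain ⟨K, hKn, h0K, h1K, h2K⟩ := hK
  have hlip : ∀ z ∈ Z, ∀ z' ∈ Z, ‖fderiv ℝ H z' - fderiv ℝ H z‖ ≤ K * ‖z' - z‖ := fun z hz z' hz' =>
    hc.norm_image_sub_le_of_norm_fderiv_le (fun x _ => hd1 x) (fun x hx => (hK2 x hx).trans h2K)
      hz hz'
  refine ⟨K, hKn, fun z hz => (hK0 z hz).trans h0K, fun z hz => (hK1 z hz).trans h1K,
    fun z hz z' hz' => hc.norm_image_sub_le_of_norm_fderiv_le (fun x _ => hd x)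
      (fun x hx => (hK1 x hx).trans h1K) hz hz', hlip, fun z hz z' hz' => ?_⟩
  have hseg : segment ℝ z z' ⊆ Z := hc.segment_subset hz hz'
  have := (convex_segment z z').norm_image_sub_le_of_norm_fderiv_le' (𝕜 := ℝ) (f := H)
    (φ := fderiv ℝ H z) (C := K * ‖z' - z‖) (fun x _ => hd x) (fun x hx => ?_)
    (left_mem_segment ℝ z z') (right_mem_segment ℝ z z')
  · rw [pow_two, ← mul_assoc]; exact this
  · refine (hlip z hz x (hseg hx)).trans (mul_le_mul_of_nonneg_left ?_ hKn)
    obtain ⟨s, t, hs, ht, hst, rfl⟩ := hx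
    have e : s • z + t • z' - z = t • (z' - z) := by
      have : s = 1 - t := by linarith
      subst this; module
    rw [e, norm_smul, Real.norm_of_nonneg ht]
    nlinarith [norm_nonneg (z' - z)]

/-! ### Tangent chains -/

section Tangent

variable {U W Y Θ V F : Type*}
  [NormedAddCommGroup U] [NormedSpace ℝ U]
  [NormedAddCommGroup W] [NormedSpace ℝ W]
  [NormedAddCommGroup Y] [NormedSpace ℝ Y] [NormedAddCommGroup Θ] [NormedSpace ℝ Θ]
  [NormedAddCommGroup V] [NormedSpace ℝ V] [NormedAddCommGroup F] [NormedSpace ℝ F]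

/-- The derivative of `θ ↦ H (y θ, v, w θ)`, where `y'` and `J` are the derivatives of `y` and
`w`. -/
def tangent (H : Y × V × W → F) (y : Y) (y' : Θ →L[ℝ] Y) (v : V) (w : W) (J : Θ →L[ℝ] W) :
    Θ →L[ℝ] F :=
  (fderiv ℝ H (y, v, w)).comp (y'.prod ((0 : Θ →L[ℝ] V).prod J))

theorem tangent_apply (H : Y × V × W → F) (y : Y) (y' : Θ →L[ℝ] Y) (v : V) (w : W)
    (J : Θ →L[ℝ] W) (τ : Θ) :
    tangent H y y' v w J τ = fderiv ℝ H (y, v, w) (y' τ, 0, J τ) := rfl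

theorem tangent_sub (H : Y × V × W → F) (y : Y) (y' : Θ →L[ℝ] Y) (v : V) (w : W)
    (J J' : Θ →L[ℝ] W) (τ : Θ) :
    tangent H y y' v w J τ - tangent H y y' v w J' τ
      = fderiv ℝ H (y, v, w) (0, 0, (J - J') τ) := by
  rw [tangent_apply, tangent_apply, ← map_sub]
  simp

theorem norm_prod_zero_prod_le {y' : Θ →L[ℝ] Y} {J : Θ →L[ℝ] W} {a b : ℝ} (ha : ‖y'‖ ≤ a)
    (hb : ‖J‖ ≤ b) : ‖y'.prod ((0 : Θ →L[ℝ] V).prod J)‖ ≤ a + b := by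
  have ha0 := (norm_nonneg _).trans ha
  have hb0 := (norm_nonneg _).trans hb
  refine ContinuousLinearMap.opNorm_le_bound _ (by positivity) fun τ => ?_
  have h1 := y'.le_of_opNorm_le ha τ
  have h2 := J.le_of_opNorm_le hb τ
  have h3 := norm_nonneg τ
  simp only [ContinuousLinearMap.prod_apply, Prod.norm_def,
    zero_apply, norm_zero, sup_le_iff]
  refine ⟨by nlinarith, by positivity, by nlinarith⟩

theorem continuous_tangent {H : Y × V × W → F} (hH : ContDiff ℝ 2 H) (y : Y) (y' : Θ →L[ℝ] Y) :
    Continuous fun p : V × W × (Θ →L[ℝ] W) => tangent H y y' p.1 p.2.1 p.2.2 := by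
  have h1 : Continuous (fderiv ℝ H) := hH.continuous_fderiv (by norm_num)
  have h2 : Continuous fun p : V × W × (Θ →L[ℝ] W) =>
      (ContinuousLinearMap.inr ℝ Y (V × W)).comp ((ContinuousLinearMap.inr ℝ V W).comp p.2.2) := by
    fun_prop
  have h3 : ∀ J : Θ →L[ℝ] W, y'.prod ((0 : Θ →L[ℝ] V).prod J)
      = (ContinuousLinearMap.inl ℝ Y (V × W)).comp y'
        + (ContinuousLinearMap.inr ℝ Y (V × W)).comp ((ContinuousLinearMap.inr ℝ V W).comp J) := by
    intro J; ext τ <;> simp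
  unfold tangent
  simp only [h3]
  fun_prop

/-- `K` bounds `H` and its derivative, and is a Lipschitz constant of both and a constant in the
second order Taylor estimate, on the product of three sets. -/
structure UnifBound (H : Y × V × W → F) (𝒴 : Set Y) (B : Set V) (S : Set W) (K : ℝ) : Prop where
  nonneg : 0 ≤ K
  bound : ∀ y ∈ 𝒴, ∀ v ∈ B, ∀ w ∈ S, ‖H (y, v, w)‖ ≤ K
  bound_fderiv : ∀ y ∈ 𝒴, ∀ v ∈ B, ∀ w ∈ S, ‖fderiv ℝ H (y, v, w)‖ ≤ K
  lip : ∀ y ∈ 𝒴, ∀ v ∈ B, ∀ w ∈ S, ∀ y' ∈ 𝒴, ∀ v' ∈ B, ∀ w' ∈ S,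
    ‖H (y', v', w') - H (y, v, w)‖ ≤ K * (‖y' - y‖ + ‖v' - v‖ + ‖w' - w‖)
  lip_fderiv : ∀ y ∈ 𝒴, ∀ v ∈ B, ∀ w ∈ S, ∀ y' ∈ 𝒴, ∀ v' ∈ B, ∀ w' ∈ S,
    ‖fderiv ℝ H (y', v', w') - fderiv ℝ H (y, v, w)‖ ≤ K * (‖y' - y‖ + ‖v' - v‖ + ‖w' - w‖)
  taylor : ∀ y ∈ 𝒴, ∀ v ∈ B, ∀ w ∈ S, ∀ y' ∈ 𝒴, ∀ v' ∈ B, ∀ w' ∈ S,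
    ‖H (y', v', w') - H (y, v, w) - fderiv ℝ H (y, v, w) (y' - y, v' - v, w' - w)‖
      ≤ K * (‖y' - y‖ + ‖v' - v‖ + ‖w' - w‖) ^ 2

theorem exists_unifBound {H : Y × V × W → F} (hH : ContDiff ℝ 2 H) {𝒴 : Set Y} {B : Set V}
    {S : Set W} (h𝒴 : IsCompact 𝒴) (c𝒴 : Convex ℝ 𝒴) (hB : IsCompact B) (cB : Convex ℝ B)
    (hS : IsCompact S) (cS : Convex ℝ S) : ∃ K, UnifBound H 𝒴 B S K := by
  obtain ⟨K, h0, h1, h2, h3, h4, h5⟩ := exists_taylor_bound hH (h𝒴.prod (hB.prod hS))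
    (c𝒴.prod (cB.prod cS))
  have hn : ∀ (y y' : Y) (v v' : V) (w w' : W),
      ‖((y', v', w') : Y × V × W) - (y, v, w)‖ ≤ ‖y' - y‖ + ‖v' - v‖ + ‖w' - w‖ := by
    intro y y' v v' w w'
    have a1 := norm_nonneg (y' - y)
    have a2 := norm_nonneg (v' - v)
    have a3 := norm_nonneg (w' - w)
    simp only [Prod.mk_sub_mk, Prod.norm_mk, sup_le_iff]
    refine ⟨by linarith, by linarith, by linarith⟩
  refine ⟨K, h0, fun y hy v hv w hw => h1 _ ⟨hy, hv, hw⟩, fun y hy v hv w hw => h2 _ ⟨hy, hv, hw⟩,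
    ?_, ?_, ?_⟩
  · intro y hy v hv w hw y' hy' v' hv' w' hw'
    exact (h3 _ ⟨hy, hv, hw⟩ _ ⟨hy', hv', hw'⟩).trans (mul_le_mul_of_nonneg_left (hn ..) h0)
  · intro y hy v hv w hw y' hy' v' hv' w' hw'
    exact (h4 _ ⟨hy, hv, hw⟩ _ ⟨hy', hv', hw'⟩).trans (mul_le_mul_of_nonneg_left (hn ..) h0)
  · intro y hy v hv w hw y' hy' v' hv' w' hw'
    refine (h5 _ ⟨hy, hv, hw⟩ _ ⟨hy', hv', hw'⟩).trans (mul_le_mul_of_nonneg_left ?_ h0)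
    exact pow_le_pow_left₀ (norm_nonneg _) (hn ..) 2

section UnifBound

variable {H : Y × V × W → F} {𝒴 : Set Y} {B : Set V} {S : Set W} {K : ℝ}

theorem UnifBound.norm_tangent_le (hK : UnifBound H 𝒴 B S K) {y : Y} (hy : y ∈ 𝒴)
    {y' : Θ →L[ℝ] Y} {v : V} (hv : v ∈ B) {w : W} (hw : w ∈ S) {J : Θ →L[ℝ] W} {Cy j : ℝ}
    (hy' : ‖y'‖ ≤ Cy) (hJ : ‖J‖ ≤ j) : ‖tangent H y y' v w J‖ ≤ K * (Cy + j) :=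
  (ContinuousLinearMap.opNorm_comp_le _ _).trans
    (mul_le_mul (hK.bound_fderiv y hy v hv w hw) (norm_prod_zero_prod_le hy' hJ) (norm_nonneg _)
      hK.nonneg)

theorem UnifBound.norm_tangent_sub_le (hK : UnifBound H 𝒴 B S K) {y : Y} (hy : y ∈ 𝒴)
    {y' : Θ →L[ℝ] Y} {v v' : V} (hv : v ∈ B) (hv' : v' ∈ B) {w w' : W} (hw : w ∈ S) (hw' : w' ∈ S)
    {J : Θ →L[ℝ] W} {Cy j : ℝ} (hy' : ‖y'‖ ≤ Cy) (hJ : ‖J‖ ≤ j) :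
    ‖tangent H y y' v w J - tangent H y y' v' w' J‖
      ≤ K * (‖v - v'‖ + ‖w - w'‖) * (Cy + j) := by
  have e : tangent H y y' v w J - tangent H y y' v' w' J
      = (fderiv ℝ H (y, v, w) - fderiv ℝ H (y, v', w')).comp (y'.prod ((0 : Θ →L[ℝ] V).prod J)) :=
    (ContinuousLinearMap.sub_comp _ _ _).symm
  have h := hK.lip_fderiv y hy v' hv' w' hw' y hy v hv w hw
  rw [sub_self, norm_zero, zero_add] at h
  rw [e]
  exact (ContinuousLinearMap.opNorm_comp_le _ _).trans
    (mul_le_mul h (norm_prod_zero_prod_le hy' hJ) (norm_nonneg _)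
      ((norm_nonneg _).trans h))

theorem UnifBound.norm_tangent_sub_tangent_le (hK : UnifBound H 𝒴 B S K) {y : Y} (hy : y ∈ 𝒴)
    (y' : Θ →L[ℝ] Y) {v : V} (hv : v ∈ B) {w : W} (hw : w ∈ S) (J J' : Θ →L[ℝ] W) :
    ‖tangent H y y' v w J - tangent H y y' v w J'‖ ≤ K * ‖J - J'‖ := by
  refine ContinuousLinearMap.opNorm_le_bound _ (mul_nonneg hK.nonneg (norm_nonneg _)) fun τ => ?_
  rw [sub_apply, tangent_sub]
  refine ((fderiv ℝ H (y, v, w)).le_of_opNorm_le (hK.bound_fderiv y hy v hv w hw) _).trans ?_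
  rw [mul_assoc]
  refine mul_le_mul_of_nonneg_left ?_ hK.nonneg
  simpa [Prod.norm_def] using (J - J').le_opNorm τ

end UnifBound

/-- A smooth family of memory updates `Gf (y, u, w)` with parameter `y ∈ 𝒴` that preserves `S` and
whose derivative in the memory contracts the norm `‖D ·‖` with rate `c`. By `lower` the latter is
equivalent to the given norm. -/
structure ParamSystem (Gf : Y × U × W → W) (𝒴 : Set Y) (S : Set W) (D : W →L[ℝ] W) (b c : ℝ) :
    Prop where
  smooth : ContDiff ℝ 2 Gf
  compact : IsCompact S
  convex : Convex ℝ S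
  one_le : 1 ≤ b
  rate_nonneg : 0 ≤ c
  rate_lt_one : c < 1
  lower : ∀ w, ‖w‖ ≤ b * ‖D w‖
  preserves : ∀ y ∈ 𝒴, Preserves (fun u w => Gf (y, u, w)) S
  contr : ∀ y ∈ 𝒴, ∀ u, ‖u‖ ≤ 1 → ∀ w ∈ S, ∀ δ,
    ‖D (fderiv ℝ Gf (y, u, w) (0, 0, δ))‖ ≤ c * ‖D δ‖

/-- A differentiable curve of parameters with values in `𝒴` and derivatives bounded by `Cy`. -/
structure ParamCurve (y : Θ → Y) (y' : Θ → Θ →L[ℝ] Y) (𝒴 : Set Y) (Cy : ℝ) : Prop where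
  mem : ∀ θ, y θ ∈ 𝒴
  hasFDerivAt : ∀ θ, HasFDerivAt y (y' θ) θ
  nonneg : 0 ≤ Cy
  bound : ∀ θ, ‖y' θ‖ ≤ Cy

theorem ParamCurve.norm_sub_le {y : Θ → Y} {y' : Θ → Θ →L[ℝ] Y} {𝒴 : Set Y} {Cy : ℝ}
    (hy : ParamCurve y y' 𝒴 Cy) (θ θ' : Θ) : ‖y θ' - y θ‖ ≤ Cy * ‖θ' - θ‖ :=
  convex_univ.norm_image_sub_le_of_norm_hasFDerivWithin_le
    (fun θ _ => (hy.hasFDerivAt θ).hasFDerivWithinAt) (fun θ _ => hy.bound θ) trivial trivial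

variable {Gf : Y × U × W → W} {𝒴 : Set Y} {S : Set W} {D : W →L[ℝ] W} {b c : ℝ}

theorem ParamSystem.norm_map_sub_le_memory (hP : ParamSystem Gf 𝒴 S D b c) {y : Y} (hy : y ∈ 𝒴)
    {u : U} (hu : ‖u‖ ≤ 1) {w w' : W} (hw : w ∈ S) (hw' : w' ∈ S) :
    ‖D (Gf (y, u, w') - Gf (y, u, w))‖ ≤ c * ‖D (w' - w)‖ := by
  have hd : Differentiable ℝ Gf := hP.smooth.differentiable (by norm_num)
  have hγ : ∀ s : ℝ, HasDerivAt (fun s : ℝ => ((y, u, w + s • (w' - w)) : Y × U × W))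
      (0, 0, w' - w) s := by
    intro s
    have h1 : HasDerivAt (fun s : ℝ => w + s • (w' - w)) (w' - w) s := by
      simpa using ((hasDerivAt_id s).smul_const (w' - w)).const_add w
    exact (hasDerivAt_const s y).prodMk ((hasDerivAt_const s u).prodMk h1)
  have hf : ∀ s : ℝ, HasDerivAt (fun s : ℝ => D (Gf (y, u, w + s • (w' - w))))
      (D (fderiv ℝ Gf (y, u, w + s • (w' - w)) (0, 0, w' - w))) s := fun s =>
    D.hasFDerivAt.comp_hasDerivAt s ((hd _).hasFDerivAt.comp_hasDerivAt s (hγ s))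
  have := norm_image_sub_le_of_norm_deriv_le_segment_01' (C := c * ‖D (w' - w)‖)
    (fun s _ => (hf s).hasDerivWithinAt) (fun s hs => by
      refine hP.contr y hy u hu _ ?_ _
      have := hP.convex.add_smul_sub_mem hw hw' ⟨hs.1, hs.2.le⟩
      exact this)
  simpa using this

theorem ParamSystem.norm_le_comp (hP : ParamSystem Gf 𝒴 S D b c) (J : Θ →L[ℝ] W) :
    ‖J‖ ≤ b * ‖D.comp J‖ := by
  have hb : 0 ≤ b := zero_le_one.trans hP.one_le
  refine ContinuousLinearMap.opNorm_le_bound _ (by positivity) fun τ => ?_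
  refine (hP.lower _).trans ?_
  rw [mul_assoc]
  exact mul_le_mul_of_nonneg_left ((D.comp J).le_opNorm τ) hb

variable [MeasurableSpace W] [BorelSpace W] {K : ℝ}

theorem ParamSystem.contracts (hP : ParamSystem Gf 𝒴 S D b c)
    (hK : UnifBound Gf 𝒴 (Metric.closedBall 0 1) S K) {y : Y} (hy : y ∈ 𝒴) :
    Contracts (fun u w => Gf (y, u, w)) S (fun w w' => ‖D (w - w')‖) (‖D‖ * K) c where
  meas := hP.compact.isClosed.measurableSet
  preserves := hP.preserves y hy
  nonneg _ _ := norm_nonneg _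
  rate_nonneg := hP.rate_nonneg
  rate_lt_one := hP.rate_lt_one
  lip u u' hu hu' w hw w' hw' := by
    have h1 := hK.lip y hy u' (by simpa using hu') w hw y hy u (by simpa using hu) w hw
    simp only [sub_self, norm_zero, zero_add, add_zero] at h1
    have h2 := hP.norm_map_sub_le_memory hy hu' hw' hw
    have e : Gf (y, u, w) - Gf (y, u', w')
        = (Gf (y, u, w) - Gf (y, u', w)) + (Gf (y, u', w) - Gf (y, u', w')) := by abel
    rw [e, map_add]
    refine (norm_add_le _ _).trans (add_le_add ?_ h2)
    rw [mul_assoc]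
    exact D.le_opNorm_of_le h1

/-- The update of the memory together with its derivative in the parameter. -/
def tangentMap (Gf : Y × U × W → W) (y : Y) (y' : Θ →L[ℝ] Y) (u : U) (p : W × (Θ →L[ℝ] W)) :
    W × (Θ →L[ℝ] W) :=
  (Gf (y, u, p.1), tangent Gf y y' u p.1 p.2)

/-- A bound for `‖D J‖`, where `J` is the derivative of the memory in the parameter: the fixed point
of `j ↦ ‖D‖ K Cy + c j`. -/
def tangentBound (D : W →L[ℝ] W) (c Cy K : ℝ) : ℝ := ‖D‖ * K * Cy / (1 - c)

/-- The set of memories in `S` with derivatives that are bounded by `tangentBound`. -/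
def tangentSet (Θ : Type*) [NormedAddCommGroup Θ] [NormedSpace ℝ Θ] (S : Set W) (D : W →L[ℝ] W)
    (c Cy K : ℝ) : Set (W × (Θ →L[ℝ] W)) :=
  {p | p.1 ∈ S ∧ ‖D.comp p.2‖ ≤ tangentBound D c Cy K}

theorem isClosed_tangentSet (hS : IsClosed S) (c Cy K : ℝ) :
    IsClosed (tangentSet Θ S D c Cy K) := by
  have h : Continuous fun p : W × (Θ →L[ℝ] W) => ‖D.comp p.2‖ := by fun_prop
  exact (hS.preimage continuous_fst).inter (isClosed_le h continuous_const)

theorem ParamSystem.norm_comp_tangent_sub_le (hP : ParamSystem Gf 𝒴 S D b c) {y : Y} (hy : y ∈ 𝒴)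
    (y' : Θ →L[ℝ] Y) {u : U} (hu : ‖u‖ ≤ 1) {w : W} (hw : w ∈ S) (J J' : Θ →L[ℝ] W) :
    ‖D.comp (tangent Gf y y' u w J - tangent Gf y y' u w J')‖ ≤ c * ‖D.comp (J - J')‖ := by
  refine ContinuousLinearMap.opNorm_le_bound _
    (mul_nonneg hP.rate_nonneg (norm_nonneg _)) fun τ => ?_
  rw [ContinuousLinearMap.comp_apply, sub_apply, tangent_sub]
  refine (hP.contr y hy u hu w hw _).trans ?_
  rw [mul_assoc]
  exact mul_le_mul_of_nonneg_left ((D.comp (J - J')).le_opNorm τ) hP.rate_nonneg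

theorem tangentBound_nonneg {Cy : ℝ} (hc : c < 1) (hCy : 0 ≤ Cy) (hK : 0 ≤ K) :
    0 ≤ tangentBound D c Cy K := by
  have : 0 < 1 - c := by linarith
  unfold tangentBound; positivity

theorem ParamSystem.preserves_tangentMap (hP : ParamSystem Gf 𝒴 S D b c)
    (hK : UnifBound Gf 𝒴 (Metric.closedBall 0 1) S K) {y : Y} (hy : y ∈ 𝒴) {y' : Θ →L[ℝ] Y}
    {Cy : ℝ} (hy' : ‖y'‖ ≤ Cy) :
    Preserves (tangentMap Gf y y') (tangentSet Θ S D c Cy K) := by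
  intro u hu p hp
  refine ⟨hP.preserves y hy u hu _ hp.1, ?_⟩
  have h0 := hK.norm_tangent_le hy (v := u) (by simpa using hu) hp.1 hy'
    (J := (0 : Θ →L[ℝ] W)) (j := 0) (by simp)
  have h1 := hP.norm_comp_tangent_sub_le hy y' hu hp.1 p.2 0
  have h2 : ‖D.comp (tangent Gf y y' u p.1 0)‖ ≤ ‖D‖ * (K * (Cy + 0)) :=
    (ContinuousLinearMap.opNorm_comp_le _ _).trans
      (mul_le_mul_of_nonneg_left h0 (norm_nonneg _))
  rw [sub_zero, ContinuousLinearMap.comp_sub] at h1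
  have h3 := norm_le_norm_add_norm_sub' (D.comp (tangent Gf y y' u p.1 p.2))
    (D.comp (tangent Gf y y' u p.1 0))
  have h4 := mul_le_mul_of_nonneg_left hp.2 hP.rate_nonneg
  have h5 : 0 < 1 - c := by linarith [hP.rate_lt_one]
  have h6 : ‖D‖ * (K * (Cy + 0)) = (1 - c) * tangentBound D c Cy K := by
    rw [tangentBound]; field_simp; ring
  change ‖D.comp (tangent Gf y y' u p.1 p.2)‖ ≤ _
  nlinarith

/-- The weight of the memory in the distance that tangent chains contract. The update of the
derivative `J` depends on the memory as well; a large weight of the memory absorbs this dependence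
at the expense of the rate `(1 + c) / 2` in place of `c`. -/
def tangentWeight (D : W →L[ℝ] W) (b c Cy K : ℝ) : ℝ :=
  1 + 2 * (‖D‖ * K * (Cy + b * tangentBound D c Cy K) * b) / (1 - c)

/-- Tangent chains are contracting as well. -/
theorem ParamSystem.contracts_tangentMap [MeasurableSpace (W × (Θ →L[ℝ] W))]
    [OpensMeasurableSpace (W × (Θ →L[ℝ] W))] (hP : ParamSystem Gf 𝒴 S D b c)
    (hK : UnifBound Gf 𝒴 (Metric.closedBall 0 1) S K) {y : Y} (hy : y ∈ 𝒴) {y' : Θ →L[ℝ] Y}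
    {Cy : ℝ} (hCy : 0 ≤ Cy) (hy' : ‖y'‖ ≤ Cy) :
    Contracts (tangentMap Gf y y') (tangentSet Θ S D c Cy K)
      (fun p p' => tangentWeight D b c Cy K * ‖D (p.1 - p'.1)‖ + ‖D.comp (p.2 - p'.2)‖)
      (tangentWeight D b c Cy K * (‖D‖ * K) + ‖D‖ * K * (Cy + b * tangentBound D c Cy K))
      ((1 + c) / 2) := by
  have hb : 0 ≤ b := zero_le_one.trans hP.one_le
  have hc1 : 0 < 1 - c := by linarith [hP.rate_lt_one]
  have hc0 := hP.rate_nonneg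
  have hj := tangentBound_nonneg (D := D) hP.rate_lt_one hCy hK.nonneg
  have hK0 := hK.nonneg
  set j := tangentBound D c Cy K with hjdef
  set M := ‖D‖ * K * (Cy + b * j) with hM
  have hM0 : 0 ≤ M := by positivity
  have hA0 : 0 ≤ tangentWeight D b c Cy K := by unfold tangentWeight; positivity
  have hAeq : (tangentWeight D b c Cy K - 1) * (1 - c) = 2 * (M * b) := by
    rw [tangentWeight]; field_simp; ring
  set A := tangentWeight D b c Cy K with hA
  refine ⟨(isClosed_tangentSet hP.compact.isClosed c Cy K).measurableSet,
    hP.preserves_tangentMap hK hy hy', fun p p' => by positivity,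
    by linarith, by linarith, ?_⟩
  intro u u' hu hu' p hp p' hp'
  have h1 := (hP.contracts hK hy).lip u u' hu hu' p.1 hp.1 p'.1 hp'.1
  have hJ : ∀ p ∈ tangentSet Θ S D c Cy K, ‖p.2‖ ≤ b * j := fun p hp =>
    (hP.norm_le_comp p.2).trans (mul_le_mul_of_nonneg_left hp.2 hb)
  have h2 := hK.norm_tangent_sub_le hy (v := u) (v' := u') (by simpa using hu) (by simpa using hu')
    hp.1 hp'.1 hy' (hJ p hp)
  have h3 := hP.norm_comp_tangent_sub_le hy y' hu' hp'.1 p.2 p'.2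
  have h4 := hP.lower (p.1 - p'.1)
  have e : tangent Gf y y' u p.1 p.2 - tangent Gf y y' u' p'.1 p'.2
      = (tangent Gf y y' u p.1 p.2 - tangent Gf y y' u' p'.1 p.2)
        + (tangent Gf y y' u' p'.1 p.2 - tangent Gf y y' u' p'.1 p'.2) := by abel
  have h5 : ‖D.comp (tangent Gf y y' u p.1 p.2 - tangent Gf y y' u' p'.1 p'.2)‖
      ≤ M * ‖u - u'‖ + M * b * ‖D (p.1 - p'.1)‖ + c * ‖D.comp (p.2 - p'.2)‖ := by
    rw [e, ContinuousLinearMap.comp_add]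
    refine (norm_add_le _ _).trans (add_le_add ?_ h3)
    refine (ContinuousLinearMap.opNorm_comp_le _ _).trans
      ((mul_le_mul_of_nonneg_left h2 (norm_nonneg D)).trans ?_)
    calc ‖D‖ * (K * (‖u - u'‖ + ‖p.1 - p'.1‖) * (Cy + b * j))
        = M * (‖u - u'‖ + ‖p.1 - p'.1‖) := by rw [hM]; ring
      _ ≤ M * (‖u - u'‖ + b * ‖D (p.1 - p'.1)‖) := by gcongr
      _ = _ := by ring
  have h6 := mul_le_mul_of_nonneg_left h1 hA0
  have h7 := norm_nonneg (D.comp (p.2 - p'.2))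
  have h8 : A * c + M * b ≤ (1 + c) / 2 * A := by nlinarith
  have h9 := mul_le_mul_of_nonneg_right h8 (norm_nonneg (D (p.1 - p'.1)))
  change A * ‖D (Gf (y, u, p.1) - Gf (y, u', p'.1))‖
    + ‖D.comp (tangent Gf y y' u p.1 p.2 - tangent Gf y y' u' p'.1 p'.2)‖ ≤ _
  nlinarith [mul_nonneg hc1.le h7]

end Tangent

/-! ### Differentiability of expectations in the parameter -/

section Deriv

variable {U W Y Θ F : Type*}
  [NormedAddCommGroup U] [NormedSpace ℝ U] [MeasurableSpace U] [BorelSpace U]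
  [SecondCountableTopology U]
  [NormedAddCommGroup W] [NormedSpace ℝ W] [MeasurableSpace W] [BorelSpace W]
  [FiniteDimensional ℝ W]
  [NormedAddCommGroup Y] [NormedSpace ℝ Y]
  [NormedAddCommGroup Θ] [NormedSpace ℝ Θ] [FiniteDimensional ℝ Θ]
  [NormedAddCommGroup F] [NormedSpace ℝ F] [FiniteDimensional ℝ F]
  {κ : Kernel U U} {ν : Measure ℝ} {ℓ : ℝ} {E : Set ℝ}
  {Gf : Y × U × W → W} {𝒴 : Set Y} {S : Set W} {D : W →L[ℝ] W} {b c : ℝ}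
  {y : Θ → Y} {y' : Θ → Θ →L[ℝ] Y} {Cy K : ℝ}
  {f : U × ℝ → ℝ} {Lf : ℝ} {Ψ : Y × ℝ × W → F} {K' : ℝ}

/-- The observable `Ψ (y, f (u, η), w)`. -/
def obs (f : U × ℝ → ℝ) (Ψ : Y × ℝ × W → F) (y : Y) (h : U × W × ℝ) : F :=
  Ψ (y, f (h.1, h.2.2), h.2.1)

/-- The derivative of `obs` in the parameter, as an observable of the tangent chain. -/
def tangentObs (f : U × ℝ → ℝ) (Ψ : Y × ℝ × W → F) (y : Y) (y' : Θ →L[ℝ] Y)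
    (h : U × (W × (Θ →L[ℝ] W)) × ℝ) : Θ →L[ℝ] F :=
  tangent Ψ y y' (f (h.1, h.2.2)) h.2.1.1 h.2.1.2

theorem measurable_paramMap (hG : ContDiff ℝ 2 Gf) (y : Y) :
    Measurable fun h : U × W × ℝ => Gf (y, h.1, h.2.1) := by
  have := FiniteDimensional.proper_real W
  have h := hG.continuous
  refine Continuous.measurable ?_
  fun_prop

theorem measurable_tangentMap (hG : ContDiff ℝ 2 Gf) (y : Y) (y' : Θ →L[ℝ] Y) :
    Measurable fun h : U × (W × (Θ →L[ℝ] W)) × ℝ => tangentMap Gf y y' h.1 h.2.1 := by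
  have := FiniteDimensional.proper_real W
  have := FiniteDimensional.proper_real (Θ →L[ℝ] W)
  have h := hG.continuous
  have h2 := continuous_tangent hG y y'
  refine Continuous.measurable ?_
  unfold tangentMap
  refine Continuous.prodMk (by fun_prop) ?_
  exact h2.comp (by fun_prop : Continuous fun h : U × (W × (Θ →L[ℝ] W)) × ℝ =>
    (h.1, h.2.1.1, h.2.1.2))

/-- A bounded Lipschitz map `f` and a twice continuously differentiable `Ψ`, with the constants of
`Ψ` on the relevant set. -/
structure ObsData (f : U × ℝ → ℝ) (Lf : ℝ) (Ψ : Y × ℝ × W → F) (𝒴 : Set Y) (S : Set W) (K' : ℝ) :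
    Prop where
  lip : ∀ p p', |f p - f p'| ≤ Lf * ‖p - p'‖
  bounded : ∀ p, |f p| ≤ Lf
  smooth : ContDiff ℝ 2 Ψ
  unif : UnifBound Ψ 𝒴 (Metric.closedBall 0 Lf) S K'

theorem ObsData.nonneg (hO : ObsData f Lf Ψ 𝒴 S K') : 0 ≤ Lf :=
  (abs_nonneg _).trans (hO.bounded 0)

theorem ObsData.mem (hO : ObsData f Lf Ψ 𝒴 S K') (p : U × ℝ) :
    f p ∈ Metric.closedBall (0 : ℝ) Lf := by
  simpa using hO.bounded p

theorem ObsData.continuous (hO : ObsData f Lf Ψ 𝒴 S K') : Continuous f :=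
  (LipschitzWith.of_dist_le_mul (K := ⟨Lf, hO.nonneg⟩) fun p p' => by
    rw [Real.dist_eq, dist_eq_norm]; exact hO.lip p p').continuous

theorem ObsData.norm_input_le (hO : ObsData f Lf Ψ 𝒴 S K') (u u' : U) (η : ℝ) :
    ‖f (u, η) - f (u', η)‖ ≤ Lf * ‖u - u'‖ := by
  simpa [Prod.norm_def] using hO.lip (u, η) (u', η)

theorem ObsData.observable (hO : ObsData f Lf Ψ 𝒴 S K') {y : Y} (hy : y ∈ 𝒴) :
    Observable (region U S E) (obs f Ψ y) K' where
  meas := by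
    have := FiniteDimensional.proper_real W
    have h1 := hO.continuous
    have h2 := hO.smooth.continuous
    refine Continuous.stronglyMeasurable ?_
    unfold obs; fun_prop
  bound h hh := hO.unif.bound y hy _ (hO.mem _) _ hh.2.1

theorem ObsData.memLipschitz (hO : ObsData f Lf Ψ 𝒴 S K') (hP : ParamSystem Gf 𝒴 S D b c)
    {y : Y} (hy : y ∈ 𝒴) :
    MemLipschitz S E (fun w w' => ‖D (w - w')‖) (obs (U := U) f Ψ y) (K' * (Lf + b)) := by
  intro u u' w w' η hu hu' hw hw' hη
  have h1 := hO.unif.lip y hy _ (hO.mem (u', η)) w' hw' y hy _ (hO.mem (u, η)) w hw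
  have h2 := hO.norm_input_le u u' η
  have h3 := hP.lower (w - w')
  have h4 := hO.nonneg
  have h5 := hP.one_le
  rw [sub_self, norm_zero, zero_add] at h1
  refine h1.trans ?_
  rw [mul_assoc]
  refine mul_le_mul_of_nonneg_left ?_ hO.unif.nonneg
  nlinarith [norm_nonneg (u - u'), norm_nonneg (D (w - w'))]

theorem ParamSystem.norm_snd_le_of_mem (hP : ParamSystem Gf 𝒴 S D b c)
    {p : W × (Θ →L[ℝ] W)} (hp : p ∈ tangentSet Θ S D c Cy K) :
    ‖p.2‖ ≤ b * tangentBound D c Cy K :=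
  (hP.norm_le_comp p.2).trans (mul_le_mul_of_nonneg_left hp.2 (zero_le_one.trans hP.one_le))

theorem ObsData.observable_tangentObs (hO : ObsData f Lf Ψ 𝒴 S K')
    (hP : ParamSystem Gf 𝒴 S D b c) {y : Y} (hy : y ∈ 𝒴) {y' : Θ →L[ℝ] Y} (hy' : ‖y'‖ ≤ Cy) :
    Observable (region U (tangentSet Θ S D c Cy K) E) (tangentObs f Ψ y y')
      (K' * (Cy + b * tangentBound D c Cy K)) where
  meas := by
    have := FiniteDimensional.proper_real W
    have := FiniteDimensional.proper_real (Θ →L[ℝ] W)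
    have h1 := hO.continuous
    have h2 := continuous_tangent hO.smooth y y'
    refine Continuous.stronglyMeasurable ?_
    exact h2.comp (by fun_prop : Continuous fun h : U × (W × (Θ →L[ℝ] W)) × ℝ =>
      (f (h.1, h.2.2), h.2.1.1, h.2.1.2))
  bound h hh := hO.unif.norm_tangent_le hy (hO.mem _) hh.2.1.1 hy' (hP.norm_snd_le_of_mem hh.2.1)

theorem ObsData.memLipschitz_tangentObs (hO : ObsData f Lf Ψ 𝒴 S K')
    (hP : ParamSystem Gf 𝒴 S D b c) {y : Y} (hy : y ∈ 𝒴) {y' : Θ →L[ℝ] Y} (hCy : 0 ≤ Cy)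
    (hK : 0 ≤ K) (hy' : ‖y'‖ ≤ Cy) :
    MemLipschitz (tangentSet Θ S D c Cy K) E
      (fun p p' => tangentWeight D b c Cy K * ‖D (p.1 - p'.1)‖ + ‖D.comp (p.2 - p'.2)‖)
      (tangentObs (U := U) f Ψ y y')
      (K' * (Lf + b) * (Cy + b * tangentBound D c Cy K + 1)) := by
  intro u u' p p' η hu hu' hp hp' hη
  have hj := hP.norm_snd_le_of_mem hp
  have hj0 := tangentBound_nonneg (D := D) hP.rate_lt_one hCy hK
  have hb := hP.one_le
  have hLf := hO.nonneg
  have hK' := hO.unif.nonneg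
  have hA : 1 ≤ tangentWeight D b c Cy K := by
    have : 0 < 1 - c := by linarith [hP.rate_lt_one]
    have hb0 : 0 ≤ b := by linarith
    rw [tangentWeight, le_add_iff_nonneg_right]; positivity
  set j := tangentBound D c Cy K
  set A := tangentWeight D b c Cy K
  have hb0 : 0 ≤ b := by linarith
  have hbj : 0 ≤ b * j := by positivity
  have h1 := hO.unif.norm_tangent_sub_le hy (hO.mem (u, η)) (hO.mem (u', η)) hp.1 hp'.1 hy' hj
  have h2 := hO.unif.norm_tangent_sub_tangent_le hy y' (hO.mem (u', η)) hp'.1 p.2 p'.2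
  have h3 := hO.norm_input_le u u' η
  have h4 := hP.lower (p.1 - p'.1)
  have h5 := hP.norm_le_comp (p.2 - p'.2)
  have e : tangentObs f Ψ y y' (u, p, η) - tangentObs f Ψ y y' (u', p', η)
      = (tangent Ψ y y' (f (u, η)) p.1 p.2 - tangent Ψ y y' (f (u', η)) p'.1 p.2)
        + (tangent Ψ y y' (f (u', η)) p'.1 p.2 - tangent Ψ y y' (f (u', η)) p'.1 p'.2) := by
    simp [tangentObs]
  rw [e]
  refine (norm_add_le _ _).trans ((add_le_add h1 h2).trans ?_)
  have n1 := norm_nonneg (u - u')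
  have n2 := norm_nonneg (D (p.1 - p'.1))
  have n3 := norm_nonneg (D.comp (p.2 - p'.2))
  have n4 : ‖D (p.1 - p'.1)‖ ≤ A * ‖D (p.1 - p'.1)‖ := le_mul_of_one_le_left n2 hA
  have q1 : ‖f (u, η) - f (u', η)‖ + ‖p.1 - p'.1‖
      ≤ (Lf + b) * (‖u - u'‖ + A * ‖D (p.1 - p'.1)‖) := by nlinarith
  have q2 : ‖p.2 - p'.2‖ ≤ (Lf + b) * ‖D.comp (p.2 - p'.2)‖ := by nlinarith
  calc K' * (‖f (u, η) - f (u', η)‖ + ‖p.1 - p'.1‖) * (Cy + b * j) + K' * ‖p.2 - p'.2‖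
      ≤ K' * ((Lf + b) * (‖u - u'‖ + A * ‖D (p.1 - p'.1)‖)) * (Cy + b * j)
          + K' * ((Lf + b) * ‖D.comp (p.2 - p'.2)‖) := by gcongr
    _ = K' * (Lf + b) * ((‖u - u'‖ + A * ‖D (p.1 - p'.1)‖) * (Cy + b * j)
          + ‖D.comp (p.2 - p'.2)‖) := by ring
    _ ≤ K' * (Lf + b) * ((Cy + b * j + 1) *
          (‖u - u'‖ + (A * ‖D (p.1 - p'.1)‖ + ‖D.comp (p.2 - p'.2)‖))) := by
        gcongr
        have := mul_nonneg (add_nonneg hCy hbj) n3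
        nlinarith
    _ = _ := by ring

/-- The relation that links, for two parameters with difference `Δ`, the memory `w'` of the chain at
the second parameter and the memory and its derivative `p` at the first one: `w'` is approximated to
first order. -/
def FirstOrder (S : Set W) (D : W →L[ℝ] W) (c Cy K ε : ℝ) (Δ : Θ) (p : W × (Θ →L[ℝ] W)) (w' : W) :
    Prop :=
  p ∈ tangentSet Θ S D c Cy K ∧ w' ∈ S ∧ ‖D (w' - p.1)‖ ≤ tangentBound D c Cy K * ‖Δ‖ ∧
    ‖D (w' - p.1 - p.2 Δ)‖ ≤ ε * ‖Δ‖

/-- Remainder of the first order expansion of `H (y θ', v, w')` at `(y θ, v, w)`. -/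
theorem UnifBound.norm_sub_tangent_le {V : Type*} [NormedAddCommGroup V] [NormedSpace ℝ V]
    {H : Y × V × W → F} {B : Set V} (hK : UnifBound H 𝒴 B S K') {y₀ y₁ : Y} (h₀ : y₀ ∈ 𝒴)
    (h₁ : y₁ ∈ 𝒴) (y' : Θ →L[ℝ] Y) {v : V} (hv : v ∈ B) {w w' : W} (hw : w ∈ S) (hw' : w' ∈ S)
    (J : Θ →L[ℝ] W) (Δ : Θ) {A ρ : ℝ} (hA : ‖y₁ - y₀‖ + ‖w' - w‖ ≤ A * ‖Δ‖) (hΔ : ‖Δ‖ ≤ ρ)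
    (hρ : ‖y₁ - y₀ - y' Δ‖ ≤ ρ * ‖Δ‖) :
    ‖H (y₁, v, w') - H (y₀, v, w) - tangent H y₀ y' v w J Δ
        - fderiv ℝ H (y₀, v, w) (0, 0, w' - w - J Δ)‖ ≤ K' * ((A ^ 2 + 1) * ρ) * ‖Δ‖ := by
  have h1 := hK.taylor y₀ h₀ v hv w hw y₁ h₁ v hv w' hw'
  have h2 := (fderiv ℝ H (y₀, v, w)).le_of_opNorm_le (hK.bound_fderiv y₀ h₀ v hv w hw)
    (y₁ - y₀ - y' Δ, 0, 0)
  have e : H (y₁, v, w') - H (y₀, v, w) - tangent H y₀ y' v w J Δ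
        - fderiv ℝ H (y₀, v, w) (0, 0, w' - w - J Δ)
      = (H (y₁, v, w') - H (y₀, v, w) - fderiv ℝ H (y₀, v, w) (y₁ - y₀, v - v, w' - w))
        + fderiv ℝ H (y₀, v, w) (y₁ - y₀ - y' Δ, 0, 0) := by
    have e1 : ((y₁ - y₀, v - v, w' - w) : Y × V × W)
        = (y₁ - y₀ - y' Δ, 0, 0) + (y' Δ, 0, J Δ) + (0, 0, w' - w - J Δ) := by
      simp
    rw [e1, map_add, map_add, tangent_apply]
    abel
  have h3 : ‖((y₁ - y₀ - y' Δ, 0, 0) : Y × V × W)‖ = ‖y₁ - y₀ - y' Δ‖ := by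
    simp [Prod.norm_def]
  rw [h3] at h2
  rw [sub_self, norm_zero, add_zero] at h1
  have hn := norm_nonneg Δ
  have hs : (‖y₁ - y₀‖ + ‖w' - w‖) ^ 2 ≤ A ^ 2 * ρ * ‖Δ‖ := by
    calc (‖y₁ - y₀‖ + ‖w' - w‖) ^ 2 ≤ (A * ‖Δ‖) ^ 2 := pow_le_pow_left₀ (by positivity) hA 2
      _ = A ^ 2 * ‖Δ‖ * ‖Δ‖ := by ring
      _ ≤ A ^ 2 * ρ * ‖Δ‖ := by gcongr
  rw [e]
  rw [sub_self]
  refine (norm_add_le _ _).trans ((add_le_add h1 h2).trans ?_)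
  have := hK.nonneg
  calc K' * (‖y₁ - y₀‖ + ‖w' - w‖) ^ 2 + K' * ‖y₁ - y₀ - y' Δ‖
      ≤ K' * (A ^ 2 * ρ * ‖Δ‖) + K' * (ρ * ‖Δ‖) := by gcongr
    _ = _ := by ring

end Deriv

section Deriv

variable {U W Y Θ F : Type*}
  [NormedAddCommGroup U] [NormedSpace ℝ U] [MeasurableSpace U] [BorelSpace U]
  [SecondCountableTopology U]
  [NormedAddCommGroup W] [NormedSpace ℝ W] [MeasurableSpace W] [BorelSpace W]
  [FiniteDimensional ℝ W]
  [NormedAddCommGroup Y] [NormedSpace ℝ Y]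
  [NormedAddCommGroup Θ] [NormedSpace ℝ Θ] [FiniteDimensional ℝ Θ]
  [NormedAddCommGroup F] [NormedSpace ℝ F] [FiniteDimensional ℝ F]
  {κ : Kernel U U} {ν : Measure ℝ} {ℓ : ℝ} {E : Set ℝ}
  {Gf : Y × U × W → W} {𝒴 : Set Y} {S : Set W} {D : W →L[ℝ] W} {b c : ℝ}
  {y : Θ → Y} {y' : Θ → Θ →L[ℝ] Y} {Cy K : ℝ}
  {f : U × ℝ → ℝ} {Lf : ℝ} {Ψ : Y × ℝ × W → F} {K' : ℝ}

theorem FirstOrder.norm_sub_le (hP : ParamSystem Gf 𝒴 S D b c) {ε : ℝ} {Δ : Θ}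
    {p : W × (Θ →L[ℝ] W)} {w' : W} (h : FirstOrder S D c Cy K ε Δ p w') :
    ‖w' - p.1‖ ≤ b * tangentBound D c Cy K * ‖Δ‖ := by
  rw [mul_assoc]
  exact (hP.lower _).trans (mul_le_mul_of_nonneg_left h.2.2.1 (zero_le_one.trans hP.one_le))

/-- The relation `FirstOrder` is preserved in time with the same precision `ε`: a step multiplies
the remainder by the contraction rate `c`, which leaves room for the new remainder of the Taylor
expansion if the parameters are close. -/
theorem FirstOrder.step (hP : ParamSystem Gf 𝒴 S D b c)
    (hK : UnifBound Gf 𝒴 (Metric.closedBall 0 1) S K) {y₀ y₁ : Y} (h₀ : y₀ ∈ 𝒴) (h₁ : y₁ ∈ 𝒴)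
    {y' : Θ →L[ℝ] Y} (hy' : ‖y'‖ ≤ Cy) {ε ρ : ℝ} {Δ : Θ}
    (hL : ‖y₁ - y₀‖ ≤ Cy * ‖Δ‖) (hΔ : ‖Δ‖ ≤ ρ) (hρ : ‖y₁ - y₀ - y' Δ‖ ≤ ρ * ‖Δ‖)
    (hsmall : ‖D‖ * (K * (((Cy + b * tangentBound D c Cy K) ^ 2 + 1) * ρ)) ≤ (1 - c) * ε)
    {u : U} (hu : ‖u‖ ≤ 1) {p : W × (Θ →L[ℝ] W)} {w' : W} (h : FirstOrder S D c Cy K ε Δ p w') :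
    FirstOrder S D c Cy K ε Δ (tangentMap Gf y₀ y' u p) (Gf (y₁, u, w')) := by
  have hu' : u ∈ Metric.closedBall (0 : U) 1 := by simpa using hu
  have hn := norm_nonneg Δ
  have hc : 0 < 1 - c := by linarith [hP.rate_lt_one]
  have hdist := h.norm_sub_le hP
  obtain ⟨hp, hw', h1, h2⟩ := h
  refine ⟨hP.preserves_tangentMap hK h₀ hy' u hu p hp, hP.preserves y₁ h₁ u hu w' hw', ?_, ?_⟩
  · have a1 := hK.lip y₀ h₀ u hu' w' hw' y₁ h₁ u hu' w' hw'
    simp only [sub_self, norm_zero, add_zero] at a1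
    have a2 := hP.norm_map_sub_le_memory h₀ hu hp.1 hw'
    have e : Gf (y₁, u, w') - Gf (y₀, u, p.1)
        = (Gf (y₁, u, w') - Gf (y₀, u, w')) + (Gf (y₀, u, w') - Gf (y₀, u, p.1)) := by abel
    have a3 : ‖D‖ * K * Cy = (1 - c) * tangentBound D c Cy K := by
      rw [tangentBound]; field_simp
    have a4 := D.le_opNorm_of_le (a1.trans (mul_le_mul_of_nonneg_left hL hK.nonneg))
    change ‖D (Gf (y₁, u, w') - Gf (y₀, u, p.1))‖ ≤ _
    rw [e, map_add]
    refine (norm_add_le _ _).trans ((add_le_add a4 a2).trans ?_)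
    calc ‖D‖ * (K * (Cy * ‖Δ‖)) + c * ‖D (w' - p.1)‖
        ≤ (‖D‖ * K * Cy) * ‖Δ‖ + c * (tangentBound D c Cy K * ‖Δ‖) := by
          have := mul_le_mul_of_nonneg_left h1 hP.rate_nonneg
          linarith
      _ = _ := by rw [a3]; ring
  · have a1 := hK.norm_sub_tangent_le h₀ h₁ y' hu' hp.1 hw' p.2 Δ
      (A := Cy + b * tangentBound D c Cy K) (by linarith) hΔ hρ
    have a2 := hP.contr y₀ h₀ u hu p.1 hp.1 (w' - p.1 - p.2 Δ)
    have a3 := mul_le_mul_of_nonneg_left h2 hP.rate_nonneg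
    have a4 := D.le_opNorm_of_le a1
    have e : Gf (y₁, u, w') - (tangentMap Gf y₀ y' u p).1 - (tangentMap Gf y₀ y' u p).2 Δ
        = (Gf (y₁, u, w') - Gf (y₀, u, p.1) - tangent Gf y₀ y' u p.1 p.2 Δ
            - fderiv ℝ Gf (y₀, u, p.1) (0, 0, w' - p.1 - p.2 Δ))
          + fderiv ℝ Gf (y₀, u, p.1) (0, 0, w' - p.1 - p.2 Δ) := by
      rw [tangentMap]; abel
    rw [e, map_add]
    refine (norm_add_le _ _).trans ((add_le_add a4 (a2.trans a3)).trans ?_)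
    have := mul_le_mul_of_nonneg_right hsmall hn
    nlinarith

/-- The expectation of the observable after `t` steps. -/
def meanObs (κ : Kernel U U) (ν : Measure ℝ) (hG : ContDiff ℝ 2 Gf) (f : U × ℝ → ℝ)
    (Ψ : Y × ℝ × W → F) (t : ℕ) (h : U × W × ℝ) (y : Y) : F :=
  iter (drive κ ν (fun u w => Gf (y, u, w)) (measurable_paramMap hG y)) t (obs f Ψ y) h

/-- The expectation of the derivative of the observable after `t` steps of the tangent chain, for
an initial state that does not depend on the parameter. -/
def meanTangentObs (κ : Kernel U U) (ν : Measure ℝ) (hG : ContDiff ℝ 2 Gf) (f : U × ℝ → ℝ)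
    (Ψ : Y × ℝ × W → F) (t : ℕ) (h : U × W × ℝ) (y : Y) (y' : Θ →L[ℝ] Y) : Θ →L[ℝ] F :=
  iter (drive κ ν (tangentMap Gf y y') (measurable_tangentMap hG y y')) t (tangentObs f Ψ y y')
    (h.1, (h.2.1, 0), h.2.2)

theorem mem_tangentSet_zero (hc : c < 1) (hCy : 0 ≤ Cy) (hK : 0 ≤ K) {w : W} (hw : w ∈ S) :
    ((w, 0) : W × (Θ →L[ℝ] W)) ∈ tangentSet Θ S D c Cy K :=
  ⟨hw, by simpa using tangentBound_nonneg (D := D) hc hCy hK⟩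

/-- Adding the memory derivative to the chain does not change the expectations of `obs`, and the
tangent observable can be evaluated at a direction `Δ`. -/
theorem Driver.iter_tangent_eq (hD : Driver κ ν ℓ E) (hP : ParamSystem Gf 𝒴 S D b c)
    (hK : UnifBound Gf 𝒴 (Metric.closedBall 0 1) S K) (hO : ObsData f Lf Ψ 𝒴 S K') {y : Y}
    (hy : y ∈ 𝒴) {y' : Θ →L[ℝ] Y} (hCy : 0 ≤ Cy) (hy' : ‖y'‖ ≤ Cy) (t : ℕ) {h : U × W × ℝ}
    (hh : h ∈ region U S E) (Δ : Θ) :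
    (∃ B, Observable (region U (tangentSet Θ S D c Cy K) E)
      (fun q => obs f Ψ y (q.1, q.2.1.1, q.2.2) + tangentObs f Ψ y y' q Δ) B) ∧
    iter (drive κ ν (tangentMap Gf y y') (measurable_tangentMap hP.smooth y y')) t
        (fun q => obs f Ψ y (q.1, q.2.1.1, q.2.2) + tangentObs f Ψ y y' q Δ)
        (h.1, (h.2.1, 0), h.2.2)
      = meanObs κ ν hP.smooth f Ψ t h y + meanTangentObs κ ν hP.smooth f Ψ t h y y' Δ := by
  have := FiniteDimensional.proper_real W
  have := FiniteDimensional.proper_real (Θ →L[ℝ] W)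
  have := FiniteDimensional.complete ℝ F
  have hS' : MeasurableSet (tangentSet Θ S D c Cy K) :=
    (isClosed_tangentSet hP.compact.isClosed c Cy K).measurableSet
  have hpres := hP.preserves_tangentMap hK hy hy'
  have o1 : Observable (region U (tangentSet Θ S D c Cy K) E)
      (fun q => obs f Ψ y (q.1, q.2.1.1, q.2.2)) K' :=
    ⟨(hO.observable (S := S) (E := E) hy).meas.comp_measurable (by fun_prop),
      fun q hq => (hO.observable (S := S) (E := E) hy).bound _ ⟨hq.1, hq.2.1.1, hq.2.2⟩⟩
  have o2 := hO.observable_tangentObs (E := E) (K := K) hP hy hy'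
  have hm : StronglyMeasurable fun q => tangentObs (U := U) f Ψ y y' q Δ :=
    (ContinuousLinearMap.apply ℝ F Δ).continuous.comp_stronglyMeasurable o2.meas
  refine ⟨⟨K' + K' * (Cy + b * tangentBound D c Cy K) * ‖Δ‖, o1.meas.add hm, fun q hq => ?_⟩, ?_⟩
  · exact (norm_add_le _ _).trans (add_le_add (o1.bound q hq)
      ((tangentObs f Ψ y y' q).le_of_opNorm_le (o2.bound q hq) Δ))
  · set P := drive κ ν (tangentMap Gf y y') (measurable_tangentMap hP.smooth y y') with hPd
    have hM : IsMarkovKernel P := hD.isMarkovKernel_drive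
    have hR : MeasurableSet (region U (tangentSet Θ S D c Cy K) E) :=
      measurableSet_region hS' hD.meas
    have hh' : (h.1, (h.2.1, 0), h.2.2) ∈ region U (tangentSet Θ S D c Cy K) E :=
      ⟨hh.1, mem_tangentSet_zero hP.rate_lt_one hCy hK.nonneg hh.2.1, hh.2.2⟩
    have hae := ae_pow_mem hR (hD.ae_drive_region hS' hpres) t hh'
    have i1 := o1.integrable hae
    have i2 := o2.integrable hae
    have e1 : iter P t (fun q => obs f Ψ y (q.1, q.2.1.1, q.2.2)) (h.1, (h.2.1, 0), h.2.2)
        = meanObs κ ν hP.smooth f Ψ t h y := by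
      have := hD.norm_iter_sub_le_of_rel (G := tangentMap Gf y y')
        (hG := measurable_tangentMap hP.smooth y y') hS' hpres (hP.contracts hK hy).meas
        (G' := fun u w => Gf (y, u, w)) (hG' := measurable_paramMap hP.smooth y)
        (hP.preserves y hy) (Rel := fun p w => p ∈ tangentSet Θ S D c Cy K ∧ p.1 = w) (ε := 0)
        (fun u p w hu hp => ⟨hpres u hu p hp.1, by rw [← hp.2]; rfl⟩)
        (fun p w hp => ⟨hp.1, hp.2 ▸ hp.1.1⟩) o1 (hO.observable hy)
        (fun u p w η hu hp hη => by simp [← hp.2]) t h.1 (h.2.1, 0) h.2.1 h.2.2 hh.1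
        ⟨hh'.2.1, rfl⟩ hh.2.2
      exact sub_eq_zero.1 (norm_le_zero_iff.1 this)
    rw [← e1, iter, integral_add i1 ?_]
    · congr 1
      exact ContinuousLinearMap.integral_apply i2 Δ |>.symm
    · exact (ContinuousLinearMap.apply ℝ F Δ).integrable_comp i2

/-- Expectations at a fixed time are differentiable in the parameter. The two chains at nearby
parameters are driven by the same input and stay in the relation `FirstOrder`. -/
theorem Driver.hasFDerivAt_meanObs (hD : Driver κ ν ℓ E) (hP : ParamSystem Gf 𝒴 S D b c)
    (hK : UnifBound Gf 𝒴 (Metric.closedBall 0 1) S K) (hy : ParamCurve y y' 𝒴 Cy)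
    (hO : ObsData f Lf Ψ 𝒴 S K') (t : ℕ) {h : U × W × ℝ} (hh : h ∈ region U S E) (θ : Θ) :
    HasFDerivAt (fun θ => meanObs κ ν hP.smooth f Ψ t h (y θ))
      (meanTangentObs κ ν hP.smooth f Ψ t h (y θ) (y' θ)) θ := by
  have := FiniteDimensional.proper_real W
  have := FiniteDimensional.proper_real (Θ →L[ℝ] W)
  have := FiniteDimensional.complete ℝ F
  have hc : 0 < 1 - c := by linarith [hP.rate_lt_one]
  have hb : 0 ≤ b := zero_le_one.trans hP.one_le
  have hK0 := hK.nonneg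
  have hK0' := hO.unif.nonneg
  rw [hasFDerivAt_iff_isLittleO, Asymptotics.isLittleO_iff]
  intro ε hε
  -- `ε₂` is the precision of the memory, `ρ` the size of the parameter increment
  obtain ⟨ε₂, hε₂, hε₂'⟩ : ∃ ε₂ > 0, K' * b * ε₂ ≤ ε / 2 := by
    refine ⟨ε / 2 / (K' * b + 1), by positivity, ?_⟩
    rw [mul_div_assoc', div_le_iff₀ (by positivity)]
    nlinarith
  set A := Cy + b * tangentBound D c Cy K with hA
  obtain ⟨ρ, hρ, hρ1, hρ2⟩ : ∃ ρ > 0, ‖D‖ * (K * ((A ^ 2 + 1) * ρ)) ≤ (1 - c) * ε₂ ∧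
      K' * ((A ^ 2 + 1) * ρ) ≤ ε / 2 := by
    have hT : ∀ M : ℝ, Filter.Tendsto (fun ρ : ℝ => M * ((A ^ 2 + 1) * ρ))
        (nhdsWithin 0 (Set.Ioi 0)) (nhds 0) := by
      intro M
      have : Continuous fun ρ : ℝ => M * ((A ^ 2 + 1) * ρ) := by fun_prop
      simpa using (this.tendsto 0).mono_left nhdsWithin_le_nhds
    have h1 := (hT (‖D‖ * K)).eventually (gt_mem_nhds (show 0 < (1 - c) * ε₂ by positivity))
    have h2 := (hT K').eventually (gt_mem_nhds (show 0 < ε / 2 by positivity))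
    obtain ⟨ρ, h1, h2, h3⟩ := (h1.and (h2.and self_mem_nhdsWithin)).exists
    exact ⟨ρ, h3, by rw [← mul_assoc]; exact h1.le, h2.le⟩
  have hd := hy.hasFDerivAt θ
  rw [hasFDerivAt_iff_isLittleO, Asymptotics.isLittleO_iff] at hd
  have hball : ∀ᶠ θ' in nhds θ, ‖θ' - θ‖ ≤ ρ := by
    filter_upwards [Metric.closedBall_mem_nhds θ hρ] with θ' h
    simpa [dist_eq_norm] using h
  filter_upwards [hd hρ, hball] with θ' h1 h2
  set Δ := θ' - θ with hΔ
  obtain ⟨⟨B, hB⟩, he⟩ := hD.iter_tangent_eq hP hK hO (hy.mem θ) hy.nonneg (hy.bound θ) t hh Δ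
  have hS' : MeasurableSet (tangentSet Θ S D c Cy K) :=
    (isClosed_tangentSet hP.compact.isClosed c Cy K).measurableSet
  have key := hD.norm_iter_sub_le_of_rel (G := tangentMap Gf (y θ) (y' θ))
    (hG := measurable_tangentMap hP.smooth (y θ) (y' θ)) hS'
    (hP.preserves_tangentMap hK (hy.mem θ) (hy.bound θ)) (hP.contracts hK (hy.mem θ')).meas
    (G' := fun u w => Gf (y θ', u, w)) (hG' := measurable_paramMap hP.smooth (y θ'))
    (hP.preserves _ (hy.mem θ')) (Rel := FirstOrder S D c Cy K ε₂ Δ) (ε := ε * ‖Δ‖)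
    (fun u p w' hu hp => hp.step hP hK (hy.mem θ) (hy.mem θ') (hy.bound θ) (hy.norm_sub_le θ θ')
      h2 h1 hρ1 hu)
    (fun p w' hp => ⟨hp.1, hp.2.1⟩) hB (hO.observable (hy.mem θ')) ?_ t h.1 (h.2.1, 0) h.2.1 h.2.2
    hh.1 ?_ hh.2.2
  · rw [he] at key
    rw [norm_sub_rev] at key
    refine le_trans (le_of_eq ?_) key
    congr 1
    simp only [meanObs]
    abel
  · intro u p w' η hu hp hη
    have hdist := hp.norm_sub_le hP
    obtain ⟨hp1, hw', h3, h4⟩ := hp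
    have a1 := hO.unif.norm_sub_tangent_le (hy.mem θ) (hy.mem θ') (y' θ) (hO.mem (u, η)) hp1.1 hw'
      p.2 Δ (A := A) (by
        have := hy.norm_sub_le θ θ'
        rw [hA, add_mul]; exact add_le_add this hdist) h2 h1
    have a2 := (fderiv ℝ Ψ (y θ, f (u, η), p.1)).le_of_opNorm_le
      (hO.unif.bound_fderiv _ (hy.mem θ) _ (hO.mem (u, η)) _ hp1.1) (0, 0, w' - p.1 - p.2 Δ)
    have a3 : ‖((0, 0, w' - p.1 - p.2 Δ) : Y × ℝ × W)‖ ≤ b * (ε₂ * ‖Δ‖) := by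
      have := (hP.lower (w' - p.1 - p.2 Δ)).trans (mul_le_mul_of_nonneg_left h4 hb)
      simpa [Prod.norm_def] using this
    have e : Ψ (y θ, f (u, η), p.1) + tangent Ψ (y θ) (y' θ) (f (u, η)) p.1 p.2 Δ
          - Ψ (y θ', f (u, η), w')
        = -((Ψ (y θ', f (u, η), w') - Ψ (y θ, f (u, η), p.1)
            - tangent Ψ (y θ) (y' θ) (f (u, η)) p.1 p.2 Δ
            - fderiv ℝ Ψ (y θ, f (u, η), p.1) (0, 0, w' - p.1 - p.2 Δ))
          + fderiv ℝ Ψ (y θ, f (u, η), p.1) (0, 0, w' - p.1 - p.2 Δ)) := by abel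
    change ‖Ψ (y θ, f (u, η), p.1) + tangent Ψ (y θ) (y' θ) (f (u, η)) p.1 p.2 Δ
          - Ψ (y θ', f (u, η), w')‖ ≤ _
    rw [e, norm_neg]
    refine (norm_add_le _ _).trans
      ((add_le_add a1 (a2.trans (mul_le_mul_of_nonneg_left a3 hK0'))).trans ?_)
    have hn := norm_nonneg Δ
    have b1 := mul_le_mul_of_nonneg_right hρ2 hn
    have b2 := mul_le_mul_of_nonneg_right hε₂' hn
    nlinarith
  · refine ⟨mem_tangentSet_zero hP.rate_lt_one hy.nonneg hK0 hh.2.1, hh.2.1, ?_, ?_⟩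
    · simpa using mul_nonneg (tangentBound_nonneg (D := D) hP.rate_lt_one hy.nonneg hK0)
        (norm_nonneg Δ)
    · simpa using mul_nonneg hε₂.le (norm_nonneg Δ)

end Deriv

/-! ### Derivatives of limits and of series -/

section Limits

variable {Θ F : Type*} [NormedAddCommGroup Θ] [NormedSpace ℝ Θ] [NormedAddCommGroup F]
  [NormedSpace ℝ F] [CompleteSpace F]

/-- If derivatives converge geometrically, uniformly in the parameter, then the limit is
differentiable, its derivative is the limit of the derivatives, and the convergence is geometric. -/
theorem exists_hasFDerivAt_limit {a : ℕ → Θ → F} {a' : ℕ → Θ → Θ →L[ℝ] F} {aLim : Θ → F} {M r : ℝ}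
    (hr0 : 0 ≤ r) (hr1 : r < 1) (hd : ∀ t θ, HasFDerivAt (a t) (a' t θ) θ)
    (hb : ∀ t θ, ‖a' (t + 1) θ - a' t θ‖ ≤ M * r ^ t)
    (hlim : ∀ θ, Filter.Tendsto (fun t => a t θ) Filter.atTop (nhds (aLim θ))) :
    ∃ aLim' : Θ → Θ →L[ℝ] F,
      (∀ θ, Filter.Tendsto (fun t => a' t θ) Filter.atTop (nhds (aLim' θ))) ∧
      (∀ θ, HasFDerivAt aLim (aLim' θ) θ) ∧
      ∀ t θ, ‖a' t θ - aLim' θ‖ ≤ M / (1 - r) * r ^ t := by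
  have hb' : ∀ θ t, dist (a' t θ) (a' (t + 1) θ) ≤ M * r ^ t := fun θ t => by
    rw [dist_comm, dist_eq_norm]; exact hb t θ
  have hc : ∀ θ, ∃ L, Filter.Tendsto (fun t => a' t θ) Filter.atTop (nhds L) := fun θ =>
    cauchySeq_tendsto_of_complete (cauchySeq_of_le_geometric r M hr1 (hb' θ))
  choose L hL using hc
  have hdist : ∀ t θ, ‖a' t θ - L θ‖ ≤ M / (1 - r) * r ^ t := fun t θ => by
    have := dist_le_of_le_geometric_of_tendsto r M hr1 (hb' θ) (hL θ) t
    rw [dist_eq_norm] at this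
    refine this.trans (le_of_eq (by ring))
  refine ⟨L, hL, fun θ => ?_, hdist⟩
  refine hasFDerivAt_of_tendstoUniformly (f := a) (f' := a') (l := Filter.atTop) ?_ hd hlim θ
  rw [Metric.tendstoUniformly_iff]
  intro ε hε
  have ht : Filter.Tendsto (fun t : ℕ => M / (1 - r) * r ^ t) Filter.atTop (nhds 0) := by
    simpa using (tendsto_pow_atTop_nhds_zero_of_lt_one hr0 hr1).const_mul (M / (1 - r))
  filter_upwards [ht.eventually (gt_mem_nhds hε)] with t h θ
  rw [dist_comm, dist_eq_norm]
  exact (hdist t θ).trans_lt h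

/-- The series of the differences to the limit can be differentiated term by term. -/
theorem hasFDerivAt_tsum_sub_limit {a : ℕ → Θ → F} {a' : ℕ → Θ → Θ →L[ℝ] F} {aLim : Θ → F}
    {aLim' : Θ → Θ →L[ℝ] F} {M r : ℝ} (hr0 : 0 ≤ r) (hr1 : r < 1)
    (hd : ∀ t θ, HasFDerivAt (a t) (a' t θ) θ) (hd' : ∀ θ, HasFDerivAt aLim (aLim' θ) θ)
    (hb : ∀ t θ, ‖a' t θ - aLim' θ‖ ≤ M * r ^ t) (hs : ∀ θ, Summable fun t => a t θ - aLim θ)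
    (θ : Θ) :
    HasFDerivAt (fun θ => ∑' t, (a t θ - aLim θ)) (∑' t, (a' t θ - aLim' θ)) θ ∧
      ‖∑' t, (a' t θ - aLim' θ)‖ ≤ M / (1 - r) := by
  have hsum : Summable fun t : ℕ => M * r ^ t := (summable_geometric_of_lt_one hr0 hr1).mul_left M
  refine ⟨hasFDerivAt_tsum hsum (fun t θ => (hd t θ).sub (hd' θ)) hb (hs θ) θ, ?_⟩
  refine (tsum_of_norm_bounded (a := M / (1 - r)) ?_ fun t => hb t θ)
  have := (hasSum_geometric_of_lt_one hr0 hr1).mul_left M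
  rwa [← div_eq_mul_inv] at this

end Limits

section Deriv

variable {U W Y Θ F : Type*}
  [NormedAddCommGroup U] [NormedSpace ℝ U] [MeasurableSpace U] [BorelSpace U]
  [SecondCountableTopology U]
  [NormedAddCommGroup W] [NormedSpace ℝ W] [MeasurableSpace W] [BorelSpace W]
  [FiniteDimensional ℝ W]
  [NormedAddCommGroup Y] [NormedSpace ℝ Y]
  [NormedAddCommGroup Θ] [NormedSpace ℝ Θ] [FiniteDimensional ℝ Θ]
  [NormedAddCommGroup F] [NormedSpace ℝ F] [FiniteDimensional ℝ F]
  {κ : Kernel U U} {ν : Measure ℝ} {ℓ : ℝ} {E : Set ℝ}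
  {Gf : Y × U × W → W} {𝒴 : Set Y} {S : Set W} {D : W →L[ℝ] W} {b c : ℝ}
  {y : Θ → Y} {y' : Θ → Θ →L[ℝ] Y} {Cy K : ℝ}
  {f : U × ℝ → ℝ} {Lf : ℝ} {Ψ : Y × ℝ × W → F} {K' : ℝ}

theorem ParamSystem.exists_diam (hP : ParamSystem Gf 𝒴 S D b c) :
    ∃ Δ, ∀ w ∈ S, ∀ w' ∈ S, ‖D (w - w')‖ ≤ Δ := by
  obtain ⟨C, hC⟩ := hP.compact.isBounded.exists_norm_le
  refine ⟨‖D‖ * (C + C), fun w hw w' hw' => D.le_opNorm_of_le ?_⟩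
  exact (norm_sub_le _ _).trans (add_le_add (hC w hw) (hC w' hw'))

/-- The derivatives of the expectations converge geometrically, uniformly in the parameter and in
the initial state. -/
theorem Driver.exists_norm_meanTangentObs_sub_le (hD : Driver κ ν ℓ E)
    (hP : ParamSystem Gf 𝒴 S D b c) (hK : UnifBound Gf 𝒴 (Metric.closedBall 0 1) S K)
    (hy : ParamCurve y y' 𝒴 Cy) (hO : ObsData f Lf Ψ 𝒴 S K') :
    ∃ M r, 0 ≤ r ∧ r < 1 ∧ ∀ θ, ∀ h ∈ region U S E, ∀ t,
      ‖meanTangentObs κ ν hP.smooth f Ψ (t + 1) h (y θ) (y' θ)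
        - meanTangentObs κ ν hP.smooth f Ψ t h (y θ) (y' θ)‖ ≤ M * r ^ t := by
  have := FiniteDimensional.proper_real W
  have := FiniteDimensional.proper_real (Θ →L[ℝ] W)
  have := FiniteDimensional.complete ℝ F
  obtain ⟨Δ, hΔ⟩ := hP.exists_diam
  have hc := hP.rate_lt_one
  have hc0 := hP.rate_nonneg
  have hA0 : 0 ≤ tangentWeight D b c Cy K := by
    have := tangentBound_nonneg (D := D) hc hy.nonneg hK.nonneg
    have := hP.one_le
    have := hy.nonneg
    have := hK.nonneg
    have : 0 < 1 - c := by linarith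
    have : 0 ≤ b := by linarith
    unfold tangentWeight; positivity
  have hΔ' : ∀ p ∈ tangentSet Θ S D c Cy K, ∀ p' ∈ tangentSet Θ S D c Cy K,
      tangentWeight D b c Cy K * ‖D (p.1 - p'.1)‖ + ‖D.comp (p.2 - p'.2)‖
        ≤ tangentWeight D b c Cy K * Δ + (tangentBound D c Cy K + tangentBound D c Cy K) := by
    intro p hp p' hp'
    refine add_le_add (mul_le_mul_of_nonneg_left (hΔ _ hp.1 _ hp'.1) hA0) ?_
    rw [ContinuousLinearMap.comp_sub]
    exact (norm_sub_le _ _).trans (add_le_add hp.2 hp'.2)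
  refine ⟨mixConst ℓ (tangentWeight D b c Cy K * (‖D‖ * K)
      + ‖D‖ * K * (Cy + b * tangentBound D c Cy K)) ((1 + c) / 2)
      (tangentWeight D b c Cy K * Δ + (tangentBound D c Cy K + tangentBound D c Cy K))
      (K' * (Cy + b * tangentBound D c Cy K))
      (K' * (Lf + b) * (Cy + b * tangentBound D c Cy K + 1)), rate ℓ ((1 + c) / 2), hD.rate_nonneg,
    RNN.rate_lt_one hD.lt_one (by linarith), fun θ h hh t => ?_⟩
  have hK'n : 0 ≤ K' * (Lf + b) * (Cy + b * tangentBound D c Cy K + 1) := by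
    have := tangentBound_nonneg (D := D) hc hy.nonneg hK.nonneg
    have := hO.unif.nonneg
    have := hO.nonneg
    have := hP.one_le
    have := hy.nonneg
    have : 0 ≤ b := by linarith
    positivity
  exact hD.norm_iter_succ_sub_iter_le (hG := measurable_tangentMap hP.smooth (y θ) (y' θ))
    (hP.contracts_tangentMap hK (hy.mem θ) hy.nonneg (hy.bound θ)) hΔ'
    (hO.observable_tangentObs hP (hy.mem θ) (hy.bound θ)) hK'n
    (hO.memLipschitz_tangentObs hP (hy.mem θ) hy.nonneg hK.nonneg (hy.bound θ)) t
    (h := (h.1, (h.2.1, 0), h.2.2))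
    ⟨hh.1, mem_tangentSet_zero hP.rate_lt_one hy.nonneg hK.nonneg hh.2.1, hh.2.2⟩

end Deriv

/-! ### Bounds for the sigmoid function and for averages -/

section Sigmoid

theorem deriv_deriv_sigmoid (x : ℝ) : deriv (deriv Real.sigmoid) x =
    Real.sigmoid x * (1 - Real.sigmoid x) * (1 - 2 * Real.sigmoid x) := by
  have h : HasDerivAt Real.sigmoid (Real.sigmoid x * (1 - Real.sigmoid x)) x :=
    Real.hasDerivAt_sigmoid x
  have h' : HasDerivAt (fun x => Real.sigmoid x * (1 - Real.sigmoid x)) _ x :=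
    h.mul (h.const_sub 1)
  rw [Real.deriv_sigmoid, h'.deriv]
  ring

theorem abs_deriv_sigmoid_le (x : ℝ) : |deriv Real.sigmoid x| ≤ 1 / 4 := by
  have h0 := Real.sigmoid_nonneg x
  have h1 := Real.sigmoid_le_one x
  rw [Real.deriv_sigmoid, abs_of_nonneg (mul_nonneg h0 (by linarith))]
  nlinarith [sq_nonneg (Real.sigmoid x - 1 / 2)]

/-- The sharp constant is `1 / √108`. -/
theorem abs_deriv_deriv_sigmoid_le (x : ℝ) : |deriv (deriv Real.sigmoid) x| ≤ 1 / 10 := by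
  have h0 := Real.sigmoid_nonneg x
  have h1 := Real.sigmoid_le_one x
  rw [deriv_deriv_sigmoid]
  -- with `p = σ (1 - σ)` the square is `p² (1 - 4 p) = 1 / 108 - 4 (p - 1 / 6)² (p + 1 / 12)`
  have hp : 0 ≤ Real.sigmoid x * (1 - Real.sigmoid x) := mul_nonneg h0 (by linarith)
  refine abs_le_of_sq_le_sq ?_ (by norm_num)
  generalize hq : Real.sigmoid x * (1 - Real.sigmoid x) = p at hp ⊢
  have : (p * (1 - 2 * Real.sigmoid x)) ^ 2 = p ^ 2 * (1 - 4 * p) := by rw [← hq]; ring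
  rw [this]
  nlinarith [mul_nonneg (sq_nonneg (p - 1 / 6)) (by linarith : 0 ≤ p + 1 / 12)]

theorem abs_sigmoid_sub_le (x y : ℝ) :
    |Real.sigmoid y - Real.sigmoid x| ≤ 1 / 4 * |y - x| :=
  Convex.norm_image_sub_le_of_norm_deriv_le (fun _ _ => differentiableAt_sigmoid)
    (fun z _ => abs_deriv_sigmoid_le z) convex_univ trivial trivial

theorem contDiff_deriv_sigmoid : ContDiff ℝ 2 (deriv Real.sigmoid) := by
  rw [Real.deriv_sigmoid]
  have : ContDiff ℝ 2 Real.sigmoid := contDiff_sigmoid.of_le le_top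
  fun_prop

theorem contDiff_deriv_deriv_sigmoid : ContDiff ℝ 2 (deriv (deriv Real.sigmoid)) := by
  rw [funext deriv_deriv_sigmoid]
  have : ContDiff ℝ 2 Real.sigmoid := contDiff_sigmoid.of_le le_top
  fun_prop

end Sigmoid

section Average

theorem abs_average_le {n : ℕ} (hn : 0 < n) {a b : Fin n → ℝ} {A B : ℝ} (hA : 0 ≤ A)
    (ha : ∀ i, |a i| ≤ A) (hb : ∀ i, |b i| ≤ B) : |1 / (n : ℝ) * ∑ i, a i * b i| ≤ A * B := by
  have hn' : (0 : ℝ) < n := by exact_mod_cast hn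
  rw [abs_mul, abs_of_nonneg (by positivity), one_div, inv_mul_le_iff₀ hn']
  calc |∑ i, a i * b i| ≤ ∑ i, |a i * b i| := Finset.abs_sum_le_sum_abs _ _
    _ ≤ ∑ _i : Fin n, A * B := Finset.sum_le_sum fun i _ => by
        rw [abs_mul]; exact mul_le_mul (ha i) (hb i) (abs_nonneg _) hA
    _ = n * (A * B) := by simp

theorem abs_mul_le_mul {a b A B : ℝ} (ha : |a| ≤ A) (hb : |b| ≤ B) : |a * b| ≤ A * B := by
  rw [abs_mul]; exact mul_le_mul ha hb (abs_nonneg _) ((abs_nonneg _).trans ha)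

theorem abs_ite_le {p : Prop} [Decidable p] : |(if p then (1 : ℝ) else 0)| ≤ 1 := by
  split_ifs <;> simp

end Average

/-! ### The recursion as a function of the jet of the parameter -/

/-- The values of `(φ, φ, λ, λ)` at the entries of the parameter, followed by the values of the first
and of the second derivatives. The recursion depends on the parameter through its jet only. Unlike
the parameter the jet ranges over a compact set. -/
abbrev Jet (d N : ℕ) : Type := Params d N × Params d N × Params d N

section Net

variable {d dZ N : ℕ}

/-- The argument `p_k` of the activation function. -/
def netPre (y : Jet d N) (u : Input d dZ) (v : Hidden d N) (k : Fin N) : ℝ :=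
  1 / (d : ℝ) * ∑ j, y.1.A k j * u.1 j + 1 / (N : ℝ) * ∑ l, y.1.W k l * v.s l

/-- The derivative `a_{ijk}` of `p_k` with respect to `A^{ij}`. -/
def netPreA (y : Jet d N) (u : Input d dZ) (v : Hidden d N) (i : Fin N) (j : Fin d) (k : Fin N) :
    ℝ :=
  1 / (d : ℝ) * (if i = k then 1 else 0) * y.2.1.A i j * u.1 j
    + 1 / (N : ℝ) * ∑ l, y.1.W k l * v.sA i j l

/-- The derivative `w_{ijk}` of `p_k` with respect to `W^{ij}`. -/
def netPreW (y : Jet d N) (v : Hidden d N) (i j k : Fin N) : ℝ :=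
  1 / (N : ℝ) * (if i = k then 1 else 0) * y.2.1.W i j * v.s j
    + 1 / (N : ℝ) * ∑ l, y.1.W k l * v.sW i j l

/-- The recursion as a function of the jet of the parameter. -/
def netF (y : Jet d N) (u : Input d dZ) (v : Hidden d N) : Hidden d N
  | .inl k => Real.sigmoid (netPre y u v k)
  | .inr (.inl (i, j, k)) => deriv Real.sigmoid (netPre y u v k) * netPreA y u v i j k
  | .inr (.inr (.inl (i, j, k))) => deriv Real.sigmoid (netPre y u v k) * netPreW y v i j k
  | .inr (.inr (.inr (.inl (n, m, i, j, k)))) =>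
    deriv (deriv Real.sigmoid) (netPre y u v k) * netPreA y u v i j k * netPreA y u v n m k
      + deriv Real.sigmoid (netPre y u v k) *
        (1 / (d : ℝ) * (if i = k then 1 else 0) * (if i = n ∧ j = m then 1 else 0)
            * y.2.2.A i j * u.1 j
          + 1 / (N : ℝ) * ∑ l, y.1.W k l * v.sAA i j n m l)
  | .inr (.inr (.inr (.inr (.inl (n, m, i, j, k))))) =>
    deriv (deriv Real.sigmoid) (netPre y u v k) * netPreW y v n m k * netPreA y u v i j k
      + deriv Real.sigmoid (netPre y u v k) *
        (1 / (N : ℝ) * (if k = n then 1 else 0) * y.2.1.W n m * v.sA i j m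
          + 1 / (N : ℝ) * ∑ l, y.1.W k l * v.sWA n m i j l)
  | .inr (.inr (.inr (.inr (.inr (n, m, i, j, k))))) =>
    deriv (deriv Real.sigmoid) (netPre y u v k) * netPreW y v n m k * netPreW y v i j k
      + deriv Real.sigmoid (netPre y u v k) *
        (1 / (N : ℝ) * (if i = k then 1 else 0) * (if i = n ∧ j = m then 1 else 0)
            * y.2.2.W i j * v.s j
          + 1 / (N : ℝ) * ∑ l, y.1.W k l * v.sWW n m i j l)

/-- `netF` as a function of a single variable. -/
def netMap (p : Jet d N × Input d dZ × Hidden d N) : Hidden d N := netF p.1 p.2.1 p.2.2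

theorem contDiff_netMap : ContDiff ℝ 2 (netMap (d := d) (dZ := dZ) (N := N)) := by
  have h0 : ContDiff ℝ 2 Real.sigmoid := contDiff_sigmoid.of_le le_top
  have h1 := contDiff_deriv_sigmoid
  have h2 := contDiff_deriv_deriv_sigmoid
  have hp : ∀ k, ContDiff ℝ 2 fun p : Jet d N × Input d dZ × Hidden d N =>
      netPre p.1 p.2.1 p.2.2 k := by
    intro k; unfold netPre Params.A Params.W Hidden.s; fun_prop
  have hA : ∀ i j k, ContDiff ℝ 2 fun p : Jet d N × Input d dZ × Hidden d N =>
      netPreA p.1 p.2.1 p.2.2 i j k := by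
    intro i j k; unfold netPreA Params.A Params.W Hidden.sA; fun_prop
  have hW : ∀ i j k, ContDiff ℝ 2 fun p : Jet d N × Input d dZ × Hidden d N =>
      netPreW p.1 p.2.2 i j k := by
    intro i j k; unfold netPreW Params.W Hidden.sW Hidden.s; fun_prop
  refine contDiff_pi.2 ?_
  rintro (k | ⟨i, j, k⟩ | ⟨i, j, k⟩ | ⟨n, m, i, j, k⟩ | ⟨n, m, i, j, k⟩ | ⟨n, m, i, j, k⟩)
  · exact h0.comp (hp k)
  · exact (h1.comp (hp k)).mul (hA i j k)
  · exact (h1.comp (hp k)).mul (hW i j k)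
  · refine (((h2.comp (hp k)).mul (hA i j k)).mul (hA n m k)).add ((h1.comp (hp k)).mul ?_)
    unfold Hidden.sAA Params.A Params.W; fun_prop
  · refine (((h2.comp (hp k)).mul (hW n m k)).mul (hA i j k)).add ((h1.comp (hp k)).mul ?_)
    unfold Hidden.sWA Hidden.sA Params.W; fun_prop
  · refine (((h2.comp (hp k)).mul (hW n m k)).mul (hW i j k)).add ((h1.comp (hp k)).mul ?_)
    unfold Hidden.sWW Hidden.s Params.W; fun_prop

/-- Bounds of the jet that involve `φ`. -/
structure JetBound (C C₁ C₂ : ℝ) (y : Jet d N) : Prop where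
  W : ∀ k l, |y.1.W k l| ≤ C
  A₁ : ∀ k j, |y.2.1.A k j| ≤ C₁
  W₁ : ∀ k l, |y.2.1.W k l| ≤ C₁
  A₂ : ∀ k j, |y.2.2.A k j| ≤ C₂
  W₂ : ∀ k l, |y.2.2.W k l| ≤ C₂

/-- The order of differentiation of an entry of the memory layer. -/
def level : HiddenIndex d N → ℕ
  | .inl _ => 0
  | .inr (.inl _) => 1
  | .inr (.inr (.inl _)) => 1
  | .inr (.inr (.inr _)) => 2

/-- Each entry of the recursion is a contraction in the entries of its own level once the
entries of lower levels are fixed. -/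
theorem abs_netF_add_sub_le (hN : 0 < N) {C C₁ C₂ : ℝ} {y : Jet d N} (hy : JetBound C C₁ C₂ y)
    (hC : 0 ≤ C) (u : Input d dZ) (v δ : Hidden d N) {m : ℝ} (i : HiddenIndex d N)
    (hlow : ∀ j, level j < level i → δ j = 0) (hm : ∀ j, level j = level i → |δ j| ≤ m) :
    |netF y u (v + δ) i - netF y u v i| ≤ C / 4 * m := by
  have havg : ∀ (k : Fin N) (a b : Fin N → ℝ), (∀ l, |b l| ≤ m) →
      |1 / (N : ℝ) * ∑ l, y.1.W k l * (a l + b l) - 1 / (N : ℝ) * ∑ l, y.1.W k l * a l| ≤ C * m := by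
    intro k a b hb
    rw [← mul_sub, ← Finset.sum_sub_distrib]
    simp only [← mul_sub, add_sub_cancel_left]
    exact abs_average_le hN hC (hy.W k) hb
  have hσ : ∀ x p q r : ℝ, |q - r| ≤ C * m →
      |deriv Real.sigmoid x * (p + q) - deriv Real.sigmoid x * (p + r)| ≤ C / 4 * m := by
    intro x p q r h
    rw [← mul_sub, add_sub_add_left_eq_sub]
    exact (abs_mul_le_mul (abs_deriv_sigmoid_le x) h).trans (le_of_eq (by ring))
  have hs : (∀ k, δ (.inl k) = 0) → (v + δ).s = v.s := fun h => by
    funext k; simp [Hidden.s, h]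
  have hsA : (∀ p, δ (.inr (.inl p)) = 0) → (v + δ).sA = v.sA := fun h => by
    funext i j k; simp [Hidden.sA, h]
  have hsW : (∀ p, δ (.inr (.inr (.inl p))) = 0) → (v + δ).sW = v.sW := fun h => by
    funext i j k; simp [Hidden.sW, h]
  rcases i with k | ⟨i, j, k⟩ | ⟨i, j, k⟩ | ⟨n, r, i, j, k⟩ | ⟨n, r, i, j, k⟩ | ⟨n, r, i, j, k⟩
  · refine (abs_sigmoid_sub_le _ _).trans ?_
    have : |netPre y u (v + δ) k - netPre y u v k| ≤ C * m := by
      unfold netPre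
      rw [add_sub_add_left_eq_sub]
      exact havg k v.s (fun l => δ (.inl l)) fun l => hm (.inl l) rfl
    linarith
  all_goals have e0 := hs fun k => hlow (.inl k) (by simp [level])
  all_goals have ep : netPre y u (v + δ) k = netPre y u v k := by unfold netPre; rw [e0]
  · show |deriv Real.sigmoid (netPre y u (v + δ) k) * netPreA y u (v + δ) i j k
      - deriv Real.sigmoid (netPre y u v k) * netPreA y u v i j k| ≤ _
    rw [ep]
    exact hσ _ _ _ _ (havg k (v.sA i j) (fun l => δ (.inr (.inl (i, j, l)))) fun l => hm _ rfl)
  · show |deriv Real.sigmoid (netPre y u (v + δ) k) * netPreW y (v + δ) i j k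
      - deriv Real.sigmoid (netPre y u v k) * netPreW y v i j k| ≤ _
    rw [ep]
    unfold netPreW
    rw [e0]
    exact hσ _ _ _ _
      (havg k (v.sW i j) (fun l => δ (.inr (.inr (.inl (i, j, l))))) fun l => hm _ rfl)
  all_goals have e1 := hsA fun k => hlow (.inr (.inl k)) (by simp [level])
  all_goals have e2 := hsW fun k => hlow (.inr (.inr (.inl k))) (by simp [level])
  all_goals have eA : netPreA y u (v + δ) = netPreA y u v := by unfold netPreA; rw [e1]
  all_goals have eW : netPreW y (v + δ) = netPreW y v := by unfold netPreW; rw [e0, e2]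
  all_goals simp only [netF, ep, eA, eW, e0, e1, add_sub_add_left_eq_sub]
  · exact hσ _ _ _ _ (havg k (v.sAA i j n r)
      (fun l => δ (.inr (.inr (.inr (.inl (i, j, n, r, l)))))) fun l => hm _ rfl)
  · exact hσ _ _ _ _ (havg k (v.sWA n r i j)
      (fun l => δ (.inr (.inr (.inr (.inr (.inl (n, r, i, j, l))))))) fun l => hm _ rfl)
  · exact hσ _ _ _ _ (havg k (v.sWW n r i j)
      (fun l => δ (.inr (.inr (.inr (.inr (.inr (n, r, i, j, l))))))) fun l => hm _ rfl)

end Net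

/-! ### The hyper-rectangle and the set of jets -/

section HyperRectangle

variable {d dZ N : ℕ}

namespace Model.Assumptions

variable {M : Model d dZ N} (hM : M.Assumptions)

include hM

theorem Cφ_nonneg : 0 ≤ M.Cφ := (abs_nonneg _).trans (hM.φ_bound 0)

theorem Cφ₁_nonneg : 0 ≤ M.Cφ₁ := (abs_nonneg _).trans (hM.φ_bound₁ 0)

theorem Cφ₂_nonneg : 0 ≤ M.Cφ₂ := (abs_nonneg _).trans (hM.φ_bound₂ 0)

/-- All that is used of the assumption `q < 1` is this inequality and `Lker < 1`. -/
theorem Cφ_lt_one : M.Cφ < 1 := by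
  have h : max M.L₀ M.L₁ < 1 := by
    have hq := hM.q_lt_one
    unfold Model.q at hq
    have := Real.abs_le_sqrt (x := max M.L₀ M.L₁) (y := max M.L₀ M.L₁ ^ 2 + M.Lker ^ 2)
      (by nlinarith [sq_nonneg M.Lker])
    exact ((le_abs_self _).trans this).trans_lt hq
  exact ((le_max_right _ _).trans (le_max_right _ _)).trans_lt h

end Model.Assumptions

namespace Model

variable (M : Model d dZ N)

/-- Upper bounds of the entries of the memory layer on the hyper-rectangle. -/
def upper : Hidden d N
  | .inl _ => 1
  | .inr (.inl _) => M.Cφ₁ / (d * (4 - M.Cφ))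
  | .inr (.inr (.inl _)) => M.Cφ₁ / (N * (4 - M.Cφ))
  | .inr (.inr (.inr (.inl _))) => M.aAA / (1 - M.Cφ / 4)
  | .inr (.inr (.inr (.inr (.inl _)))) => M.aWA / (1 - M.Cφ / 4)
  | .inr (.inr (.inr (.inr (.inr _)))) => M.aWW / (1 - M.Cφ / 4)

/-- Lower bounds of the entries of the memory layer on the hyper-rectangle. -/
def lower : Hidden d N
  | .inl _ => 0
  | .inr i => -M.upper (.inr i)

/-- The projection of the hyper-rectangle `R` to the memory layer. -/
def box : Set (Hidden d N) := Set.Icc M.lower M.upper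

theorem mem_box {v : Hidden d N} : v ∈ M.box ↔
    (∀ k, 0 ≤ v.s k ∧ v.s k ≤ 1) ∧
    (∀ i j k, |v.sA i j k| ≤ M.Cφ₁ / (d * (4 - M.Cφ))) ∧
    (∀ i j k, |v.sW i j k| ≤ M.Cφ₁ / (N * (4 - M.Cφ))) ∧
    (∀ n m i j k, |v.sAA n m i j k| ≤ M.aAA / (1 - M.Cφ / 4)) ∧
    (∀ n m i j k, |v.sWA n m i j k| ≤ M.aWA / (1 - M.Cφ / 4)) ∧
    (∀ n m i j k, |v.sWW n m i j k| ≤ M.aWW / (1 - M.Cφ / 4)) := by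
  constructor
  · rintro ⟨h0, h1⟩
    have h : ∀ i, |v (.inr i)| ≤ M.upper (.inr i) := fun i => abs_le.2 ⟨h0 (.inr i), h1 (.inr i)⟩
    exact ⟨fun k => ⟨h0 (.inl k), h1 (.inl k)⟩, fun i j k => h (.inl (i, j, k)),
      fun i j k => h (.inr (.inl (i, j, k))),
      fun n m i j k => h (.inr (.inr (.inl (n, m, i, j, k)))),
      fun n m i j k => h (.inr (.inr (.inr (.inl (n, m, i, j, k))))),
      fun n m i j k => h (.inr (.inr (.inr (.inr (n, m, i, j, k)))))⟩
  · rintro ⟨h1, h2, h3, h4, h5, h6⟩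
    constructor
    · rintro (k | ⟨i, j, k⟩ | ⟨i, j, k⟩ | ⟨n, m, i, j, k⟩ | ⟨n, m, i, j, k⟩ | ⟨n, m, i, j, k⟩)
      exacts [(h1 _).1, (abs_le.1 (h2 _ _ _)).1, (abs_le.1 (h3 _ _ _)).1,
        (abs_le.1 (h4 _ _ _ _ _)).1, (abs_le.1 (h5 _ _ _ _ _)).1, (abs_le.1 (h6 _ _ _ _ _)).1]
    · rintro (k | ⟨i, j, k⟩ | ⟨i, j, k⟩ | ⟨n, m, i, j, k⟩ | ⟨n, m, i, j, k⟩ | ⟨n, m, i, j, k⟩)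
      exacts [(h1 _).2, (abs_le.1 (h2 _ _ _)).2, (abs_le.1 (h3 _ _ _)).2,
        (abs_le.1 (h4 _ _ _ _ _)).2, (abs_le.1 (h5 _ _ _ _ _)).2, (abs_le.1 (h6 _ _ _ _ _)).2]

theorem R_eq_region : M.R = region (Input d dZ) M.box M.noiseSet := by
  ext ⟨u, v, η⟩
  have hn : ‖u‖ ≤ 1 ↔ (∀ j, |u.1 j| ≤ 1) ∧ ∀ j, |u.2 j| ≤ 1 := by
    rw [Prod.norm_def, sup_le_iff, pi_norm_le_iff_of_nonneg zero_le_one,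
      pi_norm_le_iff_of_nonneg zero_le_one]
    rfl
  show _ ↔ ‖u‖ ≤ 1 ∧ v ∈ M.box ∧ η ∈ M.noiseSet
  rw [hn, mem_box]
  simp only [Model.R, Set.mem_ofPred_eq]
  tauto

/-- The jet of a parameter. -/
def jet (θ : Params d N) : Jet d N :=
  ((fun i j => M.φ (θ.A i j), fun i j => M.φ (θ.W i j), fun i => M.lam (θ.B i), M.lam θ.c),
    (fun i j => deriv M.φ (θ.A i j), fun i j => deriv M.φ (θ.W i j),
      fun i => deriv M.lam (θ.B i), deriv M.lam θ.c),
    (fun i j => deriv (deriv M.φ) (θ.A i j), fun i j => deriv (deriv M.φ) (θ.W i j), 0, 0))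

/-- The jet of a parameter without the second derivatives. Unlike the full jet it is a
differentiable function of the parameter, and it determines the recursion of the first order
entries. -/
def jet₁ (θ : Params d N) : Jet d N := ((M.jet θ).1, (M.jet θ).2.1, 0)

theorem F_eq_netF (θ : Params d N) (u : Input d dZ) (v : Hidden d N) :
    M.F θ u v = netF (M.jet θ) u v := by
  funext i
  rcases i with k | ⟨i, j, k⟩ | ⟨i, j, k⟩ | ⟨n, m, i, j, k⟩ | ⟨n, m, i, j, k⟩ | ⟨n, m, i, j, k⟩ <;>
    rfl

/-- Entrywise bounds of the jets of all parameters, where `Λ` bounds `λ` and its derivative. -/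
def jetTop (Λ : ℝ) : Jet d N :=
  ((fun _ _ => M.Cφ, fun _ _ => M.Cφ, fun _ => Λ, Λ),
    (fun _ _ => M.Cφ₁, fun _ _ => M.Cφ₁, fun _ => Λ, Λ),
    (fun _ _ => M.Cφ₂, fun _ _ => M.Cφ₂, fun _ => Λ, Λ))

/-- A compact convex set of jets that contains the jets of all parameters. -/
def jetSet (Λ : ℝ) : Set (Jet d N) := Set.Icc (-M.jetTop Λ) (M.jetTop Λ)

theorem isCompact_jetSet (Λ : ℝ) : IsCompact (M.jetSet Λ) := isCompact_Icc

theorem convex_jetSet (Λ : ℝ) : Convex ℝ (M.jetSet Λ) := by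
  have h : ∀ a b : Params d N, Convex ℝ (Set.Icc a b) := fun a b => by
    rw [Set.Icc_prod_eq, Set.Icc_prod_eq a.2, Set.Icc_prod_eq a.2.2]
    exact (convex_Icc _ _).prod ((convex_Icc _ _).prod ((convex_Icc _ _).prod (convex_Icc _ _)))
  rw [jetSet, Set.Icc_prod_eq, Set.Icc_prod_eq (-M.jetTop Λ).2]
  exact (h _ _).prod ((h _ _).prod (h _ _))

theorem jetBound_of_mem {Λ : ℝ} {y : Jet d N} (hy : y ∈ M.jetSet Λ) :
    JetBound M.Cφ M.Cφ₁ M.Cφ₂ y where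
  W k j := abs_le.2 ⟨hy.1.1.2.1 k j, hy.2.1.2.1 k j⟩
  A₁ k j := abs_le.2 ⟨hy.1.2.1.1 k j, hy.2.2.1.1 k j⟩
  W₁ k j := abs_le.2 ⟨hy.1.2.1.2.1 k j, hy.2.2.1.2.1 k j⟩
  A₂ k j := abs_le.2 ⟨hy.1.2.2.1 k j, hy.2.2.2.1 k j⟩
  W₂ k j := abs_le.2 ⟨hy.1.2.2.2.1 k j, hy.2.2.2.2.1 k j⟩

variable {M}

theorem Assumptions.jet_mem (hM : M.Assumptions) {Λ : ℝ} (h0 : 0 ≤ Λ) (h1 : ∀ y, |M.lam y| ≤ Λ)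
    (h2 : ∀ y, |deriv M.lam y| ≤ Λ) (θ : Params d N) : M.jet θ ∈ M.jetSet Λ := by
  have n0 : -Λ ≤ 0 := by linarith
  exact ⟨⟨⟨fun _ _ => (abs_le.1 (hM.φ_bound _)).1, fun _ _ => (abs_le.1 (hM.φ_bound _)).1,
      fun _ => (abs_le.1 (h1 _)).1, (abs_le.1 (h1 _)).1⟩,
    ⟨fun _ _ => (abs_le.1 (hM.φ_bound₁ _)).1, fun _ _ => (abs_le.1 (hM.φ_bound₁ _)).1,
      fun _ => (abs_le.1 (h2 _)).1, (abs_le.1 (h2 _)).1⟩,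
    ⟨fun _ _ => (abs_le.1 (hM.φ_bound₂ _)).1, fun _ _ => (abs_le.1 (hM.φ_bound₂ _)).1,
      fun _ => n0, n0⟩⟩,
    ⟨fun _ _ => (abs_le.1 (hM.φ_bound _)).2, fun _ _ => (abs_le.1 (hM.φ_bound _)).2,
      fun _ => (abs_le.1 (h1 _)).2, (abs_le.1 (h1 _)).2⟩,
    ⟨fun _ _ => (abs_le.1 (hM.φ_bound₁ _)).2, fun _ _ => (abs_le.1 (hM.φ_bound₁ _)).2,
      fun _ => (abs_le.1 (h2 _)).2, (abs_le.1 (h2 _)).2⟩,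
    ⟨fun _ _ => (abs_le.1 (hM.φ_bound₂ _)).2, fun _ _ => (abs_le.1 (hM.φ_bound₂ _)).2,
      fun _ => h0, h0⟩⟩

theorem Assumptions.jet₁_mem (hM : M.Assumptions) {Λ : ℝ} (h0 : 0 ≤ Λ) (h1 : ∀ y, |M.lam y| ≤ Λ)
    (h2 : ∀ y, |deriv M.lam y| ≤ Λ) (θ : Params d N) : M.jet₁ θ ∈ M.jetSet Λ := by
  have h := hM.jet_mem h0 h1 h2 θ
  have n0 : -Λ ≤ 0 := by linarith
  have c0 := hM.Cφ₂_nonneg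
  have n1 : -M.Cφ₂ ≤ 0 := by linarith
  exact ⟨⟨h.1.1, h.1.2.1, ⟨fun _ _ => n1, fun _ _ => n1, fun _ => n0, n0⟩⟩,
    ⟨h.2.1, h.2.2.1, ⟨fun _ _ => c0, fun _ _ => c0, fun _ => h0, h0⟩⟩⟩

/-- The recursion maps the hyper-rectangle to itself: the bounds are the fixed points of the
affine recursions for the bounds of the entries. -/
theorem Assumptions.preserves_netF (hM : M.Assumptions) (hd : 0 < d) (hN : 0 < N) {y : Jet d N}
    (hy : JetBound M.Cφ M.Cφ₁ M.Cφ₂ y) :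
    Preserves (U := Input d dZ) (fun u v => netF y u v) M.box := by
  intro u hu v hv
  have hC0 := hM.Cφ_nonneg
  have hC1 := hM.Cφ_lt_one
  have h10 := hM.Cφ₁_nonneg
  have h20 := hM.Cφ₂_nonneg
  have hd' : (0 : ℝ) < d := by exact_mod_cast hd
  have hN' : (0 : ℝ) < N := by exact_mod_cast hN
  have h4 : 0 < 4 - M.Cφ := by linarith
  have h4' : 0 < 1 - M.Cφ / 4 := by linarith
  obtain ⟨hs, hA, hW, hAA, hWA, hWW⟩ := M.mem_box.1 hv
  have hx : ∀ j, |u.1 j| ≤ 1 := fun j =>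
    (norm_le_pi_norm u.1 j).trans ((norm_fst_le u).trans hu)
  have hs' : ∀ k, |v.s k| ≤ 1 := fun k => abs_le.2 ⟨by linarith [(hs k).1], (hs k).2⟩
  have hdi : |1 / (d : ℝ)| ≤ 1 / d := (abs_of_nonneg (by positivity)).le
  have hNi : |1 / (N : ℝ)| ≤ 1 / N := (abs_of_nonneg (by positivity)).le
  have bA : ∀ i j k, |netPreA y u v i j k| ≤ M.Cφ₁ * M.Mφ / d := by
    intro i j k
    refine (abs_add_le _ _).trans ((add_le_add
      (abs_mul_le_mul (abs_mul_le_mul (abs_mul_le_mul hdi abs_ite_le) (hy.A₁ i j)) (hx j))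
      (abs_average_le hN hC0 (hy.W k) (hA i j))).trans (le_of_eq ?_))
    unfold Model.Mφ; field_simp
  have bW : ∀ i j k, |netPreW y v i j k| ≤ M.Cφ₁ * M.Mφ / N := by
    intro i j k
    refine (abs_add_le _ _).trans ((add_le_add
      (abs_mul_le_mul (abs_mul_le_mul (abs_mul_le_mul hNi abs_ite_le) (hy.W₁ i j)) (hs' j))
      (abs_average_le hN hC0 (hy.W k) (hW i j))).trans (le_of_eq ?_))
    unfold Model.Mφ; field_simp
  have second : ∀ {x a b e f α β ε φ B : ℝ}, |a| ≤ α → |b| ≤ β → |e| ≤ ε → |f| ≤ φ →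
      1 / 10 * α * β + 1 / 4 * (ε + φ) = B →
      |deriv (deriv Real.sigmoid) x * a * b + deriv Real.sigmoid x * (e + f)| ≤ B := by
    intro x a b e f α β ε φ B ha hb he hf hB
    rw [← hB]
    exact (abs_add_le _ _).trans (add_le_add
      (abs_mul_le_mul (abs_mul_le_mul (abs_deriv_deriv_sigmoid_le x) ha) hb)
      (abs_mul_le_mul (abs_deriv_sigmoid_le x)
        ((abs_add_le _ _).trans (add_le_add he hf))))
  rw [mem_box]
  refine ⟨fun k => ⟨Real.sigmoid_nonneg _, Real.sigmoid_le_one _⟩, fun i j k => ?_, fun i j k => ?_,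
    fun n m i j k => ?_, fun n m i j k => ?_, fun n m i j k => ?_⟩
  · refine (abs_mul_le_mul (abs_deriv_sigmoid_le _) (bA i j k)).trans (le_of_eq ?_)
    unfold Model.Mφ; field_simp; ring
  · refine (abs_mul_le_mul (abs_deriv_sigmoid_le _) (bW i j k)).trans (le_of_eq ?_)
    unfold Model.Mφ; field_simp; ring
  · refine second (bA i j k) (bA n m k)
      (abs_mul_le_mul (abs_mul_le_mul (abs_mul_le_mul (abs_mul_le_mul hdi abs_ite_le) abs_ite_le)
        (hy.A₂ i j)) (hx j)) (abs_average_le hN hC0 (hy.W k) (hAA i j n m)) ?_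
    unfold Model.aAA; field_simp; ring
  · refine second (bW n m k) (bA i j k)
      (abs_mul_le_mul (abs_mul_le_mul (abs_mul_le_mul hNi abs_ite_le) (hy.W₁ n m)) (hA i j m))
      (abs_average_le hN hC0 (hy.W k) (hWA n m i j)) ?_
    unfold Model.aWA; field_simp; ring
  · refine second (bW n m k) (bW i j k)
      (abs_mul_le_mul (abs_mul_le_mul (abs_mul_le_mul (abs_mul_le_mul hNi abs_ite_le) abs_ite_le)
        (hy.W₂ i j)) (hs' j)) (abs_average_le hN hC0 (hy.W k) (hWW n m i j)) ?_
    unfold Model.aWW; field_simp; ring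

end Model

end HyperRectangle

/-! ### A weighted norm that the recursion contracts -/

section Scale

variable {d N : ℕ}

/-- The diagonal map that multiplies the entries of level `k` by `β ^ k`. -/
def levelScale (β : ℝ) : Hidden d N →L[ℝ] Hidden d N :=
  ContinuousLinearMap.pi fun i => β ^ level i • ContinuousLinearMap.proj i

theorem levelScale_apply (β : ℝ) (δ : Hidden d N) (i : HiddenIndex d N) :
    levelScale β δ i = β ^ level i * δ i := rfl

theorem level_le_two (i : HiddenIndex d N) : level i ≤ 2 := by
  rcases i with k | k | k | k <;> simp [level]

theorem norm_le_levelScale {β : ℝ} (h0 : 0 < β) (h1 : β ≤ 1) (δ : Hidden d N) :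
    ‖δ‖ ≤ (β ^ 2)⁻¹ * ‖levelScale β δ‖ := by
  rw [pi_norm_le_iff_of_nonneg (by positivity)]
  intro i
  have h := norm_le_pi_norm (levelScale β δ) i
  rw [levelScale_apply, norm_mul, Real.norm_of_nonneg (by positivity)] at h
  rw [le_inv_mul_iff₀ (by positivity)]
  exact (mul_le_mul_of_nonneg_right (pow_le_pow_of_le_one h0.le h1 (level_le_two i))
    (norm_nonneg _)).trans h

theorem abs_fderiv_apply_le {E ι : Type*} [NormedAddCommGroup E] [NormedSpace ℝ E] [Fintype ι]
    {H : E → ι → ℝ} {p e : E} (hH : DifferentiableAt ℝ H p) {i : ι} {C : ℝ} (hC : 0 ≤ C)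
    (h : ∀ t : ℝ, |H (p + t • e) i - H p i| ≤ C * |t|) : |fderiv ℝ H p e i| ≤ C := by
  have hγ : HasDerivAt (fun t : ℝ => p + t • e) e 0 := by
    simpa using ((hasDerivAt_id (0 : ℝ)).smul_const e).const_add p
  have hd := hasDerivAt_pi.1 (hH.hasFDerivAt.comp_hasDerivAt_of_eq (0 : ℝ) hγ (by simp)) i
  refine hd.le_of_lip' hC (Filter.Eventually.of_forall fun t => ?_)
  simpa using h t

/-- If each entry is a contraction in the entries of its own level, then the map is a contraction in
the weighted norm: the influence of the lower levels is small for small `β`. -/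
theorem norm_levelScale_fderiv_le {Y V : Type*} [NormedAddCommGroup Y] [NormedSpace ℝ Y]
    [NormedAddCommGroup V] [NormedSpace ℝ V] {H : Y × V × Hidden d N → Hidden d N} {y : Y} {u : V}
    {v : Hidden d N} (hH : DifferentiableAt ℝ H (y, u, v)) {C : ℝ}
    (hlevel : ∀ (δ : Hidden d N) (m : ℝ) (i : HiddenIndex d N),
      (∀ j, level j < level i → δ j = 0) → (∀ j, level j = level i → |δ j| ≤ m) →
        |H (y, u, v + δ) i - H (y, u, v) i| ≤ C / 4 * m)
    (hC : 0 ≤ C) (hC1 : C ≤ 1) {K : ℝ} {β : ℝ} (h0 : 0 < β) (h1 : β ≤ 1)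
    (hβ : K * β ≤ 1 / 4) (hK : ‖fderiv ℝ H (y, u, v)‖ ≤ K) (δ : Hidden d N) :
    ‖levelScale β (fderiv ℝ H (y, u, v) (0, 0, δ))‖ ≤ 1 / 2 * ‖levelScale β δ‖ := by
  set n := ‖levelScale β δ‖ with hn
  have hn0 : 0 ≤ n := norm_nonneg _
  have hδ : ∀ j, |δ j| ≤ n * (β ^ level j)⁻¹ := by
    intro j
    have h := norm_le_pi_norm (levelScale β δ) j
    rw [levelScale_apply, norm_mul, Real.norm_of_nonneg (by positivity)] at h
    rw [← div_eq_mul_inv, le_div_iff₀ (by positivity), mul_comm]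
    exact h
  rw [pi_norm_le_iff_of_nonneg (by positivity)]
  intro i
  rw [levelScale_apply, norm_mul, Real.norm_of_nonneg (by positivity)]
  set lo : Hidden d N := fun j => if level j < level i then δ j else 0 with hlo
  set hi : Hidden d N := fun j => if level j < level i then 0 else δ j with hhi
  have hsplit : fderiv ℝ H (y, u, v) (0, 0, δ)
      = fderiv ℝ H (y, u, v) (0, 0, hi) + fderiv ℝ H (y, u, v) (0, 0, lo) := by
    rw [← map_add]
    congr 1
    simp only [Prod.mk_add_mk, add_zero]
    congr 2
    funext j
    by_cases h : level j < level i <;> simp [hlo, hhi, h]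
  have hhigh : ‖fderiv ℝ H (y, u, v) (0, 0, hi) i‖ ≤ C / 4 * (n * (β ^ level i)⁻¹) := by
    refine abs_fderiv_apply_le hH (by positivity)
      fun t => ?_
    have hp : ((y, u, v) : Y × V × Hidden d N) + t • (0, 0, hi)
        = (y, u, v + t • hi) := by simp
    rw [hp]
    have := hlevel (t • hi) (n * (β ^ level i)⁻¹ * |t|) i
      (fun j hj => by simp [hhi, hj]) (fun j hj => by
        have hlt : ¬ level j < level i := by omega
        simp only [hhi, Pi.smul_apply, hlt, if_false, smul_eq_mul, abs_mul]
        rw [mul_comm, ← hj]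
        exact mul_le_mul_of_nonneg_right (hδ j) (abs_nonneg _))
    rw [← mul_assoc] at this
    exact this
  have hlow : β ^ level i * ‖fderiv ℝ H (y, u, v) (0, 0, lo) i‖ ≤ 1 / 4 * n := by
    have hK0 : 0 ≤ K := (norm_nonneg _).trans hK
    rcases Nat.eq_zero_or_pos (level i) with h | h
    · have : lo = 0 := by funext j; simp [hlo, h]
      rw [this]
      have : fderiv ℝ H (y, u, v) ((0, 0, 0) : Y × V × Hidden d N) = 0 :=
        map_zero _
      rw [this]
      simp only [Pi.zero_apply, norm_zero, mul_zero]
      positivity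
    · obtain ⟨k, hk⟩ : ∃ k, level i = k + 1 := ⟨level i - 1, by omega⟩
      have hlo' : ‖lo‖ ≤ n * (β ^ k)⁻¹ := by
        rw [pi_norm_le_iff_of_nonneg (by positivity)]
        intro j
        by_cases hj : level j < level i
        · simp only [hlo, hj, if_true, Real.norm_eq_abs]
          refine (hδ j).trans (mul_le_mul_of_nonneg_left ?_ hn0)
          exact inv_anti₀ (by positivity) (pow_le_pow_of_le_one h0.le h1 (by omega))
        · simp only [hlo, hj, if_false, norm_zero]
          positivity
      have : ‖fderiv ℝ H (y, u, v) (0, 0, lo) i‖ ≤ K * (n * (β ^ k)⁻¹) := by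
        refine (norm_le_pi_norm _ i).trans (((fderiv ℝ H (y, u, v)).le_of_opNorm_le hK _).trans ?_)
        refine mul_le_mul_of_nonneg_left ?_ hK0
        simpa using hlo'
      calc β ^ level i * ‖fderiv ℝ H (y, u, v) (0, 0, lo) i‖
          ≤ β ^ level i * (K * (n * (β ^ k)⁻¹)) := by gcongr
        _ = K * β * n := by rw [hk, pow_succ]; field_simp
        _ ≤ 1 / 4 * n := by gcongr
  calc β ^ level i * ‖fderiv ℝ H (y, u, v) (0, 0, δ) i‖
      ≤ β ^ level i * (‖fderiv ℝ H (y, u, v) (0, 0, hi) i‖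
        + ‖fderiv ℝ H (y, u, v) (0, 0, lo) i‖) := by
        rw [hsplit]; gcongr; exact norm_add_le _ _
    _ ≤ β ^ level i * (C / 4 * (n * (β ^ level i)⁻¹)) + 1 / 4 * n := by
        rw [mul_add]; gcongr
    _ = (C / 4 + 1 / 4) * n := by field_simp
    _ ≤ 1 / 2 * n := by gcongr; linarith

end Scale

/-! ### The Poisson equation -/

section Poisson

variable {U W F : Type*} [NormedAddCommGroup U] [MeasurableSpace U] [BorelSpace U]
  [SecondCountableTopology U] [NormedAddCommGroup W] [MeasurableSpace W]
  [NormedAddCommGroup F] [NormedSpace ℝ F] [CompleteSpace F]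
  {κ : Kernel U U} {ν : Measure ℝ} {ℓ : ℝ} {E : Set ℝ}
  {G : U → W → W} {hG : Measurable fun h : U × W × ℝ => G h.1 h.2.1} {S : Set W}
  {d : W → W → ℝ} {C c Δ : ℝ}

/-- The solution `∑ₜ (Pᵗ ψ - ∫ ψ dμ)` of the Poisson equation. -/
def resolvent {X F : Type*} [MeasurableSpace X] [NormedAddCommGroup F] [NormedSpace ℝ F]
    (P : Kernel X X) (μ : Measure X) (ψ : X → F) (h : X) : F :=
  ∑' t, (iter P t ψ h - ∫ y, ψ y ∂μ)

variable (hD : Driver κ ν ℓ E) (hC : Contracts G S d C c)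
  (hΔ : ∀ w ∈ S, ∀ w' ∈ S, d w w' ≤ Δ) {ψ : U × W × ℝ → F} {B K : ℝ}
  (hψ : Observable (region U S E) ψ B) (hK : 0 ≤ K) (hL : MemLipschitz S E d ψ K)
  {μ : Measure (U × W × ℝ)} [IsProbabilityMeasure μ] (hμ : ∀ᵐ y ∂μ, y ∈ region U S E)
  (hinv : (drive κ ν G hG).Invariant μ)

include hD hC hΔ hψ hK hL hμ hinv

theorem Driver.norm_iter_sub_limit_le (t : ℕ) {h : U × W × ℝ} (hh : h ∈ region U S E) :
    ‖iter (drive κ ν G hG) t ψ h - ∫ y, ψ y ∂μ‖ ≤ mixConst ℓ C c Δ B K * rate ℓ c ^ t := by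
  rw [← hD.integral_iter_of_invariant (hG := hG) hC.meas hC.preserves hψ hμ hinv t]
  exact hD.norm_iter_sub_integral_le hC hΔ hψ hK hL t hh hμ

theorem Driver.summable_iter_sub {h : U × W × ℝ} (hh : h ∈ region U S E) :
    Summable fun t => iter (drive κ ν G hG) t ψ h - ∫ y, ψ y ∂μ :=
  Summable.of_norm_bounded ((summable_geometric_of_lt_one hD.rate_nonneg
    (RNN.rate_lt_one hD.lt_one hC.rate_lt_one)).mul_left _)
    fun t => hD.norm_iter_sub_limit_le hC hΔ hψ hK hL hμ hinv t hh

theorem Driver.norm_resolvent_le {h : U × W × ℝ} (hh : h ∈ region U S E) :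
    ‖resolvent (drive κ ν G hG) μ ψ h‖ ≤ mixConst ℓ C c Δ B K * (1 - rate ℓ c)⁻¹ :=
  tsum_of_norm_bounded ((hasSum_geometric_of_lt_one hD.rate_nonneg
    (RNN.rate_lt_one hD.lt_one hC.rate_lt_one)).mul_left _)
    fun t => hD.norm_iter_sub_limit_le hC hΔ hψ hK hL hμ hinv t hh

theorem Driver.integrable_resolvent {h : U × W × ℝ} (hh : h ∈ region U S E) :
    Integrable (resolvent (drive κ ν G hG) μ ψ) (drive κ ν G hG h) := by
  have := hD.isMarkovKernel_drive (hG := hG)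
  have hae := hD.ae_drive_region (hG := hG) hC.meas hC.preserves h hh
  refine Integrable.of_bound (C := mixConst ℓ C c Δ B K * (1 - rate ℓ c)⁻¹) ?_ ?_
  · refine aestronglyMeasurable_of_tendsto_ae Filter.atTop
      (f := fun n y => ∑ t ∈ Finset.range n, (iter (drive κ ν G hG) t ψ y - ∫ y, ψ y ∂μ)) ?_ ?_
    · intro n
      refine Finset.aestronglyMeasurable_fun_sum _ fun t _ => ?_
      exact ((hD.observable_iter hC.meas hC.preserves hψ t).meas.sub
        stronglyMeasurable_const).aestronglyMeasurable
    · filter_upwards [hae] with y hy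
      exact (hD.summable_iter_sub hC hΔ hψ hK hL hμ hinv hy).hasSum.tendsto_sum_nat
  · filter_upwards [hae] with y hy
    exact hD.norm_resolvent_le hC hΔ hψ hK hL hμ hinv hy

/-- The Poisson equation: integration against the kernel shifts the series. -/
theorem Driver.resolvent_sub_integral {h : U × W × ℝ} (hh : h ∈ region U S E) :
    resolvent (drive κ ν G hG) μ ψ h - ∫ y, resolvent (drive κ ν G hG) μ ψ y ∂drive κ ν G hG h
      = ψ h - ∫ y, ψ y ∂μ := by
  have := hD.isMarkovKernel_drive (hG := hG)
  have hae := hD.ae_drive_region (hG := hG) hC.meas hC.preserves h hh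
  have hr := RNN.rate_lt_one hD.lt_one hC.rate_lt_one
  have hobs := fun t => hD.observable_iter (hG := hG) hC.meas hC.preserves hψ t
  have hint : ∀ t, Integrable (fun y => iter (drive κ ν G hG) t ψ y - ∫ y, ψ y ∂μ)
      (drive κ ν G hG h) := fun t => ((hobs t).integrable hae).sub (integrable_const _)
  have hsum : Summable fun t => ∫ y, ‖iter (drive κ ν G hG) t ψ y - ∫ y, ψ y ∂μ‖
      ∂drive κ ν G hG h := by
    refine Summable.of_nonneg_of_le (fun t => integral_nonneg fun _ => norm_nonneg _) (fun t => ?_)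
      ((summable_geometric_of_lt_one hD.rate_nonneg hr).mul_left (mixConst ℓ C c Δ B K))
    have h1 := integral_mono_ae (hint t).norm (integrable_const _) (by
      filter_upwards [hae] with y hy
      exact hD.norm_iter_sub_limit_le hC hΔ hψ hK hL hμ hinv t hy)
    simpa using h1
  have h1 := hasSum_integral_of_summable_integral_norm hint hsum
  have h2 : ∀ t, ∫ y, (iter (drive κ ν G hG) t ψ y - ∫ y, ψ y ∂μ) ∂drive κ ν G hG h
      = iter (drive κ ν G hG) (t + 1) ψ h - ∫ y, ψ y ∂μ := fun t => by
    rw [integral_sub ((hobs t).integrable hae) (integrable_const _),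
      hD.iter_succ hC.meas hC.preserves hψ t hh]
    simp
  have h3 := (hD.summable_iter_sub hC hΔ hψ hK hL hμ hinv hh).tsum_eq_zero_add
  have h4 : ∫ y, resolvent (drive κ ν G hG) μ ψ y ∂drive κ ν G hG h
      = ∑' t, (iter (drive κ ν G hG) (t + 1) ψ h - ∫ y, ψ y ∂μ) := by
    rw [← tsum_congr h2]; exact h1.tsum_eq.symm
  rw [h4, resolvent, h3, iter_zero hψ.meas]
  abel

/-- The resolvent is Lipschitz, also in the noise: the noise matters for the term `t = 0` only. -/
theorem Driver.norm_resolvent_sub_le {L b' : ℝ} (hL0 : 0 ≤ L) (hb0 : 0 ≤ b')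
    (hLip : ∀ h ∈ region U S E, ∀ h' ∈ region U S E, ‖ψ h - ψ h'‖ ≤ L * ‖h - h'‖)
    (hb' : ∀ w ∈ S, ∀ w' ∈ S, d w w' ≤ b' * ‖w - w'‖) {h h' : U × W × ℝ}
    (hh : h ∈ region U S E) (hh' : h' ∈ region U S E) :
    ‖resolvent (drive κ ν G hG) μ ψ h - resolvent (drive κ ν G hG) μ ψ h'‖
      ≤ (L + K * (weight ℓ C c + b')) * (1 - rate ℓ c)⁻¹ * ‖h - h'‖ := by
  have hr := RNN.rate_lt_one hD.lt_one hC.rate_lt_one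
  have hw : 0 ≤ weight ℓ C c := zero_le_one.trans (le_max_left _ _)
  have hsum := (hD.summable_iter_sub hC hΔ hψ hK hL hμ hinv hh).tsum_sub
    (hD.summable_iter_sub hC hΔ hψ hK hL hμ hinv hh')
  unfold resolvent
  rw [← hsum]
  have hgeo := (hasSum_geometric_of_lt_one (hD.rate_nonneg (c := c)) hr).mul_left
    ((L + K * (weight ℓ C c + b')) * ‖h - h'‖)
  refine (tsum_of_norm_bounded hgeo fun t => ?_).trans (le_of_eq (by ring))
  rw [sub_sub_sub_cancel_right]
  have hn := norm_nonneg (h - h')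
  have hKw : 0 ≤ K * (weight ℓ C c + b') := by positivity
  rcases t with _ | t
  · rw [iter_zero hψ.meas, iter_zero hψ.meas, pow_zero, mul_one]
    refine (hLip h hh h' hh').trans ?_
    gcongr
    linarith
  · refine (hD.norm_iter_succ_sub_le hC hψ hK hL t h hh h' hh').trans ?_
    have h1 : ‖h.1 - h'.1‖ ≤ ‖h - h'‖ := norm_fst_le (h - h')
    have h2 : d h.2.1 h'.2.1 ≤ b' * ‖h - h'‖ := (hb' _ hh.2.1 _ hh'.2.1).trans
      (mul_le_mul_of_nonneg_left ((norm_fst_le (h - h').2).trans (norm_snd_le (h - h'))) hb0)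
    calc K * rate ℓ c ^ (t + 1) * (weight ℓ C c * ‖h.1 - h'.1‖ + d h.2.1 h'.2.1)
        ≤ K * rate ℓ c ^ (t + 1) * (weight ℓ C c * ‖h - h'‖ + b' * ‖h - h'‖) := by
          have := hD.rate_nonneg (c := c)
          gcongr
      _ = K * (weight ℓ C c + b') * ‖h - h'‖ * rate ℓ c ^ (t + 1) := by ring
      _ ≤ (L + K * (weight ℓ C c + b')) * ‖h - h'‖ * rate ℓ c ^ (t + 1) := by
          have := hD.rate_nonneg (c := c)
          gcongr
          linarith

end Poisson

/-! ### Stationary distribution and Poisson equation of the network -/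

section Chain

variable {d dZ N : ℕ} {M : Model d dZ N}

/-- The recursion contracts a weighted norm with rate `1 / 2`, uniformly in the jet. -/
theorem exists_paramSystem_netMap (hM : M.Assumptions) (hd : 0 < d) (hN : 0 < N) (Λ : ℝ) :
    ∃ (D : Hidden d N →L[ℝ] Hidden d N) (b K : ℝ),
      ParamSystem (netMap (dZ := dZ)) (M.jetSet Λ) M.box D b (1 / 2) ∧
      UnifBound (netMap (dZ := dZ)) (M.jetSet Λ) (Metric.closedBall 0 1) M.box K := by
  have hbox : IsCompact M.box := isCompact_Icc
  have cbox : Convex ℝ M.box := convex_Icc _ _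
  have hsm := contDiff_netMap (d := d) (dZ := dZ) (N := N)
  have hball := isCompact_closedBall (0 : Input d dZ) 1
  have cball := convex_closedBall (0 : Input d dZ) 1
  obtain ⟨K, hK⟩ := exists_unifBound hsm (M.isCompact_jetSet Λ) (M.convex_jetSet Λ) hball cball
    hbox cbox
  have hK0 := hK.nonneg
  set β : ℝ := (4 * (K + 1))⁻¹ with hβ
  have hβ0 : 0 < β := by positivity
  have hβ1 : β ≤ 1 := inv_le_one_of_one_le₀ (by linarith)
  have hKβ : K * β ≤ 1 / 4 := by
    rw [hβ, ← div_eq_mul_inv, div_le_iff₀ (by positivity)]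
    linarith
  have hcontr : ∀ y ∈ M.jetSet Λ, ∀ u, ‖u‖ ≤ 1 → ∀ v ∈ M.box, ∀ δ,
      ‖levelScale β (fderiv ℝ (netMap (dZ := dZ)) (y, u, v) (0, 0, δ))‖
        ≤ 1 / 2 * ‖levelScale β δ‖ := by
    intro y hy u hu v hv δ
    have hdiff := hsm.differentiable (by norm_num) (y, u, v)
    have hK' := hK.bound_fderiv y hy u (by simpa using hu) v hv
    exact norm_levelScale_fderiv_le hdiff
      (fun δ m i h0 h1 => abs_netF_add_sub_le hN (M.jetBound_of_mem hy) hM.Cφ_nonneg u v δ i h0 h1)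
      hM.Cφ_nonneg hM.Cφ_lt_one.le hβ0 hβ1 hKβ hK' δ
  have hb : 1 ≤ (β ^ 2)⁻¹ := (one_le_inv₀ (by positivity)).2 (pow_le_one₀ hβ0.le hβ1)
  exact ⟨levelScale β, (β ^ 2)⁻¹, K, ⟨hsm, hbox, cbox, hb, by norm_num, by norm_num, norm_le_levelScale hβ0 hβ1,
    fun y hy => hM.preserves_netF hd hN (M.jetBound_of_mem hy), hcontr⟩, hK⟩

theorem Model.Assumptions.exists_lam_bound (hM : M.Assumptions) :
    ∃ Λ, 0 ≤ Λ ∧ (∀ y, |M.lam y| ≤ Λ) ∧ (∀ y, |deriv M.lam y| ≤ Λ) ∧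
      ∀ y, |deriv (deriv M.lam) y| ≤ Λ := by
  obtain ⟨a, ha⟩ := hM.lam_bound
  obtain ⟨b, hb⟩ := hM.lam_bound₁
  obtain ⟨c, hc⟩ := hM.lam_bound₂
  exact ⟨max a (max b c), (abs_nonneg _).trans ((ha 0).trans (le_max_left _ _)),
    fun y => (ha y).trans (le_max_left _ _),
    fun y => (hb y).trans ((le_max_left _ _).trans (le_max_right _ _)),
    fun y => (hc y).trans ((le_max_right _ _).trans (le_max_right _ _))⟩

theorem Model.Assumptions.driver (hM : M.Assumptions) :
    Driver M.ker M.noise M.Lker M.noiseSet where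
  markov := M.ker_markov
  prob := M.noise_prob
  nonneg := hM.Lker_nonneg
  lt_one := hM.Lker_lt_one
  contract := hM.ker_contract
  bounded := hM.ker_bounded
  meas := hM.noiseSet_meas
  mem := hM.noise_mem

theorem drive_congr {U W : Type*} [MeasurableSpace U] [MeasurableSpace W] {κ : Kernel U U}
    {ν : Measure ℝ} {G G' : U → W → W} {hG : Measurable fun h : U × W × ℝ => G h.1 h.2.1}
    {hG' : Measurable fun h : U × W × ℝ => G' h.1 h.2.1} (h : G = G') :
    drive κ ν G hG = drive κ ν G' hG' := by subst h; rfl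

theorem measurable_netMap (y : Jet d N) :
    Measurable fun h : Input d dZ × Hidden d N × ℝ => netMap (y, h.1, h.2.1) := by
  have := measurable_paramMap (Gf := netMap (d := d) (dZ := dZ) (N := N)) contDiff_netMap y
  exact this

theorem Model.P_eq_drive (M : Model d dZ N) (θ : Params d N) :
    M.P θ = drive M.ker M.noise (fun u v => netMap (M.jet θ, u, v))
      (measurable_netMap (M.jet θ)) :=
  drive_congr (G := M.F θ) (hG := M.measurable_F θ) (by funext u v; exact M.F_eq_netF θ u v)

theorem Model.Assumptions.noiseSet_nonempty (hM : M.Assumptions) : M.noiseSet.Nonempty := by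
  by_contra h
  have := hM.noise_mem
  rw [Set.not_nonempty_iff_eq_empty.1 h] at this
  simp at this

theorem Model.Assumptions.zero_mem_box (hM : M.Assumptions) (hd : 0 < d) (hN : 0 < N) :
    (0 : Hidden d N) ∈ M.box := by
  have hC1 := hM.Cφ_lt_one
  have h10 := hM.Cφ₁_nonneg
  have h20 := hM.Cφ₂_nonneg
  have h4 : 0 < 4 - M.Cφ := by linarith
  have h4' : 0 < 1 - M.Cφ / 4 := by linarith
  rw [M.mem_box]
  have hz : |(0 : ℝ)| = 0 := abs_zero
  refine ⟨fun k => ⟨le_rfl, zero_le_one⟩, fun i j k => ?_, fun i j k => ?_, fun n m i j k => ?_,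
    fun n m i j k => ?_, fun n m i j k => ?_⟩ <;>
  · refine hz.le.trans ?_
    first
    | positivity
    | (unfold Model.aAA; positivity)
    | (unfold Model.aWA; positivity)
    | (unfold Model.aWW; positivity)

theorem Model.Assumptions.measurableSet_R (hM : M.Assumptions) : MeasurableSet M.R := by
  rw [M.R_eq_region]
  exact measurableSet_region isCompact_Icc.measurableSet hM.noiseSet_meas

theorem Model.Assumptions.isStationary_iff (hM : M.Assumptions) (θ : Params d N)
    (μ : Measure (State d dZ N)) : M.IsStationary θ μ ↔
      IsProbabilityMeasure μ ∧ (∀ᵐ y ∂μ, y ∈ region (Input d dZ) M.box M.noiseSet) ∧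
        (M.P θ).Invariant μ := by
  unfold Model.IsStationary
  rw [← M.R_eq_region]
  refine and_congr_right fun hμ => and_congr_left' ?_
  exact (mem_ae_iff_prob_eq_one hM.measurableSet_R).symm

theorem Model.Assumptions.existsUnique_isStationary (hM : M.Assumptions) (hd : 0 < d) (hN : 0 < N)
    (θ : Params d N) : ∃! μ, M.IsStationary θ μ := by
  obtain ⟨Λ, hΛ0, hΛ, hΛ1, -⟩ := hM.exists_lam_bound
  obtain ⟨D, b, K, hP, hK⟩ := exists_paramSystem_netMap hM hd hN Λ
  obtain ⟨Δ, hΔ⟩ := hP.exists_diam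
  have hy := hM.jet_mem hΛ0 hΛ hΛ1 θ
  have hc := hP.contracts hK hy
  simp only [hM.isStationary_iff, M.P_eq_drive]
  obtain ⟨μ, h1, h2, h3⟩ := hM.driver.exists_invariant (hG := measurable_netMap (M.jet θ))
    hc hΔ hP.one_le (fun w _ w' _ => hP.lower (w - w')) (norm_nonneg D)
    (fun w _ w' _ => D.le_opNorm (w - w')) hP.compact ⟨0, hM.zero_mem_box hd hN⟩
  refine ⟨μ, ⟨h1, h2, h3⟩, ?_⟩
  rintro μ' ⟨h1', h2', h3'⟩
  exact hM.driver.eq_of_invariant hc hΔ hP.one_le (fun w _ w' _ => hP.lower (w - w')) h2' h3' h2 h3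

theorem Model.Assumptions.stationary_spec (hM : M.Assumptions) (hd : 0 < d) (hN : 0 < N)
    (θ : Params d N) : IsProbabilityMeasure (M.stationary θ) ∧
      (∀ᵐ y ∂M.stationary θ, y ∈ region (Input d dZ) M.box M.noiseSet) ∧
        (M.P θ).Invariant (M.stationary θ) :=
  (hM.isStationary_iff θ _).1
    (Classical.epsilon_spec (hM.existsUnique_isStationary hd hN θ).exists)

theorem Model.Assumptions.isMarkovKernel_P (hM : M.Assumptions) (θ : Params d N) :
    IsMarkovKernel (M.P θ) := by
  rw [M.P_eq_drive]; exact hM.driver.isMarkovKernel_drive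

theorem Model.Assumptions.ae_P (hM : M.Assumptions) (hd : 0 < d) (hN : 0 < N) (θ : Params d N) :
    ∀ h ∈ region (Input d dZ) M.box M.noiseSet,
      ∀ᵐ y ∂M.P θ h, y ∈ region (Input d dZ) M.box M.noiseSet := by
  obtain ⟨Λ, hΛ0, hΛ, hΛ1, -⟩ := hM.exists_lam_bound
  rw [M.P_eq_drive]
  exact hM.driver.ae_drive_region isCompact_Icc.measurableSet
    (hM.preserves_netF hd hN (M.jetBound_of_mem (hM.jet_mem hΛ0 hΛ hΛ1 θ)))

theorem Model.Assumptions.ae_P_pow (hM : M.Assumptions) (hd : 0 < d) (hN : 0 < N) (θ : Params d N)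
    (t : ℕ) {h : State d dZ N} (hh : h ∈ region (Input d dZ) M.box M.noiseSet) :
    ∀ᵐ y ∂(M.P θ ^ t) h, y ∈ region (Input d dZ) M.box M.noiseSet := by
  have := hM.isMarkovKernel_P θ
  exact ae_pow_mem (measurableSet_region isCompact_Icc.measurableSet hM.noiseSet_meas)
    (hM.ae_P hd hN θ) t hh

theorem Model.Assumptions.poissonTerm_eq (hM : M.Assumptions) (hd : 0 < d) (hN : 0 < N)
    (Q : Params d N → State d dZ N → ℝ) (θ : Params d N) (t : ℕ) {h : State d dZ N}
    (hh : h ∈ region (Input d dZ) M.box M.noiseSet) :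
    M.poissonTerm Q θ h t = iter (M.P θ) t (Q θ) h - ∫ y, Q θ y ∂M.stationary θ := by
  unfold Model.poissonTerm iter
  rw [M.R_eq_region, Measure.restrict_eq_self_of_ae_mem (hM.ae_P_pow hd hN θ t hh),
    Measure.restrict_eq_self_of_ae_mem (hM.stationary_spec hd hN θ).2.1]

theorem Model.Assumptions.V_eq_resolvent (hM : M.Assumptions) (hd : 0 < d) (hN : 0 < N)
    (Q : Params d N → State d dZ N → ℝ) (θ : Params d N) {h : State d dZ N}
    (hh : h ∈ region (Input d dZ) M.box M.noiseSet) :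
    M.V Q θ h = resolvent (M.P θ) (M.stationary θ) (Q θ) h :=
  tsum_congr fun t => hM.poissonTerm_eq hd hN Q θ t hh

/-- The Poisson equation for right-hand sides that are uniformly Lipschitz and have bounded
oscillation in the noise. Such a function need be neither bounded nor, off the region `R`,
measurable, but on `R` it differs by a constant, for each `θ`, from an observable. -/
theorem Model.Assumptions.poisson (hM : M.Assumptions) (hd : 0 < d) (hN : 0 < N)
    {Q : Params d N → State d dZ N → ℝ} (hL : M.UnifLipschitz Q) (hO : M.BoundedNoiseOsc Q) :
    M.SeriesConverges Q ∧ M.SolvesPoisson Q (M.V Q) ∧ M.UnifBounded (M.V Q) ∧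
      M.UnifLipschitz (M.V Q) := by
  obtain ⟨L, hL⟩ := hL
  obtain ⟨O, hO⟩ := hO
  have hL' : ∀ θ, ∀ h ∈ M.R, ∀ h' ∈ M.R, |Q θ h - Q θ h'| ≤ |L| * ‖h - h'‖ :=
    fun θ h hh h' hh' => (hL θ h hh h' hh').trans
      (mul_le_mul_of_nonneg_right (le_abs_self L) (norm_nonneg _))
  have hL0 := abs_nonneg L
  obtain ⟨Λ, hΛ0, hΛ, hΛ1, -⟩ := hM.exists_lam_bound
  obtain ⟨D, b, K, hP, hK⟩ := exists_paramSystem_netMap hM hd hN Λ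
  obtain ⟨Δ, hΔ⟩ := hP.exists_diam
  have hb1 := hP.one_le
  obtain ⟨η₀, hη₀⟩ := hM.noiseSet_nonempty
  set R' := region (Input d dZ) M.box M.noiseSet with hR'
  have hR : M.R = R' := M.R_eq_region
  rw [hR] at hL'
  have hmR : MeasurableSet R' := hR ▸ hM.measurableSet_R
  set h₀ : State d dZ N := (0, 0, η₀) with hh₀
  have hmem₀ : h₀ ∈ R' := ⟨by simp [hh₀], hM.zero_mem_box hd hN, hη₀⟩
  -- on the region `Q θ` is a constant plus the observable `ψ θ`
  set ψ : Params d N → State d dZ N → ℝ := fun θ => R'.indicator fun h => Q θ h - Q θ h₀ with hψdef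
  have hψR : ∀ θ, ∀ h ∈ R', ψ θ h = Q θ h - Q θ h₀ := fun θ h hh => Set.indicator_of_mem hh _
  have hψQ : ∀ θ, ∀ h ∈ R', Q θ h = ψ θ h + Q θ h₀ := fun θ h hh => by rw [hψR θ h hh]; ring
  set B := O + |L| * (2 + b * Δ) with hB
  have hobs : ∀ θ, Observable R' (ψ θ) B := by
    intro θ
    constructor
    · refine Measurable.stronglyMeasurable ?_
      have hc : ContinuousOn (Q θ) R' := by
        refine (LipschitzOnWith.of_dist_le_mul (K := ⟨|L|, hL0⟩) fun x hx y hy => ?_).continuousOn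
        rw [Real.dist_eq, dist_eq_norm]
        exact hL' θ x hx y hy
      classical
      simp only [hψdef]
      rw [← Set.piecewise_eq_indicator]
      exact (hc.sub continuousOn_const).measurable_piecewise continuousOn_const hmR
    · rintro ⟨u, v, η⟩ hh
      rw [hψR θ _ hh, Real.norm_eq_abs]
      have hh' : ((u, v, η₀) : State d dZ N) ∈ R' := ⟨hh.1, hh.2.1, hη₀⟩
      have h1 := hO θ u v η η₀ (hR ▸ hh) (hR ▸ hh')
      have h2 := hL' θ _ hh' _ hmem₀
      have hu : ‖u‖ ≤ 1 := hh.1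
      have hv : ‖v‖ ≤ b * Δ := by
        have := (hP.lower (v - 0)).trans (mul_le_mul_of_nonneg_left
          (hΔ v hh.2.1 0 (hM.zero_mem_box hd hN)) (by linarith))
        simpa using this
      have h3 : ‖((u, v, η₀) : State d dZ N) - h₀‖ ≤ 2 + b * Δ := by
        have := norm_nonneg v
        simp only [hh₀, Prod.mk_sub_mk, sub_zero, sub_self, Prod.norm_mk, norm_zero, sup_le_iff]
        refine ⟨by linarith, by linarith, by linarith⟩
      calc |Q θ (u, v, η) - Q θ h₀|
          ≤ |Q θ (u, v, η) - Q θ (u, v, η₀)| + |Q θ (u, v, η₀) - Q θ h₀| := abs_sub_le _ _ _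
        _ ≤ O + |L| * (2 + b * Δ) := add_le_add h1 (h2.trans (mul_le_mul_of_nonneg_left h3 hL0))
  have hLip : ∀ θ, ∀ h ∈ R', ∀ h' ∈ R', ‖ψ θ h - ψ θ h'‖ ≤ |L| * ‖h - h'‖ := by
    intro θ h hh h' hh'
    rw [hψR θ h hh, hψR θ h' hh', sub_sub_sub_cancel_right]
    exact hL' θ h hh h' hh'
  have hmemL : ∀ θ, MemLipschitz M.box M.noiseSet (fun w w' => ‖D (w - w')‖) (ψ θ) (|L| * b) := by
    intro θ u u' v v' η hu hu' hv hv' hη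
    refine (hLip θ _ ⟨hu, hv, hη⟩ _ ⟨hu', hv', hη⟩).trans ?_
    rw [mul_assoc]
    refine mul_le_mul_of_nonneg_left ?_ hL0
    have h1 := hP.lower (v - v')
    have h2 := norm_nonneg (u - u')
    have h3 : ‖u - u'‖ ≤ b * ‖u - u'‖ := le_mul_of_one_le_left h2 hb1
    have h4 := norm_nonneg (D (v - v'))
    have h5 : 0 ≤ b * ‖D (v - v')‖ := by positivity
    have h6 : 0 ≤ b * ‖u - u'‖ := by positivity
    simp only [Prod.mk_sub_mk, sub_self, Prod.norm_mk, norm_zero, sup_le_iff, mul_add]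
    refine ⟨by linarith, by linarith, by linarith⟩
  have hKn : 0 ≤ |L| * b := by positivity
  have hcon := fun θ => hP.contracts hK (hM.jet_mem hΛ0 hΛ hΛ1 θ)
  have hint : ∀ θ (μ : Measure (State d dZ N)) [IsProbabilityMeasure μ], (∀ᵐ y ∂μ, y ∈ R') →
      Integrable (Q θ) μ ∧ ∫ y, Q θ y ∂μ = ∫ y, ψ θ y ∂μ + Q θ h₀ := by
    intro θ μ _ hμ
    have he : (fun y => ψ θ y + Q θ h₀) =ᵐ[μ] Q θ := by
      filter_upwards [hμ] with y hy
      exact (hψQ θ y hy).symm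
    have hi := (hobs θ).integrable hμ
    refine ⟨(hi.add (integrable_const _)).congr he, ?_⟩
    rw [← integral_congr_ae he, integral_add hi (integrable_const _)]
    simp
  have hμ := hM.stationary_spec hd hN
  have hμint := fun θ => by
    have := (hμ θ).1
    exact hint θ (M.stationary θ) (hμ θ).2.1
  have hPint := fun θ t h (hh : h ∈ R') => by
    have := hM.isMarkovKernel_P θ
    exact hint θ ((M.P θ ^ t) h) (hM.ae_P_pow hd hN θ t hh)
  have hterm : ∀ θ, ∀ h ∈ R', ∀ t, M.poissonTerm Q θ h t
      = iter (M.P θ) t (ψ θ) h - ∫ y, ψ θ y ∂M.stationary θ := by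
    intro θ h hh t
    rw [hM.poissonTerm_eq hd hN Q θ t hh, (hμint θ).2]
    unfold iter
    rw [(hPint θ t h hh).2]
    ring
  have hV : ∀ θ, ∀ h ∈ R', M.V Q θ h = resolvent (M.P θ) (M.stationary θ) (ψ θ) h :=
    fun θ h hh => tsum_congr (hterm θ h hh)
  have hinv := fun θ => M.P_eq_drive θ ▸ (hμ θ).2.2
  refine ⟨fun θ => ⟨(hμint θ).1.integrableOn, fun h hh => ⟨fun t => ?_, ?_⟩⟩,
    fun θ => ⟨(hμint θ).1.integrableOn, fun h hh => ?_⟩, ?_, ?_⟩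
  · exact (hPint θ t h (hR ▸ hh)).1.integrableOn
  · have := (hμ θ).1
    rw [summable_congr (hterm θ h (hR ▸ hh)), M.P_eq_drive]
    exact hM.driver.summable_iter_sub (hcon θ) hΔ (hobs θ) hKn (hmemL θ) (hμ θ).2.1 (hinv θ)
      (hR ▸ hh : h ∈ R')
  · have := (hμ θ).1
    rw [hR] at hh ⊢
    have hae := hM.ae_P hd hN θ h hh
    have he : resolvent (M.P θ) (M.stationary θ) (ψ θ) =ᵐ[M.P θ h] M.V Q θ := by
      filter_upwards [hae] with y hy
      exact (hV θ y hy).symm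
    have h1 := hM.driver.integrable_resolvent (hcon θ) hΔ (hobs θ) hKn (hmemL θ) (hμ θ).2.1
      (hinv θ) hh
    have h2 := hM.driver.resolvent_sub_integral (hcon θ) hΔ (hobs θ) hKn (hmemL θ) (hμ θ).2.1
      (hinv θ) hh
    rw [← M.P_eq_drive] at h1 h2
    refine ⟨(h1.congr he).integrableOn, ?_⟩
    rw [Measure.restrict_eq_self_of_ae_mem hae, Measure.restrict_eq_self_of_ae_mem (hμ θ).2.1,
      ← integral_congr_ae he, hV θ h hh, h2, (hμint θ).2, hψQ θ h hh]
    ring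
  · refine ⟨mixConst M.Lker (‖D‖ * K) (1 / 2) Δ B (|L| * b) * (1 - rate M.Lker (1 / 2))⁻¹,
      fun θ h hh => ?_⟩
    have := (hμ θ).1
    rw [hV θ h (hR ▸ hh), M.P_eq_drive]
    exact hM.driver.norm_resolvent_le (hcon θ) hΔ (hobs θ) hKn (hmemL θ) (hμ θ).2.1 (hinv θ)
      (hR ▸ hh : h ∈ R')
  · refine ⟨(|L| + |L| * b * (weight M.Lker (‖D‖ * K) (1 / 2) + ‖D‖))
      * (1 - rate M.Lker (1 / 2))⁻¹, fun θ h hh h' hh' => ?_⟩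
    have := (hμ θ).1
    rw [hV θ h (hR ▸ hh), hV θ h' (hR ▸ hh'), M.P_eq_drive]
    exact hM.driver.norm_resolvent_sub_le (hcon θ) hΔ (hobs θ) hKn (hmemL θ) (hμ θ).2.1 (hinv θ)
      hL0 (norm_nonneg D) (hLip θ) (fun w _ w' _ => D.le_opNorm (w - w'))
      (hR ▸ hh : h ∈ R') (hR ▸ hh' : h' ∈ R')

theorem Model.UnifLipschitz.boundedNoiseOsc {Q : Params d N → State d dZ N → ℝ}
    (hL : M.UnifLipschitz Q) (hE : Bornology.IsBounded M.noiseSet) : M.BoundedNoiseOsc Q := by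
  obtain ⟨L, hL⟩ := hL
  obtain ⟨C, hC⟩ := hE.exists_norm_le
  refine ⟨|L| * (C + C), fun θ u v η η' hh hh' => (hL θ _ hh _ hh').trans ?_⟩
  have h1 : ‖((u, v, η) : State d dZ N) - (u, v, η')‖ ≤ C + C := by
    have h := (norm_sub_le η η').trans
      (add_le_add (hC η (M.R_eq_region ▸ hh).2.2) (hC η' (M.R_eq_region ▸ hh').2.2))
    have h0 := (norm_nonneg (η - η')).trans h
    simp only [Prod.mk_sub_mk, sub_self, Prod.norm_mk, norm_zero, sup_le_iff]
    exact ⟨h0, h0, h⟩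
  exact mul_le_mul (le_abs_self L) h1 (norm_nonneg _) (abs_nonneg L)

end Chain

/-! ### Directional derivatives of the recursion and of the loss -/

section Directional

variable {E F : Type*} [NormedAddCommGroup E] [NormedSpace ℝ E] [NormedAddCommGroup F]
  [NormedSpace ℝ F]

/-- A functional of a directional derivative is a derivative along a line. -/
theorem apply_fderiv_eq_of_hasDerivAt {H : E → F} {p e : E} (hH : DifferentiableAt ℝ H p)
    (T : F →L[ℝ] ℝ) {r : ℝ} (h : HasDerivAt (fun t : ℝ => T (H (p + t • e))) r 0) :
    T (fderiv ℝ H p e) = r := by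
  have hγ : HasDerivAt (fun t : ℝ => p + t • e) e 0 := by
    simpa using ((hasDerivAt_id (0 : ℝ)).smul_const e).const_add p
  have hd := hH.hasFDerivAt.comp_hasDerivAt_of_eq (0 : ℝ) hγ (by simp)
  exact (T.hasFDerivAt.comp_hasDerivAt (0 : ℝ) hd).unique h

theorem hasDerivAt_sum_mul {ι : Type*} [Fintype ι] (a a' c c' : ι → ℝ) :
    HasDerivAt (fun t : ℝ => ∑ j, (a j + t * a' j) * (c j + t * c' j))
      (∑ j, (a' j * c j + a j * c' j)) 0 := by
  have h : ∀ x x' : ℝ, HasDerivAt (fun t : ℝ => x + t * x') x' 0 := fun x x' => by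
    simpa using ((hasDerivAt_id (0 : ℝ)).mul_const x').const_add x
  refine HasDerivAt.fun_sum fun j _ => ?_
  simpa using (h (a j) (a' j)).fun_mul (h (c j) (c' j))

theorem differentiable_and_differentiable_deriv {g : ℝ → ℝ} (hg : ContDiff ℝ 2 g) :
    Differentiable ℝ g ∧ Differentiable ℝ (deriv g) := by
  refine ⟨hg.differentiable (by norm_num), ?_⟩
  have := hg.differentiable_iteratedDeriv 1 (by norm_num)
  rwa [iteratedDeriv_one] at this

end Directional

section Gradient

variable {d dZ N : ℕ} {M : Model d dZ N}

theorem netMap_fderiv_inl (y y' : Jet d N) (u : Input d dZ) (v v' : Hidden d N) (k : Fin N) :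
    fderiv ℝ netMap (y, u, v) (y', 0, v') (.inl k) = deriv Real.sigmoid (netPre y u v k) *
      (1 / (d : ℝ) * ∑ j, y'.1.A k j * u.1 j
        + 1 / (N : ℝ) * ∑ l, (y'.1.W k l * v.s l + y.1.W k l * v'.s l)) := by
  have hdiff := contDiff_netMap.differentiable (by norm_num) (y, u, v)
  refine apply_fderiv_eq_of_hasDerivAt hdiff
    (ContinuousLinearMap.proj (R := ℝ) (φ := fun _ : HiddenIndex d N => ℝ) (.inl k)) ?_
  have h1 := hasDerivAt_sum_mul (fun j => y.1.A k j) (fun j => y'.1.A k j) u.1 0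
  have h2 := hasDerivAt_sum_mul (fun l => y.1.W k l) (fun l => y'.1.W k l) v.s v'.s
  have h3 := (h1.const_mul (1 / (d : ℝ))).add (h2.const_mul (1 / (N : ℝ)))
  have hσ : HasDerivAt Real.sigmoid (deriv Real.sigmoid (netPre y u v k)) (netPre y u v k) :=
    differentiableAt_sigmoid.hasDerivAt
  have h4 := hσ.comp_of_eq (0 : ℝ) h3 (by simp [netPre])
  refine HasDerivAt.congr_deriv (show HasDerivAt _ _ _ from h4) ?_
  simp

/-- Half the squared residual as a function of the jet, of the value of `f` and of the memory. -/
def lossObs (p : Jet d N × ℝ × Hidden d N) : ℝ :=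
  1 / 2 * (p.2.1 - ∑ k, p.1.1.B k * p.2.2.s k - p.1.1.c) ^ 2

/-- The vector `g` as a function of the jet, of the value of `f` and of the memory. -/
def gradObs (p : Jet d N × ℝ × Hidden d N) : Params d N :=
  (fun i j => -(p.2.1 - ∑ k, p.1.1.B k * p.2.2.s k - p.1.1.c) * ∑ k, p.1.1.B k * p.2.2.sA i j k,
   fun i j => -(p.2.1 - ∑ k, p.1.1.B k * p.2.2.s k - p.1.1.c) * ∑ k, p.1.1.B k * p.2.2.sW i j k,
   fun i => -(p.2.1 - ∑ k, p.1.1.B k * p.2.2.s k - p.1.1.c) * (p.1.2.1.B i * p.2.2.s i),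
   -(p.2.1 - ∑ k, p.1.1.B k * p.2.2.s k - p.1.1.c) * p.1.2.1.c)

theorem contDiff_lossObs : ContDiff ℝ 2 (lossObs (d := d) (N := N)) := by
  unfold lossObs Params.B Params.c Hidden.s; fun_prop

theorem contDiff_gradObs : ContDiff ℝ 2 (gradObs (d := d) (N := N)) := by
  unfold gradObs Params.B Params.c Hidden.s Hidden.sA Hidden.sW; fun_prop

/-- The standard pairing of two vectors in the shape of the parameter. -/
def pairing (g τ : Params d N) : ℝ :=
  ∑ i, ∑ j, g.A i j * τ.A i j + ∑ i, ∑ j, g.W i j * τ.W i j + ∑ i, g.B i * τ.B i + g.c * τ.c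

/-- The standard pairing as a bounded bilinear map. -/
def pairingL : Params d N →L[ℝ] Params d N →L[ℝ] ℝ :=
  LinearMap.toContinuousBilinearMap <| LinearMap.mk₂ ℝ pairing
    (fun g g' τ => by
      simp only [pairing, Params.A, Params.W, Params.B, Params.c, Prod.fst_add, Prod.snd_add,
        Pi.add_apply, add_mul, Finset.sum_add_distrib]
      ring)
    (fun r g τ => by
      simp only [pairing, Params.A, Params.W, Params.B, Params.c, Prod.smul_fst, Prod.smul_snd,
        Pi.smul_apply, smul_eq_mul, mul_add, Finset.mul_sum, mul_assoc])
    (fun g τ τ' => by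
      simp only [pairing, Params.A, Params.W, Params.B, Params.c, Prod.fst_add, Prod.snd_add,
        Pi.add_apply, mul_add, Finset.sum_add_distrib]
      ring)
    (fun r g τ => by
      simp only [pairing, Params.A, Params.W, Params.B, Params.c, Prod.smul_fst, Prod.smul_snd,
        Pi.smul_apply, smul_eq_mul, mul_add, Finset.mul_sum, mul_left_comm r])

theorem pairingL_apply (g τ : Params d N) : pairingL g τ = pairing g τ := rfl

theorem lossObs_fderiv (y y' : Jet d N) (z : ℝ) (v v' : Hidden d N) :
    fderiv ℝ lossObs (y, z, v) (y', 0, v') = -(z - ∑ k, y.1.B k * v.s k - y.1.c) *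
      (∑ k, (y'.1.B k * v.s k + y.1.B k * v'.s k) + y'.1.c) := by
  have hdiff := contDiff_lossObs.differentiable (by norm_num) (y, z, v)
  refine apply_fderiv_eq_of_hasDerivAt hdiff (ContinuousLinearMap.id ℝ ℝ) ?_
  have h1 := hasDerivAt_sum_mul (fun k => y.1.B k) (fun k => y'.1.B k) v.s v'.s
  have h2 : HasDerivAt (fun t : ℝ => y.1.c + t * y'.1.c) y'.1.c 0 := by
    simpa using ((hasDerivAt_id (0 : ℝ)).mul_const y'.1.c).const_add y.1.c
  have h3 : HasDerivAt (fun t : ℝ => z + t * 0) 0 0 := by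
    simpa using ((hasDerivAt_id (0 : ℝ)).mul_const 0).const_add z
  have h4 := (((h3.sub h1).sub h2).pow 2).const_mul (1 / 2 : ℝ)
  refine HasDerivAt.congr_deriv (show HasDerivAt _ _ _ from h4) ?_
  simp
  ring

theorem Model.Assumptions.differentiable_jet₁ (hM : M.Assumptions) : Differentiable ℝ M.jet₁ := by
  obtain ⟨h1, h2⟩ := differentiable_and_differentiable_deriv hM.φ_smooth
  obtain ⟨h3, h4⟩ := differentiable_and_differentiable_deriv hM.lam_smooth
  unfold Model.jet₁ Model.jet Params.A Params.W Params.B Params.c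
  fun_prop

theorem abs_sub_le_of_deriv {g : ℝ → ℝ} {C : ℝ} (hg : Differentiable ℝ g)
    (h : ∀ x, |deriv g x| ≤ C) (x y : ℝ) : |g x - g y| ≤ C * |x - y| :=
  Convex.norm_image_sub_le_of_norm_deriv_le (fun z _ => hg z) (fun z _ => h z) convex_univ trivial
    trivial

theorem Model.Assumptions.exists_paramCurve_jet₁ (hM : M.Assumptions) {Λ : ℝ} (h0 : 0 ≤ Λ)
    (h1 : ∀ y, |M.lam y| ≤ Λ) (h2 : ∀ y, |deriv M.lam y| ≤ Λ)
    (h3 : ∀ y, |deriv (deriv M.lam) y| ≤ Λ) :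
    ∃ Cy, ParamCurve M.jet₁ (fderiv ℝ M.jet₁) (M.jetSet Λ) Cy := by
  have c1 := hM.Cφ₁_nonneg
  have c2 := hM.Cφ₂_nonneg
  set Cy := M.Cφ₁ + M.Cφ₂ + Λ with hCy
  have hC0 : 0 ≤ Cy := by positivity
  have key : ∀ {g : ℝ → ℝ} {C : ℝ}, Differentiable ℝ g → (∀ x, |deriv g x| ≤ C) → C ≤ Cy →
      ∀ {x y r : ℝ}, ‖x - y‖ ≤ r → ‖g x - g y‖ ≤ Cy * r := by
    intro g C hg hC hle x y r hr
    have hr0 := (norm_nonneg _).trans hr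
    exact (abs_sub_le_of_deriv hg hC x y).trans (mul_le_mul hle hr (abs_nonneg _) hC0)
  have hφ : ∀ {x y r : ℝ}, ‖x - y‖ ≤ r → ‖M.φ x - M.φ y‖ ≤ Cy * r :=
    key (differentiable_and_differentiable_deriv hM.φ_smooth).1 hM.φ_bound₁ (by linarith)
  have hφ' : ∀ {x y r : ℝ}, ‖x - y‖ ≤ r → ‖deriv M.φ x - deriv M.φ y‖ ≤ Cy * r :=
    key (differentiable_and_differentiable_deriv hM.φ_smooth).2 hM.φ_bound₂ (by linarith)
  have hl : ∀ {x y r : ℝ}, ‖x - y‖ ≤ r → ‖M.lam x - M.lam y‖ ≤ Cy * r :=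
    key (differentiable_and_differentiable_deriv hM.lam_smooth).1 h2 (by linarith)
  have hl' : ∀ {x y r : ℝ}, ‖x - y‖ ≤ r → ‖deriv M.lam x - deriv M.lam y‖ ≤ Cy * r :=
    key (differentiable_and_differentiable_deriv hM.lam_smooth).2 h3 (by linarith)
  refine ⟨Cy, hM.jet₁_mem h0 h1 h2, fun θ => (hM.differentiable_jet₁ θ).hasFDerivAt, hC0,
    fun θ => norm_fderiv_le_of_lip' ℝ hC0 (Filter.Eventually.of_forall fun θ' => ?_)⟩
  have hr : 0 ≤ Cy * ‖θ' - θ‖ := by positivity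
  have bA : ∀ i j, ‖θ'.A i j - θ.A i j‖ ≤ ‖θ' - θ‖ := fun i j =>
    (norm_le_pi_norm ((θ' - θ).1 i) j).trans
      ((norm_le_pi_norm (θ' - θ).1 i).trans (norm_fst_le (θ' - θ)))
  have b2 : ‖(θ' - θ).2‖ ≤ ‖θ' - θ‖ := norm_snd_le (θ' - θ)
  have b22 : ‖(θ' - θ).2.2‖ ≤ ‖θ' - θ‖ := (norm_snd_le (θ' - θ).2).trans b2
  have bW : ∀ i j, ‖θ'.W i j - θ.W i j‖ ≤ ‖θ' - θ‖ := fun i j =>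
    (norm_le_pi_norm ((θ' - θ).2.1 i) j).trans
      ((norm_le_pi_norm (θ' - θ).2.1 i).trans ((norm_fst_le (θ' - θ).2).trans b2))
  have bB : ∀ i, ‖θ'.B i - θ.B i‖ ≤ ‖θ' - θ‖ := fun i =>
    (norm_le_pi_norm (θ' - θ).2.2.1 i).trans ((norm_fst_le (θ' - θ).2.2).trans b22)
  have bc : ‖θ'.c - θ.c‖ ≤ ‖θ' - θ‖ := (norm_snd_le (θ' - θ).2.2).trans b22
  have pi1 : ∀ {n : ℕ} {f : Fin n → ℝ}, (∀ i, ‖f i‖ ≤ Cy * ‖θ' - θ‖) → ‖f‖ ≤ Cy * ‖θ' - θ‖ :=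
    fun h => (pi_norm_le_iff_of_nonneg hr).2 h
  have pi2 : ∀ {n m : ℕ} {f : Fin n → Fin m → ℝ}, (∀ i j, ‖f i j‖ ≤ Cy * ‖θ' - θ‖) →
      ‖f‖ ≤ Cy * ‖θ' - θ‖ := fun h => (pi_norm_le_iff_of_nonneg hr).2 fun i => pi1 (h i)
  refine norm_prod_le_iff.2 ⟨norm_prod_le_iff.2 ⟨pi2 fun i j => hφ (bA i j),
    norm_prod_le_iff.2 ⟨pi2 fun i j => hφ (bW i j), norm_prod_le_iff.2 ⟨pi1 fun i => hl (bB i),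
      hl bc⟩⟩⟩, norm_prod_le_iff.2 ⟨norm_prod_le_iff.2 ⟨pi2 fun i j => hφ' (bA i j),
    norm_prod_le_iff.2 ⟨pi2 fun i j => hφ' (bW i j), norm_prod_le_iff.2 ⟨pi1 fun i => hl' (bB i),
      hl' bc⟩⟩⟩, ?_⟩⟩
  have : (M.jet₁ θ' - M.jet₁ θ).2.2 = 0 := sub_self _
  rw [this, norm_zero]
  exact hr

theorem Model.Assumptions.fderiv_jet₁ (hM : M.Assumptions) (θ τ : Params d N) :
    (∀ k j, (fderiv ℝ M.jet₁ θ τ).1.A k j = (M.jet₁ θ).2.1.A k j * τ.A k j) ∧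
    (∀ k l, (fderiv ℝ M.jet₁ θ τ).1.W k l = (M.jet₁ θ).2.1.W k l * τ.W k l) ∧
    (∀ k, (fderiv ℝ M.jet₁ θ τ).1.B k = (M.jet₁ θ).2.1.B k * τ.B k) ∧
    (fderiv ℝ M.jet₁ θ τ).1.c = (M.jet₁ θ).2.1.c * τ.c := by
  have h : ∀ {g : ℝ → ℝ}, ContDiff ℝ 2 g → ∀ x x' : ℝ,
      HasDerivAt (fun t : ℝ => g (x + t * x')) (deriv g x * x') 0 := by
    intro g hg x x'
    have h1 : HasDerivAt (fun t : ℝ => x + t * x') x' 0 := by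
      simpa using ((hasDerivAt_id (0 : ℝ)).mul_const x').const_add x
    exact ((hg.differentiable (by norm_num) x).hasDerivAt).comp_of_eq (0 : ℝ) h1 (by simp)
  have hd := hM.differentiable_jet₁ θ
  have key : ∀ (T : Params d N →L[ℝ] ℝ) {r : ℝ},
      HasDerivAt (fun t : ℝ => T (M.jet₁ (θ + t • τ)).1) r 0 → T (fderiv ℝ M.jet₁ θ τ).1 = r :=
    fun T r h => apply_fderiv_eq_of_hasDerivAt hd
      (T.comp (ContinuousLinearMap.fst ℝ (Params d N) (Params d N × Params d N))) h
  refine ⟨fun k j => ?_, fun k l => ?_, fun k => ?_, ?_⟩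
  · exact key (((ContinuousLinearMap.proj (R := ℝ) (φ := fun _ : Fin d => ℝ) j).comp
      (ContinuousLinearMap.proj (R := ℝ) (φ := fun _ : Fin N => Fin d → ℝ) k)).comp
      (ContinuousLinearMap.fst ℝ _ _)) (h hM.φ_smooth (θ.A k j) (τ.A k j))
  · exact key (((ContinuousLinearMap.proj (R := ℝ) (φ := fun _ : Fin N => ℝ) l).comp
      (ContinuousLinearMap.proj (R := ℝ) (φ := fun _ : Fin N => Fin N → ℝ) k)).comp
      ((ContinuousLinearMap.fst ℝ _ _).comp (ContinuousLinearMap.snd ℝ _ _)))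
      (h hM.φ_smooth (θ.W k l) (τ.W k l))
  · exact key ((ContinuousLinearMap.proj (R := ℝ) (φ := fun _ : Fin N => ℝ) k).comp
      ((ContinuousLinearMap.fst ℝ _ _).comp ((ContinuousLinearMap.snd ℝ _ _).comp
        (ContinuousLinearMap.snd ℝ _ _)))) (h hM.lam_smooth (θ.B k) (τ.B k))
  · exact key ((ContinuousLinearMap.snd ℝ _ _).comp ((ContinuousLinearMap.snd ℝ _ _).comp
        (ContinuousLinearMap.snd ℝ _ _))) (h hM.lam_smooth θ.c τ.c)

end Gradient

/-! ### Observables that do not depend on second derivatives -/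

section FirstOrderChain

variable {d dZ N : ℕ} {M : Model d dZ N}

/-- The memory layers `v` and `v'` agree up to the first derivatives. -/
def Agree (v v' : Hidden d N) : Prop := ∀ i, level i ≤ 1 → v i = v' i

/-- `Ψ` does not depend on second derivatives. -/
def IsFirstOrder {F : Type*} (Ψ : Jet d N × ℝ × Hidden d N → F) : Prop :=
  ∀ y y' z v v', y.1 = y'.1 → y.2.1 = y'.2.1 → Agree v v' → Ψ (y, z, v) = Ψ (y', z, v')

theorem Agree.s {v v' : Hidden d N} (h : Agree v v') : v.s = v'.s :=
  funext fun k => h (.inl k) (by simp [level])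

theorem Agree.sA {v v' : Hidden d N} (h : Agree v v') : v.sA = v'.sA :=
  funext fun i => funext fun j => funext fun k => h (.inr (.inl (i, j, k))) (by simp [level])

theorem Agree.sW {v v' : Hidden d N} (h : Agree v v') : v.sW = v'.sW :=
  funext fun i => funext fun j => funext fun k => h (.inr (.inr (.inl (i, j, k)))) (by simp [level])

theorem Agree.netF {y y' : Jet d N} (h1 : y.1 = y'.1) (h2 : y.2.1 = y'.2.1) {v v' : Hidden d N}
    (h : Agree v v') (u : Input d dZ) : Agree (netF y u v) (netF y' u v') := by
  have hp : netPre y u v = netPre y' u v' := by unfold netPre; rw [h1, h.s]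
  have hA : netPreA y u v = netPreA y' u v' := by unfold netPreA; rw [h1, h2, h.sA]
  have hW : netPreW y v = netPreW y' v' := by unfold netPreW; rw [h1, h2, h.s, h.sW]
  rintro (k | ⟨i, j, k⟩ | ⟨i, j, k⟩ | i) hi
  · simp only [RNN.netF, hp]
  · simp only [RNN.netF, hp, hA]
  · simp only [RNN.netF, hp, hW]
  · simp [level] at hi

theorem isFirstOrder_lossObs : IsFirstOrder (lossObs (d := d) (N := N)) := by
  intro y y' z v v' h1 _ h
  unfold lossObs
  simp only [h1, h.s]

theorem isFirstOrder_gradObs : IsFirstOrder (gradObs (d := d) (N := N)) := by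
  intro y y' z v v' h1 h2 h
  unfold gradObs
  simp only [h1, h2, h.s, h.sA, h.sW]

/-- The network as a parametrised system, driven by the differentiable curve `jet₁`. -/
structure System (M : Model d dZ N) (Λ : ℝ) (D : Hidden d N →L[ℝ] Hidden d N) (b K Cy : ℝ) :
    Prop where
  param : ParamSystem (netMap (dZ := dZ)) (M.jetSet Λ) M.box D b (1 / 2)
  unif : UnifBound (netMap (dZ := dZ)) (M.jetSet Λ) (Metric.closedBall 0 1) M.box K
  curve : ParamCurve M.jet₁ (fderiv ℝ M.jet₁) (M.jetSet Λ) Cy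
  jet_mem : ∀ θ, M.jet θ ∈ M.jetSet Λ

theorem exists_system (hM : M.Assumptions) (hd : 0 < d) (hN : 0 < N) :
    ∃ Λ D b K Cy, System M Λ D b K Cy := by
  obtain ⟨Λ, h0, h1, h2, h3⟩ := hM.exists_lam_bound
  obtain ⟨D, b, K, hP, hK⟩ := exists_paramSystem_netMap hM hd hN Λ
  obtain ⟨Cy, hy⟩ := hM.exists_paramCurve_jet₁ h0 h1 h2 h3
  exact ⟨Λ, D, b, K, Cy, hP, hK, hy, hM.jet_mem h0 h1 h2⟩

variable {Λ b K Cy : ℝ} {D : Hidden d N →L[ℝ] Hidden d N} (hS : System M Λ D b K Cy)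
  (hM : M.Assumptions) (hd : 0 < d) (hN : 0 < N)
  {F : Type*} [NormedAddCommGroup F] [NormedSpace ℝ F] [FiniteDimensional ℝ F]
  {Ψ : Jet d N × ℝ × Hidden d N → F} {K' : ℝ}

include hM in
theorem exists_obsData (hΨ : ContDiff ℝ 2 Ψ) : ∃ K', ObsData M.f M.Lf Ψ (M.jetSet Λ) M.box K' := by
  have h1 := isCompact_closedBall (0 : ℝ) M.Lf
  have h2 := convex_closedBall (0 : ℝ) M.Lf
  obtain ⟨K', hK'⟩ := exists_unifBound hΨ (M.isCompact_jetSet Λ) (M.convex_jetSet Λ) h1 h2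
    (isCompact_Icc (a := M.lower) (b := M.upper)) (convex_Icc _ _)
  exact ⟨K', hM.f_lipschitz, hM.f_bounded, hΨ, hK'⟩

variable (hO : ObsData M.f M.Lf Ψ (M.jetSet Λ) M.box K')

include hS hM hO

/-- Observables of first order do not see that `jet₁` lacks the second derivatives. -/
theorem meanObs_jet₁_eq (hΨ : IsFirstOrder Ψ) (θ : Params d N) (t : ℕ) {h : State d dZ N}
    (hh : h ∈ region (Input d dZ) M.box M.noiseSet) :
    meanObs M.ker M.noise hS.param.smooth M.f Ψ t h (M.jet₁ θ)
      = iter (M.P θ) t (obs M.f Ψ (M.jet θ)) h := by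
  have := FiniteDimensional.complete ℝ F
  have hbox : MeasurableSet M.box := isCompact_Icc.measurableSet
  have hp := hS.param.preserves _ (hS.curve.mem θ)
  have hp' := hS.param.preserves _ (hS.jet_mem θ)
  have ho := hO.observable (E := M.noiseSet) (U := Input d dZ) (hS.curve.mem θ)
  have ho' := hO.observable (E := M.noiseSet) (U := Input d dZ) (hS.jet_mem θ)
  rw [M.P_eq_drive, ← sub_eq_zero, ← norm_le_zero_iff]
  exact hM.driver.norm_iter_sub_le_of_rel (hG := measurable_netMap (M.jet₁ θ))
    (hG' := measurable_netMap (M.jet θ)) hbox hp hbox hp'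
    (Rel := fun v v' => v ∈ M.box ∧ v' ∈ M.box ∧ Agree v v')
    (fun u v v' hu hv => ⟨hp u hu v hv.1, hp' u hu v' hv.2.1,
      hv.2.2.netF (y := M.jet₁ θ) (y' := M.jet θ) rfl rfl u⟩)
    (fun v v' hv => ⟨hv.1, hv.2.1⟩) ho ho'
    (fun u v v' η hu hv hη => by
      rw [norm_le_zero_iff, sub_eq_zero]
      exact hΨ _ _ _ _ _ rfl rfl hv.2.2) t h.1 h.2.1 h.2.1 h.2.2 hh.1
    ⟨hh.2.1, hh.2.1, fun _ _ => rfl⟩ hh.2.2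

include hd hN

theorem tendsto_meanObs (hΨ : IsFirstOrder Ψ) (θ : Params d N) {h : State d dZ N}
    (hh : h ∈ region (Input d dZ) M.box M.noiseSet) :
    Filter.Tendsto (fun t => meanObs M.ker M.noise hS.param.smooth M.f Ψ t h (M.jet₁ θ))
      Filter.atTop (nhds (∫ y, obs M.f Ψ (M.jet θ) y ∂M.stationary θ)) := by
  have := FiniteDimensional.complete ℝ F
  obtain ⟨Δ, hΔ⟩ := hS.param.exists_diam
  have hμ := hM.stationary_spec hd hN θ
  have := hμ.1
  have hinv := M.P_eq_drive θ ▸ hμ.2.2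
  have hb := hS.param.one_le
  have hO0 := hO.nonneg
  have hK0 := hO.unif.nonneg
  have hcon := hS.param.contracts hS.unif (hS.jet_mem θ)
  simp only [meanObs_jet₁_eq hS hM hO hΨ θ _ hh, M.P_eq_drive]
  exact hM.driver.tendsto_iter hcon hΔ (hO.observable (hS.jet_mem θ)) (by positivity)
    (hO.memLipschitz hS.param (hS.jet_mem θ)) hh hμ.2.1 hinv

/-- Bounds and derivatives in the parameter of stationary expectations, and of the solutions of
the Poisson equation, for observables of first order. -/
theorem exists_derivatives (hΨ : IsFirstOrder Ψ) :
    ∃ (L' : Params d N → Params d N →L[ℝ] F) (C : ℝ),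
      (∀ θ, HasFDerivAt (fun θ => ∫ y, obs M.f Ψ (M.jet θ) y ∂M.stationary θ) (L' θ) θ) ∧
      (∀ θ, ‖L' θ‖ ≤ C) ∧
      (∀ θ, ∀ h ∈ region (Input d dZ) M.box M.noiseSet, Filter.Tendsto
        (fun t => meanTangentObs M.ker M.noise hS.param.smooth M.f Ψ t h (M.jet₁ θ)
          (fderiv ℝ M.jet₁ θ)) Filter.atTop (nhds (L' θ))) ∧
      ∀ θ, ∀ h ∈ region (Input d dZ) M.box M.noiseSet,
        ‖resolvent (M.P θ) (M.stationary θ) (obs M.f Ψ (M.jet θ)) h‖ ≤ C ∧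
        ∃ r' : Params d N →L[ℝ] F, ‖r'‖ ≤ C ∧
          HasFDerivAt (fun θ => resolvent (M.P θ) (M.stationary θ) (obs M.f Ψ (M.jet θ)) h)
            r' θ := by
  have := FiniteDimensional.complete ℝ F
  have := FiniteDimensional.proper_real (Hidden d N)
  obtain ⟨Δ, hΔ⟩ := hS.param.exists_diam
  have hb := hS.param.one_le
  have hO0 := hO.nonneg
  have hK0 := hO.unif.nonneg
  obtain ⟨m, r, hr0, hr1, hmr⟩ :=
    hM.driver.exists_norm_meanTangentObs_sub_le hS.param hS.unif hS.curve hO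
  obtain ⟨η₀, hη₀⟩ := hM.noiseSet_nonempty
  have hd' := fun h (hh : h ∈ region (Input d dZ) M.box M.noiseSet) t θ =>
    hM.driver.hasFDerivAt_meanObs hS.param hS.unif hS.curve hO t hh θ
  have hlim := fun h (hh : h ∈ region (Input d dZ) M.box M.noiseSet) θ =>
    tendsto_meanObs hS hM hd hN hO hΨ θ hh
  have hex := fun h (hh : h ∈ region (Input d dZ) M.box M.noiseSet) =>
    exists_hasFDerivAt_limit hr0 hr1 (hd' h hh) (fun t θ => hmr θ h hh t) (hlim h hh)
  have hh₀ : ((0, 0, η₀) : State d dZ N) ∈ region (Input d dZ) M.box M.noiseSet :=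
    ⟨by simp, hM.zero_mem_box hd hN, hη₀⟩
  obtain ⟨L', hL1, hL2, hL3⟩ := hex _ hh₀
  -- the limit does not depend on the initial state, as derivatives are unique
  have hall : ∀ h ∈ region (Input d dZ) M.box M.noiseSet,
      (∀ θ, Filter.Tendsto (fun t => meanTangentObs M.ker M.noise hS.param.smooth M.f Ψ t h
        (M.jet₁ θ) (fderiv ℝ M.jet₁ θ)) Filter.atTop (nhds (L' θ))) ∧
      ∀ t θ, ‖meanTangentObs M.ker M.noise hS.param.smooth M.f Ψ t h (M.jet₁ θ)
        (fderiv ℝ M.jet₁ θ) - L' θ‖ ≤ m / (1 - r) * r ^ t := by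
    intro h hh
    obtain ⟨L'', h1, h2, h3⟩ := hex h hh
    have : L'' = L' := funext fun θ => (h2 θ).unique (hL2 θ)
    rw [this] at h1 h3
    exact ⟨h1, h3⟩
  have hBnd : ∀ θ, ‖L' θ‖ ≤ m / (1 - r) + K' * (Cy + b * tangentBound D (1 / 2) Cy K) := by
    intro θ
    have h1 := hL3 0 θ
    have h2 : ‖meanTangentObs M.ker M.noise hS.param.smooth M.f Ψ 0 (0, 0, η₀) (M.jet₁ θ)
        (fderiv ℝ M.jet₁ θ)‖ ≤ K' * (Cy + b * tangentBound D (1 / 2) Cy K) := by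
      have ho := hO.observable_tangentObs (E := M.noiseSet) (U := Input d dZ) hS.param
        (K := K) (hS.curve.mem θ) (hS.curve.bound θ)
      refine (hM.driver.observable_iter
        (hG := measurable_tangentMap hS.param.smooth (M.jet₁ θ) (fderiv ℝ M.jet₁ θ))
        (isClosed_tangentSet hS.param.compact.isClosed _ _ _).measurableSet
        (hS.param.preserves_tangentMap hS.unif (hS.curve.mem θ) (hS.curve.bound θ)) ho 0).bound _ ?_
      exact ⟨by simp, mem_tangentSet_zero hS.param.rate_lt_one hS.curve.nonneg hS.unif.nonneg
        (hM.zero_mem_box hd hN), hη₀⟩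
    rw [pow_zero, mul_one, norm_sub_rev] at h1
    have h3 := norm_le_norm_add_norm_sub' (L' θ) (meanTangentObs M.ker M.noise hS.param.smooth M.f Ψ
      0 (0, 0, η₀) (M.jet₁ θ) (fderiv ℝ M.jet₁ θ))
    linarith
  have hK'n : 0 ≤ K' * (M.Lf + b) := by positivity
  set C₁ := m / (1 - r) + K' * (Cy + b * tangentBound D (1 / 2) Cy K)
  set C₂ := m / (1 - r) / (1 - r)
  set C₃ := mixConst M.Lker (‖D‖ * K) (1 / 2) Δ K' (K' * (M.Lf + b))
    * (1 - rate M.Lker (1 / 2))⁻¹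
  refine ⟨L', max C₁ (max C₂ C₃), hL2, fun θ => (hBnd θ).trans (le_max_left _ _),
    fun θ h hh => (hall h hh).1 θ, fun θ h hh => ?_⟩
  have hcon := fun θ => hS.param.contracts hS.unif (hS.jet_mem θ)
  have hμ := hM.stationary_spec hd hN
  have hinv := fun θ => M.P_eq_drive θ ▸ (hμ θ).2.2
  have hres : ∀ θ, resolvent (M.P θ) (M.stationary θ) (obs M.f Ψ (M.jet θ)) h
      = ∑' t, (meanObs M.ker M.noise hS.param.smooth M.f Ψ t h (M.jet₁ θ)
          - ∫ y, obs M.f Ψ (M.jet θ) y ∂M.stationary θ) := fun θ =>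
    tsum_congr fun t => by rw [meanObs_jet₁_eq hS hM hO hΨ θ t hh]
  have hsum : ∀ θ, Summable fun t => meanObs M.ker M.noise hS.param.smooth M.f Ψ t h (M.jet₁ θ)
      - ∫ y, obs M.f Ψ (M.jet θ) y ∂M.stationary θ := by
    intro θ
    have := (hμ θ).1
    simp only [meanObs_jet₁_eq hS hM hO hΨ θ _ hh, M.P_eq_drive]
    exact hM.driver.summable_iter_sub (hcon θ) hΔ (hO.observable (hS.jet_mem θ)) hK'n
      (hO.memLipschitz hS.param (hS.jet_mem θ)) (hμ θ).2.1 (hinv θ) hh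
  have hder := hasFDerivAt_tsum_sub_limit hr0 hr1 (hd' h hh) hL2 (hall h hh).2 hsum θ
  refine ⟨?_, _, hder.2.trans ((le_max_left _ _).trans (le_max_right _ _)), ?_⟩
  · refine le_trans ?_ ((le_max_right _ _).trans (le_max_right _ _))
    have := (hμ θ).1
    rw [M.P_eq_drive]
    exact hM.driver.norm_resolvent_le (hcon θ) hΔ (hO.observable (hS.jet_mem θ)) hK'n
      (hO.memLipschitz hS.param (hS.jet_mem θ)) (hμ θ).2.1 (hinv θ) hh
  · rw [funext hres]
    exact hder.1

end FirstOrderChain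

/-! ### The network stores its derivative in the parameter -/

section GradientIdentity

variable {d dZ N : ℕ} {M : Model d dZ N}

/-- The derivative `J` of the memory in the parameter is stored in the entries of first order of
`v`. -/
def StoresDerivative (J : Params d N →L[ℝ] Hidden d N) (v : Hidden d N) : Prop :=
  ∀ τ k, J τ (.inl k) = ∑ i, ∑ j, v.sA i j k * τ.A i j + ∑ i, ∑ j, v.sW i j k * τ.W i j

theorem sum_average_mul {ι κ : Type*} [Fintype ι] [Fintype κ] (c : ℝ) (w : Fin N → ℝ)
    (s : ι → κ → Fin N → ℝ) (τ : ι → κ → ℝ) :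
    ∑ i, ∑ j, c * (∑ l, w l * s i j l) * τ i j = c * ∑ l, w l * ∑ i, ∑ j, s i j l * τ i j := by
  simp only [Finset.mul_sum, Finset.sum_mul]
  have h : ∀ i, ∑ j, ∑ l, c * (w l * s i j l) * τ i j = ∑ l, ∑ j, c * (w l * s i j l) * τ i j :=
    fun i => Finset.sum_comm
  simp only [h]
  rw [Finset.sum_comm]
  refine Finset.sum_congr rfl fun l _ => Finset.sum_congr rfl fun i _ =>
    Finset.sum_congr rfl fun j _ => by ring

theorem sum_ite_mul {n m : ℕ} (k : Fin n) (f : Fin n → Fin m → ℝ) :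
    ∑ i, ∑ j, (if i = k then 1 else 0) * f i j = ∑ j, f k j := by
  rw [Finset.sum_eq_single k]
  · simp
  · intro i _ hi; simp [hi]
  · simp

/-- The recursion of the entries of first order is the recursion of the derivative. -/
theorem StoresDerivative.tangentMap (hM : M.Assumptions) {J : Params d N →L[ℝ] Hidden d N}
    {v : Hidden d N} (h : StoresDerivative J v) (θ : Params d N) (u : Input d dZ) :
    StoresDerivative (tangent netMap (M.jet₁ θ) (fderiv ℝ M.jet₁ θ) u v J)
      (netMap (M.jet₁ θ, u, v)) := by
  intro τ k
  obtain ⟨h1, h2, -, -⟩ := hM.fderiv_jet₁ θ τ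
  rw [tangent_apply, netMap_fderiv_inl]
  have hJ : (J τ).s = fun l => ∑ i, ∑ j, v.sA i j l * τ.A i j + ∑ i, ∑ j, v.sW i j l * τ.W i j :=
    funext fun l => h τ l
  simp only [h1, h2, hJ]
  generalize M.jet₁ θ = y
  have eA : ∀ i j, (netMap (y, u, v)).sA i j k = deriv Real.sigmoid (netPre y u v k) *
      ((if i = k then 1 else 0) * (1 / (d : ℝ) * y.2.1.A i j * u.1 j)
        + 1 / (N : ℝ) * ∑ l, y.1.W k l * v.sA i j l) := by
    intro i j
    show deriv Real.sigmoid (netPre y u v k) * netPreA y u v i j k = _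
    unfold netPreA; ring
  have eW : ∀ i j, (netMap (y, u, v)).sW i j k = deriv Real.sigmoid (netPre y u v k) *
      ((if i = k then 1 else 0) * (1 / (N : ℝ) * y.2.1.W i j * v.s j)
        + 1 / (N : ℝ) * ∑ l, y.1.W k l * v.sW i j l) := by
    intro i j
    show deriv Real.sigmoid (netPre y u v k) * netPreW y v i j k = _
    unfold netPreW; ring
  have sA : ∑ i, ∑ j, (netMap (y, u, v)).sA i j k * τ.A i j = deriv Real.sigmoid (netPre y u v k) *
      (∑ j, 1 / (d : ℝ) * y.2.1.A k j * u.1 j * τ.A k j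
        + 1 / (N : ℝ) * ∑ l, y.1.W k l * ∑ i, ∑ j, v.sA i j l * τ.A i j) := by
    rw [← sum_average_mul, ← sum_ite_mul k fun i j => 1 / (d : ℝ) * y.2.1.A i j * u.1 j * τ.A i j,
      ← Finset.sum_add_distrib, Finset.mul_sum]
    refine Finset.sum_congr rfl fun i _ => ?_
    rw [← Finset.sum_add_distrib, Finset.mul_sum]
    refine Finset.sum_congr rfl fun j _ => ?_
    rw [eA]; ring
  have sW : ∑ i, ∑ j, (netMap (y, u, v)).sW i j k * τ.W i j = deriv Real.sigmoid (netPre y u v k) *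
      (∑ j, 1 / (N : ℝ) * y.2.1.W k j * v.s j * τ.W k j
        + 1 / (N : ℝ) * ∑ l, y.1.W k l * ∑ i, ∑ j, v.sW i j l * τ.W i j) := by
    rw [← sum_average_mul, ← sum_ite_mul k fun i j => 1 / (N : ℝ) * y.2.1.W i j * v.s j * τ.W i j,
      ← Finset.sum_add_distrib, Finset.mul_sum]
    refine Finset.sum_congr rfl fun i _ => ?_
    rw [← Finset.sum_add_distrib, Finset.mul_sum]
    refine Finset.sum_congr rfl fun j _ => ?_
    rw [eW]; ring
  rw [sA, sW, ← mul_add]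
  congr 1
  simp only [mul_add, Finset.sum_add_distrib, Finset.mul_sum]
  have r1 : ∀ j, 1 / (d : ℝ) * (y.2.1.A k j * τ.A k j * u.1 j)
      = 1 / (d : ℝ) * y.2.1.A k j * u.1 j * τ.A k j := fun j => by ring
  have r2 : ∀ j, 1 / (N : ℝ) * (y.2.1.W k j * τ.W k j * v.s j)
      = 1 / (N : ℝ) * y.2.1.W k j * v.s j * τ.W k j := fun j => by ring
  simp only [r1, r2]
  ring

/-- If the derivative of the memory is stored in the memory then the derivative of half the squared
residual is given by the vector `g`. -/
theorem StoresDerivative.tangent_lossObs (hM : M.Assumptions) {J : Params d N →L[ℝ] Hidden d N}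
    {v : Hidden d N} (h : StoresDerivative J v) (θ : Params d N) (z : ℝ) :
    tangent lossObs (M.jet₁ θ) (fderiv ℝ M.jet₁ θ) z v J
      = pairingL (gradObs (M.jet₁ θ, z, v)) := by
  refine ContinuousLinearMap.ext fun τ => ?_
  obtain ⟨-, -, h3, h4⟩ := hM.fderiv_jet₁ θ τ
  rw [tangent_apply, lossObs_fderiv, pairingL_apply]
  have hJ : (J τ).s = fun l => ∑ i, ∑ j, v.sA i j l * τ.A i j + ∑ i, ∑ j, v.sW i j l * τ.W i j :=
    funext fun l => h τ l
  simp only [h3, h4, hJ]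
  generalize M.jet₁ θ = y
  have hA := sum_average_mul (-(z - ∑ k, y.1.B k * v.s k - y.1.c)) y.1.B v.sA τ.A
  have hW := sum_average_mul (-(z - ∑ k, y.1.B k * v.s k - y.1.c)) y.1.B v.sW τ.W
  have hp : pairing (gradObs (y, z, v)) τ =
      ∑ i, ∑ j, -(z - ∑ k, y.1.B k * v.s k - y.1.c) * (∑ k, y.1.B k * v.sA i j k) * τ.A i j
      + ∑ i, ∑ j, -(z - ∑ k, y.1.B k * v.s k - y.1.c) * (∑ k, y.1.B k * v.sW i j k) * τ.W i j
      + ∑ i, -(z - ∑ k, y.1.B k * v.s k - y.1.c) * (y.2.1.B i * v.s i) * τ.B i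
      + -(z - ∑ k, y.1.B k * v.s k - y.1.c) * y.2.1.c * τ.c := rfl
  rw [hp, hA, hW]
  generalize -(z - ∑ k, y.1.B k * v.s k - y.1.c) = ρ
  have hB : ∑ i, ρ * (y.2.1.B i * v.s i) * τ.B i = ρ * ∑ i, y.2.1.B i * τ.B i * v.s i := by
    rw [Finset.mul_sum]
    exact Finset.sum_congr rfl fun i _ => by ring
  rw [hB]
  simp only [mul_add, Finset.sum_add_distrib]
  ring

variable {Λ b K Cy : ℝ} {D : Hidden d N →L[ℝ] Hidden d N} (hS : System M Λ D b K Cy)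
  (hM : M.Assumptions) (hd : 0 < d) (hN : 0 < N) {K₀ K₁ : ℝ}
  (hO₀ : ObsData M.f M.Lf lossObs (M.jetSet Λ) M.box K₀)
  (hO₁ : ObsData M.f M.Lf gradObs (M.jetSet Λ) M.box K₁)

include hS hM hd hN hO₀ hO₁

/-- Started from the zero memory, the chain computes the derivative of the expected loss. -/
theorem meanTangentObs_lossObs (θ : Params d N) (t : ℕ) {η : ℝ} (hη : η ∈ M.noiseSet) :
    meanTangentObs M.ker M.noise hS.param.smooth M.f lossObs t ((0, 0, η) : State d dZ N)
        (M.jet₁ θ) (fderiv ℝ M.jet₁ θ)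
      = pairingL (meanObs M.ker M.noise hS.param.smooth M.f gradObs t (0, 0, η) (M.jet₁ θ)) := by
  have hP := hS.param
  have hy := hS.curve
  have hbox : MeasurableSet M.box := isCompact_Icc.measurableSet
  have hpres := hP.preserves_tangentMap hS.unif (hy.mem θ) (hy.bound θ)
  have ho := hO₀.observable_tangentObs (E := M.noiseSet) (U := Input d dZ) hP
    (K := K) (hy.mem θ) (hy.bound θ)
  have ho₁ := hO₁.observable (E := M.noiseSet) (U := Input d dZ) (hy.mem θ)
  have ho' : Observable (region (Input d dZ) M.box M.noiseSet)
      (fun h => pairingL (obs M.f gradObs (M.jet₁ θ) h)) (‖pairingL (d := d) (N := N)‖ * K₁) :=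
    ⟨pairingL.continuous.comp_stronglyMeasurable ho₁.meas,
      fun h hh => pairingL.le_opNorm_of_le (ho₁.bound h hh)⟩
  have h0 : ((0, 0) : Hidden d N × (Params d N →L[ℝ] Hidden d N))
      ∈ tangentSet (Params d N) M.box D (1 / 2) Cy K :=
    mem_tangentSet_zero hP.rate_lt_one hy.nonneg hS.unif.nonneg (hM.zero_mem_box hd hN)
  have key := hM.driver.norm_iter_sub_le_of_rel
    (hG := measurable_tangentMap hP.smooth (M.jet₁ θ) (fderiv ℝ M.jet₁ θ))
    (hG' := measurable_netMap (M.jet₁ θ))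
    (isClosed_tangentSet hP.compact.isClosed _ _ _).measurableSet hpres hbox
    (hP.preserves _ (hy.mem θ))
    (Rel := fun p v => p ∈ tangentSet (Params d N) M.box D (1 / 2) Cy K ∧ p.1 = v ∧
      StoresDerivative p.2 v) (ε := 0)
    (fun u p v hu hp => ⟨hpres u hu p hp.1, by rw [← hp.2.1]; rfl, by
      have := hp.2.2.tangentMap hM θ u
      rw [← hp.2.1] at this ⊢
      exact this⟩)
    (fun p v hp => ⟨hp.1, hp.2.1 ▸ hp.1.1⟩) ho ho'
    (fun u p v η hu hp hη => by
      rw [norm_le_zero_iff, sub_eq_zero]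
      have := hp.2.2.tangent_lossObs hM θ (M.f (u, η))
      rw [← hp.2.1] at this ⊢
      exact this) t 0 (0, 0) 0 η (by simp)
    ⟨h0, rfl, fun τ k => by simp [Hidden.sA, Hidden.sW]⟩ hη
  have h1 := sub_eq_zero.1 (norm_le_zero_iff.1 key)
  refine h1.trans ?_
  have hmk := hM.driver.isMarkovKernel_drive
    (G := fun u v => netMap (M.jet₁ θ, u, v)) (hG := measurable_netMap (M.jet₁ θ))
  have hae := ae_pow_mem (measurableSet_region hbox hM.noiseSet_meas)
    (hM.driver.ae_drive_region
      (G := fun u v => netMap (M.jet₁ θ, u, v)) (hG := measurable_netMap (M.jet₁ θ)) hbox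
      (hP.preserves _ (hy.mem θ))) t (h := (0, 0, η)) ⟨by simp, hM.zero_mem_box hd hN, hη⟩
  exact pairingL.integral_comp_comm (ho₁.integrable hae)

end GradientIdentity

/-! ### The gradient of the loss and the case of its pairing with `g` -/

section Loss

variable {d dZ N : ℕ} {M : Model d dZ N}

/-- The stationary expectation of the vector `g`. -/
def Model.meanGrad (M : Model d dZ N) (θ : Params d N) : Params d N :=
  ∫ y, obs M.f gradObs (M.jet θ) y ∂M.stationary θ

/-- The solution of the Poisson equation for the vector `g`. -/
def Model.gradResolvent (M : Model d dZ N) (θ : Params d N) (h : State d dZ N) : Params d N :=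
  resolvent (M.P θ) (M.stationary θ) (obs M.f gradObs (M.jet θ)) h

variable (hM : M.Assumptions) (hd : 0 < d) (hN : 0 < N)

include hM hd hN

theorem loss_eq (θ : Params d N) :
    M.loss θ = ∫ y, obs M.f lossObs (M.jet θ) y ∂M.stationary θ := by
  unfold Model.loss
  rw [M.R_eq_region, Measure.restrict_eq_self_of_ae_mem (hM.stationary_spec hd hN θ).2.1]
  rfl

/-- The gradient of the loss is the stationary expectation of `g`: both sides are limits of
expectations from the zero memory, where they agree at all times. -/
theorem hasFDerivAt_loss (θ : Params d N) :
    HasFDerivAt M.loss (pairingL (M.meanGrad θ)) θ := by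
  obtain ⟨Λ, D, b, K, Cy, hS⟩ := exists_system hM hd hN
  obtain ⟨K₀, hO₀⟩ := exists_obsData hM (Λ := Λ) contDiff_lossObs
  obtain ⟨K₁, hO₁⟩ := exists_obsData hM (Λ := Λ) contDiff_gradObs
  obtain ⟨L', -, hL, -, hlim, -⟩ := exists_derivatives hS hM hd hN hO₀ isFirstOrder_lossObs
  obtain ⟨η, hη⟩ := hM.noiseSet_nonempty
  have hh : ((0, 0, η) : State d dZ N) ∈ region (Input d dZ) M.box M.noiseSet :=
    ⟨by simp, hM.zero_mem_box hd hN, hη⟩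
  have h1 := hlim θ _ hh
  have h2 := (pairingL.continuous.tendsto _).comp
    (tendsto_meanObs hS hM hd hN hO₁ isFirstOrder_gradObs θ hh)
  have h3 : L' θ = pairingL (M.meanGrad θ) := by
    refine tendsto_nhds_unique h1 (h2.congr fun t => ?_)
    exact (meanTangentObs_lossObs hS hM hd hN hO₀ hO₁ θ t hη).symm
  rw [← h3, funext (loss_eq hM hd hN)]
  exact hL θ

theorem gradQ_eq (θ : Params d N) (h : State d dZ N) :
    M.gradQ θ h = pairingL (M.meanGrad θ) (obs M.f gradObs (M.jet θ) h) := by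
  unfold Model.gradQ
  rw [(hasFDerivAt_loss hM hd hN θ).fderiv]
  rfl

/-- The Poisson equation is linear: the solution for `∇L^⊤ g` is `∇L^⊤` applied to the
solution for `g`. -/
theorem V_gradQ_eq (θ : Params d N) {h : State d dZ N}
    (hh : h ∈ region (Input d dZ) M.box M.noiseSet) :
    M.V M.gradQ θ h = pairingL (M.meanGrad θ) (M.gradResolvent θ h) := by
  obtain ⟨Λ, D, b, K, Cy, hS⟩ := exists_system hM hd hN
  obtain ⟨K', hO⟩ := exists_obsData hM (Λ := Λ) contDiff_gradObs
  obtain ⟨Δ, hΔ⟩ := hS.param.exists_diam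
  have hb := hS.param.one_le
  have hO0 := hO.nonneg
  have hK0 := hO.unif.nonneg
  have hμ := hM.stationary_spec hd hN θ
  have := hμ.1
  have := hM.isMarkovKernel_P θ
  have hobs := hO.observable (E := M.noiseSet) (U := Input d dZ) (hS.jet_mem θ)
  have hsum : Summable fun t => iter (M.P θ) t (obs M.f gradObs (M.jet θ)) h
      - ∫ y, obs M.f gradObs (M.jet θ) y ∂M.stationary θ := by
    have hinv := M.P_eq_drive θ ▸ hμ.2.2
    have hcon := hS.param.contracts hS.unif (hS.jet_mem θ)
    rw [M.P_eq_drive]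
    exact hM.driver.summable_iter_sub hcon hΔ hobs (by positivity)
      (hO.memLipschitz hS.param (hS.jet_mem θ)) hμ.2.1 hinv hh
  rw [hM.V_eq_resolvent hd hN _ _ hh]
  unfold Model.gradResolvent resolvent
  rw [(pairingL (M.meanGrad θ)).map_tsum hsum]
  refine tsum_congr fun t => ?_
  rw [map_sub]
  unfold iter
  rw [← (pairingL (M.meanGrad θ)).integral_comp_comm (hobs.integrable hμ.2.1),
    ← (pairingL (M.meanGrad θ)).integral_comp_comm
      (hobs.integrable (hM.ae_P_pow hd hN θ t hh))]
  simp only [gradQ_eq hM hd hN θ]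

theorem unifLipschitz_and_boundedNoiseOsc_gradQ :
    M.UnifLipschitz M.gradQ ∧ M.BoundedNoiseOsc M.gradQ := by
  obtain ⟨Λ, D, b, K, Cy, hS⟩ := exists_system hM hd hN
  obtain ⟨K', hO⟩ := exists_obsData hM (Λ := Λ) contDiff_gradObs
  have hO0 := hO.nonneg
  have hK0 := hO.unif.nonneg
  have hobs := fun θ => hO.observable (E := M.noiseSet) (U := Input d dZ) (hS.jet_mem θ)
  have hmean : ∀ θ, ‖pairingL (M.meanGrad θ)‖ ≤ ‖pairingL (d := d) (N := N)‖ * K' := by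
    intro θ
    have hμ := hM.stationary_spec hd hN θ
    have := hμ.1
    exact pairingL.le_opNorm_of_le ((hobs θ).norm_integral_le hμ.2.1)
  set C := ‖pairingL (d := d) (N := N)‖ * K'
  have hsub : ∀ θ h h', |M.gradQ θ h - M.gradQ θ h'|
      ≤ C * ‖obs M.f gradObs (M.jet θ) h - obs M.f gradObs (M.jet θ) h'‖ := by
    intro θ h h'
    rw [gradQ_eq hM hd hN, gradQ_eq hM hd hN, ← map_sub]
    exact (pairingL (M.meanGrad θ)).le_of_opNorm_le (hmean θ) _
  have hC : 0 ≤ C := by positivity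
  constructor
  · refine ⟨C * (K' * (M.Lf + 1)), fun θ h hh h' hh' => (hsub θ h h').trans ?_⟩
    rw [M.R_eq_region] at hh hh'
    rw [mul_assoc C]
    refine mul_le_mul_of_nonneg_left ?_ hC
    refine (hO.unif.lip _ (hS.jet_mem θ) _ (hO.mem _) _ hh'.2.1 _ (hS.jet_mem θ) _ (hO.mem _) _
      hh.2.1).trans ?_
    rw [mul_assoc]
    refine mul_le_mul_of_nonneg_left ?_ hK0
    have h1 : ‖M.f (h.1, h.2.2) - M.f (h'.1, h'.2.2)‖ ≤ M.Lf * ‖h - h'‖ := by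
      refine (hM.f_lipschitz _ _).trans (mul_le_mul_of_nonneg_left ?_ hO0)
      exact max_le (norm_fst_le (h - h')) ((norm_snd_le (h - h').2).trans (norm_snd_le (h - h')))
    have h2 : ‖h.2.1 - h'.2.1‖ ≤ ‖h - h'‖ :=
      (norm_fst_le (h - h').2).trans (norm_snd_le (h - h'))
    rw [sub_self, norm_zero]
    linarith
  · refine ⟨C * (K' + K'), fun θ u v η η' hh hh' => (hsub θ _ _).trans ?_⟩
    rw [M.R_eq_region] at hh hh'
    exact mul_le_mul_of_nonneg_left ((norm_sub_le _ _).trans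
      (add_le_add ((hobs θ).bound _ hh) ((hobs θ).bound _ hh'))) hC

theorem exists_fderiv_V_gradQ_le : ∃ C : ℝ, ∀ θ, ∀ h ∈ M.R,
    DifferentiableAt ℝ (fun θ' => M.V M.gradQ θ' h) θ ∧
      ‖fderiv ℝ (fun θ' => M.V M.gradQ θ' h) θ‖ ≤ C := by
  obtain ⟨Λ, D, b, K, Cy, hS⟩ := exists_system hM hd hN
  obtain ⟨K', hO⟩ := exists_obsData hM (Λ := Λ) contDiff_gradObs
  obtain ⟨L', C, hL, hLC, -, hres⟩ := exists_derivatives hS hM hd hN hO isFirstOrder_gradObs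
  have hobs := fun θ => hO.observable (E := M.noiseSet) (U := Input d dZ) (hS.jet_mem θ)
  have hmean : ∀ θ, ‖M.meanGrad θ‖ ≤ K' := by
    intro θ
    have hμ := hM.stationary_spec hd hN θ
    have := hμ.1
    exact (hobs θ).norm_integral_le hμ.2.1
  set p := ‖pairingL (d := d) (N := N)‖
  refine ⟨p * K' * C + p * C * C, fun θ h hh => ?_⟩
  rw [M.R_eq_region] at hh
  obtain ⟨hV, r', hr', hVd⟩ := hres θ h hh
  have hK0 := hO.unif.nonneg
  have hC0 : 0 ≤ C := (norm_nonneg _).trans hr'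
  have h1 : HasFDerivAt (fun θ' => pairingL (M.meanGrad θ')) (pairingL.comp (L' θ)) θ :=
    pairingL.hasFDerivAt.comp θ (hL θ)
  have h2 := h1.clm_apply hVd
  have h3 : (fun θ' => M.V M.gradQ θ' h)
      = fun θ' => pairingL (M.meanGrad θ') (M.gradResolvent θ' h) :=
    funext fun θ' => V_gradQ_eq hM hd hN θ' hh
  rw [h3]
  refine ⟨h2.differentiableAt, ?_⟩
  rw [show fderiv ℝ (fun θ' => pairingL (M.meanGrad θ') (M.gradResolvent θ' h)) θ = _ from h2.fderiv]
  refine (norm_add_le _ _).trans (add_le_add ?_ ?_)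
  · refine (ContinuousLinearMap.opNorm_comp_le _ _).trans
      (mul_le_mul ?_ hr' (norm_nonneg _) (by positivity))
    exact pairingL.le_opNorm_of_le (hmean θ)
  · refine (ContinuousLinearMap.le_opNorm_of_le _ hV).trans
      (mul_le_mul_of_nonneg_right ?_ hC0)
    rw [ContinuousLinearMap.opNorm_flip]
    exact (ContinuousLinearMap.opNorm_comp_le _ _).trans
      (mul_le_mul_of_nonneg_left (hLC θ) (norm_nonneg _))

end Loss

end RNN

end

theorem lemmaL {d dZ N : ℕ} (hd : 0 < d) (hN : 0 < N)
    (M : RNN.Model d dZ N) (hM : M.Assumptions) :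
    -- the stationary distribution exists and is unique
    (∀ θ, ∃! μ, M.IsStationary θ μ) ∧
    -- the Poisson equation for a uniformly Lipschitz right-hand side
    (∀ Q : RNN.Params d N → RNN.State d dZ N → ℝ, M.UnifLipschitz Q →
      (Bornology.IsBounded M.noiseSet ∨ M.BoundedNoiseOsc Q) →
      M.SeriesConverges Q ∧ M.SolvesPoisson Q (M.V Q) ∧
        M.UnifBounded (M.V Q) ∧ M.UnifLipschitz (M.V Q)) ∧
    -- the case of `Q = ∇L^⊤ g^θ`
    (Differentiable ℝ M.loss ∧
      M.SeriesConverges M.gradQ ∧ M.SolvesPoisson M.gradQ (M.V M.gradQ) ∧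
      M.UnifBounded (M.V M.gradQ) ∧ M.UnifLipschitz (M.V M.gradQ) ∧
      ∃ C : ℝ, ∀ θ, ∀ h ∈ M.R,
        DifferentiableAt ℝ (fun θ' => M.V M.gradQ θ' h) θ ∧
          ‖fderiv ℝ (fun θ' => M.V M.gradQ θ' h) θ‖ ≤ C) := by
  obtain ⟨hL, hO⟩ := RNN.unifLipschitz_and_boundedNoiseOsc_gradQ hM hd hN
  obtain ⟨h1, h2, h3, h4⟩ := hM.poisson hd hN hL hO
  refine ⟨hM.existsUnique_isStationary hd hN, fun Q hQ hE => ?_,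
    fun θ => (RNN.hasFDerivAt_loss hM hd hN θ).differentiableAt, h1, h2, h3, h4,
    RNN.exists_fderiv_V_gradQ_le hM hd hN⟩
  exact hM.poisson hd hN hQ (hE.elim hQ.boundedNoiseOsc id)
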